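/- Let $\mathfrak h$ be a finite-dimensional complex vector space and $W\subset GL(\mathfrak h)$ a finite subgroup. Let $S\subset W$ be the set of reflections, i.e. of elements $s$ with $\mathrm{rk}(s-1)=1$, and let $\mathbb C[S]^W$ be the set of $W$-invariant (under conjugation) functions $c:S\to\mathbb C$. For $s\in S$ let $\alpha_s\in\mathfrak h^*$ and $\alpha_s^\vee\in\mathfrak h$ be generators of $\mathrm{Im}(s|_{\mathfrak h^*}-1)$ and $\mathrm{Im}(s|_{\mathfrak h}-1)$ with $(\alpha_s,\alpha_s^\vee)=2$. For $c\in\mathbb C[S]^W$ the rational Cherednik algebra $H_c=H_c(W,\mathfrak h)$ is the quotient of $\mathbb CW\ltimes T(\mathfrak h\oplus\mathfrak h^*)$ by the relations $$[x,x']=0,\quad [y,y']=0,\quad [y,x]=(y,x)-\sum_{s\in S}c_s\,(y,\alpha_s)(x,\alpha_s^\vee)\,s\qquad(x,x'\in\mathfrak h^*,\ y,y'\in\mathfrak h).$$ Let $\mathcal O_c(W,\mathfrak h)_0$ be the category of $H_c$-modules that are finitely generated over $\mathbb C[\mathfrak h]=S\mathfrak h^*$ and on which $\mathfrak h$ acts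 locally nilpotently, and let $e_W=\frac1{|W|}\sum_{w\in W}w$. An $H_c$-module $M\neq0$ is called aspherical if $e_WM=0$. Let $\Sigma(W,\mathfrak h)$ be the set of $c\in\mathbb C[S]^W$ for which $\mathcal O_c(W,\mathfrak h)_0$ contains an aspherical module (such $c$ are called aspherical), and let $FDA(W,\mathfrak h)$ be the set of $c$ for which $H_c$ has a finite-dimensional aspherical module. A parabolic subgroup of $W$ is the stabilizer of a point of $\mathfrak h$. For a parabolic subgroup $W'$ let $\Sigma'(W',\mathfrak h/\mathfrak h^{W'})\subset\mathbb C[S]^W$ be the preimage of $\Sigma(W',\mathfrak h/\mathfrak h^{W'})$ under the restriction of functions $c\mapsto c'=c|_{S\cap W'}$ (here $S\cap W'$ is also the set of reflections of $W'$ acting on $\mathfrak h/\mathfrak h^{W'}$). Then: (i) $c\in\Sigma(W,\mathfrak h)$ if and only if $H_ce_WH_c\neq H_c$. (ii) $$\Sigma(W,\mathfrak h)=FDA(W,\mathfrak h)\cup\bigcup_{W'}\Sigma'(W',\mathfrak h/\mathfrak h^{W'}),$$ where $W'$ runs over all parabolic subgroups of $W$. Moreover, if $\mathfrak h^W=0$,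 the same equality holds with $W'$ running over the proper parabolic subgroups $W'\neq W$ only. -/

import Mathlib

/-!
Rational Cherednik algebras `H_c(W, 𝔥)` of a finite group `W` acting linearly on a complex vector
space `𝔥 = V` through `ρ : Representation ℂ W V`.
-/

universe u v

noncomputable section

namespace Cherednik

variable {W : Type u} [Group W] {V : Type v} [AddCommGroup V] [Module ℂ V]

/-- The set `S` of reflections: the elements `s` with `rk (s - 1) = 1` on `𝔥`. -/
def reflections (ρ : Representation ℂ W V) : Set W :=
  {s | Module.finrank ℂ (LinearMap.range (ρ s - 1)) = 1}

/-- A vector of `Im (s - 1)` that is fixed by `s` vanishes. -/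
theorem eq_zero_of_fixed [Finite W] (ρ : Representation ℂ W V) (s : W) {u v : V}
    (h : ρ s v - v = u) (hu : ρ s u = u) : u = 0 := by
  have key : ∀ k : ℕ, ρ (s ^ k) v = v + (k : ℂ) • u := by
    intro k
    induction k with
    | zero => simp
    | succ k ih =>
      rw [pow_succ', map_mul, Module.End.mul_apply, ih, map_add, map_smul, hu,
        sub_eq_iff_eq_add.mp h]
      push_cast
      module
  have h1 := key (orderOf s)
  rw [pow_orderOf_eq_one, map_one, Module.End.one_apply, left_eq_add, smul_eq_zero] at h1
  rcases h1 with h1 | h1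
  · exact absurd (Nat.cast_eq_zero.mp h1) (isOfFinOrder_of_finite s).orderOf_pos.ne'
  · exact h1

/-- For a reflection `s` there are generators `α_s` of `Im (s|_{𝔥*} - 1)` and `α_s^∨` of
`Im (s|_𝔥 - 1)` with `(α_s, α_s^∨) = 2`. -/
theorem exists_root [Finite W] (ρ : Representation ℂ W V) (s : reflections ρ) :
    ∃ p : Module.Dual ℂ V × V,
      Submodule.span ℂ {p.1} = LinearMap.range (ρ.dual s.1 - 1) ∧
      Submodule.span ℂ {p.2} = LinearMap.range (ρ s.1 - 1) ∧ p.1 p.2 = 2 := by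
  obtain ⟨s, hs⟩ := s
  obtain ⟨⟨u, hur⟩, hu0, hu⟩ := finrank_eq_one_iff'.mp hs
  have hu0' : u ≠ 0 := fun h => hu0 (Subtype.ext h)
  have hspan : Submodule.span ℂ {u} = LinearMap.range (ρ s - 1) := by
    apply le_antisymm
    · rwa [Submodule.span_singleton_le_iff_mem]
    · intro w hw
      obtain ⟨c, hc⟩ := hu ⟨w, hw⟩
      exact Submodule.mem_span_singleton.mpr ⟨c, congrArg Subtype.val hc⟩
  obtain ⟨ψ, hψ⟩ := Module.Projective.exists_dual_ne_zero ℂ hu0'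
  -- `φ` is the functional with `(s - 1) v = φ v • u`
  set φ : Module.Dual ℂ V := (ψ u)⁻¹ • (ψ ∘ₗ (ρ s - 1)) with hφ
  have hs1 : ∀ v, ρ s v - v = φ v • u := by
    intro v
    have : ρ s v - v ∈ Submodule.span ℂ {u} := hspan ▸ ⟨v, rfl⟩
    obtain ⟨a, ha⟩ := Submodule.mem_span_singleton.mp this
    have : φ v = a := by
      simp only [hφ, LinearMap.smul_apply, LinearMap.comp_apply, LinearMap.sub_apply,
        Module.End.one_apply, ← ha, map_smul, smul_eq_mul]
      field_simp
    rw [this, ha]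
  obtain ⟨v, hv⟩ := hur
  have hφu : φ u ≠ 0 := by
    intro h
    refine hu0' (eq_zero_of_fixed ρ s (v := v) hv ?_)
    have := hs1 u
    rwa [h, zero_smul, sub_eq_zero] at this
  have hinv : ∀ w, ρ s (ρ s⁻¹ w) = w := fun w => by
    rw [← Module.End.mul_apply, ← map_mul, mul_inv_cancel, map_one, Module.End.one_apply]
  have hinv' : ∀ w, ρ s⁻¹ (ρ s w) = w := fun w => by
    rw [← Module.End.mul_apply, ← map_mul, inv_mul_cancel, map_one, Module.End.one_apply]
  have hdual : ∀ x : Module.Dual ℂ V, (ρ.dual s - 1) x = (-(x (ρ s⁻¹ u))) • φ := by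
    intro x
    ext w
    have h := congrArg (fun z => x (ρ s⁻¹ z)) (hs1 w)
    simp only [map_sub, hinv', map_smul, smul_eq_mul] at h
    simp only [LinearMap.sub_apply, Module.End.one_apply, Representation.dual_apply,
      LinearMap.smul_apply, smul_eq_mul, Module.Dual.transpose_apply, LinearMap.comp_apply]
    linear_combination -h
  have hu1 : ρ s⁻¹ u ≠ 0 := fun h => hu0' (by rw [← hinv u, h, map_zero])
  refine ⟨((2 * (φ u)⁻¹) • φ, u), ?_, hspan, ?_⟩
  · apply le_antisymm
    · rw [Submodule.span_singleton_le_iff_mem]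
      obtain ⟨x, hx⟩ := Module.Projective.exists_dual_ne_zero ℂ hu1
      refine Submodule.smul_mem _ _ ?_
      refine ⟨(-(x (ρ s⁻¹ u)))⁻¹ • x, ?_⟩
      rw [map_smul, hdual, smul_smul, inv_mul_cancel₀ (neg_ne_zero.mpr hx), one_smul]
    · rintro _ ⟨x, rfl⟩
      rw [hdual]
      refine Submodule.mem_span_singleton.mpr ⟨-(x (ρ s⁻¹ u)) * (2 * (φ u)⁻¹)⁻¹, ?_⟩
      rw [smul_smul, inv_mul_cancel_right₀ (mul_ne_zero two_ne_zero (inv_ne_zero hφu))]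
  · simp [hφu]

/-- `α_s ∈ 𝔥*`. Only `α_s ⊗ α_s^∨` is used below; it does not depend on the choice. -/
def root [Finite W] (ρ : Representation ℂ W V) (s : reflections ρ) : Module.Dual ℂ V :=
  (exists_root ρ s).choose.1

/-- `α_s^∨ ∈ 𝔥`. -/
def coroot [Finite W] (ρ : Representation ℂ W V) (s : reflections ρ) : V :=
  (exists_root ρ s).choose.2

/-- Parameters: the `W`-invariant functions `c : S → ℂ`, that is, the set `ℂ[S]^W`. -/
def Parameter (ρ : Representation ℂ W V) : Type u :=
  {c : reflections ρ → ℂ //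
    ∀ (g : W) (s t : reflections ρ), (t : W) = g * s * g⁻¹ → c t = c s}

/-- Generators of the rational Cherednik algebra: `w ∈ W`, `x ∈ 𝔥*` and `y ∈ 𝔥`. -/
inductive Gen (W : Type u) (V : Type v) [AddCommGroup V] [Module ℂ V] : Type (max u v)
  | w (g : W)
  | x (a : Module.Dual ℂ V)
  | y (b : V)

open FreeAlgebra in
/-- Defining relations. All but the last three present `ℂW ⋉ T(𝔥 ⊕ 𝔥*)`; the last three are
`[x, x'] = 0`, `[y, y'] = 0` and `[y, x] = (y, x) - ∑ c_s (y, α_s) (x, α_s^∨) s`. -/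
inductive Rel [Finite W] (ρ : Representation ℂ W V) (c : Parameter ρ) :
    FreeAlgebra ℂ (Gen W V) → FreeAlgebra ℂ (Gen W V) → Prop
  | w_one : Rel ρ c (ι ℂ (.w 1)) 1
  | w_mul (g h : W) : Rel ρ c (ι ℂ (.w (g * h))) (ι ℂ (.w g) * ι ℂ (.w h))
  | x_add (a a' : Module.Dual ℂ V) :
      Rel ρ c (ι ℂ (.x (a + a'))) (ι ℂ (.x a) + ι ℂ (.x a'))
  | x_smul (r : ℂ) (a : Module.Dual ℂ V) : Rel ρ c (ι ℂ (.x (r • a))) (r • ι ℂ (.x a))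
  | y_add (b b' : V) : Rel ρ c (ι ℂ (.y (b + b'))) (ι ℂ (.y b) + ι ℂ (.y b'))
  | y_smul (r : ℂ) (b : V) : Rel ρ c (ι ℂ (.y (r • b))) (r • ι ℂ (.y b))
  | w_x (g : W) (a : Module.Dual ℂ V) :
      Rel ρ c (ι ℂ (.w g) * ι ℂ (.x a)) (ι ℂ (.x (ρ.dual g a)) * ι ℂ (.w g))
  | w_y (g : W) (b : V) :
      Rel ρ c (ι ℂ (.w g) * ι ℂ (.y b)) (ι ℂ (.y (ρ g b)) * ι ℂ (.w g))
  | x_comm (a a' : Module.Dual ℂ V) :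
      Rel ρ c (ι ℂ (.x a) * ι ℂ (.x a')) (ι ℂ (.x a') * ι ℂ (.x a))
  | y_comm (b b' : V) : Rel ρ c (ι ℂ (.y b) * ι ℂ (.y b')) (ι ℂ (.y b') * ι ℂ (.y b))
  | y_x (b : V) (a : Module.Dual ℂ V) :
      Rel ρ c (ι ℂ (.y b) * ι ℂ (.x a) - ι ℂ (.x a) * ι ℂ (.y b))
        (algebraMap ℂ _ (a b) -
          ∑ᶠ s : reflections ρ, (c.1 s * root ρ s b * a (coroot ρ s)) • ι ℂ (.w (s : W)))

/-- The rational Cherednik algebra `H_c(W, 𝔥)`. -/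
abbrev H [Finite W] (ρ : Representation ℂ W V) (c : Parameter ρ) : Type (max u v) :=
  RingQuot (Rel ρ c)

section

variable [Finite W] (ρ : Representation ℂ W V) (c : Parameter ρ)

/-- The image of a generator in `H_c(W, 𝔥)`. -/
def gen (z : Gen W V) : H ρ c := RingQuot.mkAlgHom ℂ (Rel ρ c) (FreeAlgebra.ι ℂ z)

/-- The idempotent `e_W = |W|⁻¹ ∑ w`. -/
def idem : H ρ c := (Nat.card W : ℂ)⁻¹ • ∑ᶠ g : W, gen ρ c (.w g)

/-- The subalgebra `ℂ[𝔥] = S𝔥*` of `H_c(W, 𝔥)`, generated by `𝔥*`. -/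
def polySubalgebra : Subalgebra ℂ (H ρ c) :=
  Algebra.adjoin ℂ (Set.range fun a : Module.Dual ℂ V => gen ρ c (.x a))

/-- The two-sided ideal `H_c e_W H_c`: the span of the products `a * e_W * b`. -/
def sphericalIdeal : Submodule ℂ (H ρ c) := ⊤ * Submodule.span ℂ {idem ρ c} * ⊤

/-- Membership in the category `𝒪_c(W, 𝔥)_0`: finitely generated over `ℂ[𝔥]` and locally
nilpotent under the action of `𝔥`. -/
def InCatO (M : Type*) [AddCommGroup M] [Module (H ρ c) M] : Prop :=
  Module.Finite (polySubalgebra ρ c) M ∧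
    ∀ (b : V) (m : M), ∃ N : ℕ, gen ρ c (.y b) ^ N • m = 0

/-- A nonzero module `M` is aspherical if `e_W M = 0`. -/
def IsAspherical (M : Type*) [AddCommGroup M] [Module (H ρ c) M] : Prop :=
  Nontrivial M ∧ ∀ m : M, idem ρ c • m = 0

end

/-- `Σ(W, 𝔥)`: the parameters `c` for which `𝒪_c(W, 𝔥)_0` contains an aspherical module. -/
def asphericalSet [Finite W] (ρ : Representation ℂ W V) : Set (Parameter ρ) :=
  {c | ∃ (M : Type (max u v)) (_ : AddCommGroup M) (_ : Module (H ρ c) M),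
    InCatO ρ c M ∧ IsAspherical ρ c M}

/-- `FDA(W, 𝔥)`: the parameters `c` for which `H_c(W, 𝔥)` has a finite dimensional aspherical
representation. -/
def fdaSet [Finite W] (ρ : Representation ℂ W V) : Set (Parameter ρ) :=
  {c | ∃ (M : Type (max u v)) (_ : AddCommGroup M) (_ : Module ℂ M) (_ : Module (H ρ c) M)
    (_ : IsScalarTower ℂ (H ρ c) M), FiniteDimensional ℂ M ∧ IsAspherical ρ c M}

/-- A parabolic subgroup is the stabilizer of a point of `𝔥`. -/
def IsParabolic (ρ : Representation ℂ W V) (P : Subgroup W) : Prop :=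
  ∃ b : V, ∀ g : W, g ∈ P ↔ ρ g b = b

/-- The subspace `𝔥^{W'}` of vectors fixed by a subgroup `W'`. -/
def fixedSpace (ρ : Representation ℂ W V) (P : Subgroup W) : Submodule ℂ V :=
  Representation.invariants (ρ.comp P.subtype : Representation ℂ P V)

theorem fixedSpace_le_comap (ρ : Representation ℂ W V) (P : Subgroup W) (g : P) :
    fixedSpace ρ P ≤ (fixedSpace ρ P).comap ((ρ.comp P.subtype) g) := by
  intro v hv
  have h : (ρ.comp P.subtype) g v = v := hv g
  rw [Submodule.mem_comap, h]
  exact hv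

/-- The action of a subgroup `W'` of `W` on `𝔥 / 𝔥^{W'}`. -/
def quotRep (ρ : Representation ℂ W V) (P : Subgroup W) :
    Representation ℂ P (V ⧸ fixedSpace ρ P) :=
  Representation.quotient (ρ.comp P.subtype) (fixedSpace ρ P) (fixedSpace_le_comap ρ P)

/-- An element of `W'` that is a reflection on `𝔥 / 𝔥^{W'}` is a reflection on `𝔥`, and
conversely. -/
theorem mem_reflections_quotRep [Finite W] (ρ : Representation ℂ W V) (P : Subgroup W) (s : P) :
    s ∈ reflections (quotRep ρ P) ↔ (s : W) ∈ reflections ρ := by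
  set F := fixedSpace ρ P
  have hr : LinearMap.range (quotRep ρ P s - 1) =
      LinearMap.range (F.mkQ.domRestrict (LinearMap.range (ρ (s : W) - 1))) := by
    have hmk : ∀ v : V, (quotRep ρ P s - 1) (F.mkQ v) = F.mkQ ((ρ (s : W) - 1) v) :=
      fun v => rfl
    apply le_antisymm
    · rintro _ ⟨q, rfl⟩
      obtain ⟨v, rfl⟩ := F.mkQ_surjective q
      exact ⟨⟨_, ⟨v, rfl⟩⟩, (hmk v).symm⟩
    · rintro _ ⟨⟨_, ⟨v, rfl⟩⟩, rfl⟩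
      exact ⟨F.mkQ v, hmk v⟩
  have hinj : Function.Injective (F.mkQ.domRestrict (LinearMap.range (ρ (s : W) - 1))) := by
    rw [← LinearMap.ker_eq_bot, LinearMap.ker_eq_bot']
    rintro ⟨u, ⟨v, hv⟩⟩ h
    have hu : u ∈ F := by simpa using h
    exact Subtype.ext (eq_zero_of_fixed ρ (s : W) (v := v) hv (hu s))
  simp only [reflections, Set.mem_ofPred_eq]
  rw [hr, LinearMap.finrank_range_of_inj hinj]

/-- The restriction map `c ↦ c'` to the reflections of a subgroup `W'`, acting on
`𝔥 / 𝔥^{W'}`. -/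
def Parameter.restrict [Finite W] {ρ : Representation ℂ W V} (P : Subgroup W) (c : Parameter ρ) :
    Parameter (quotRep ρ P) :=
  ⟨fun s => c.1 ⟨((s : P) : W), (mem_reflections_quotRep ρ P s).mp s.2⟩,
    fun g s t h => c.2 g ⟨_, (mem_reflections_quotRep ρ P s).mp s.2⟩
      ⟨_, (mem_reflections_quotRep ρ P t).mp t.2⟩ (by simp [h])⟩

end Cherednik

end

noncomputable section

namespace Cherednik

variable {W : Type u} [Group W] {V : Type v} [AddCommGroup V] [Module ℂ V]

/-! ### Roots and the intrinsic form of the commutation relation -/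

/-! Everything is reduced to the ideal `H e H`. It is proper as soon as the relations of `H_c` can
be realized in some nonzero algebra with `∑ w = 0`, and no finiteness of that algebra is needed.
Restriction and induction between `W` and a parabolic subgroup can therefore be done on arbitrarily
large modules, without completions.

(i) A nonzero module killed by `e` shows that `H e H` is proper. Conversely, let `A = H / H e H` be
nonzero. The candidate module is `H / (H e H + H 𝔥) = A / A 𝔥`; the triangular decomposition puts it
in category `𝒪`, and the point is that it is nonzero (`Triangular.one_notMem_span`). The algebra `A`
is finitely generated over the commutative algebra `C` of operators generated by left
multiplications by `𝔥*` and right multiplications by `𝔥`. If `A 𝔥 = A`, Nakayama's lemma places the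
identity of `A` in the ideal of `C` generated by right multiplications by `𝔥`. The grading by the
Euler element forbids this, since that ideal lives in nonzero degrees. The same argument works with
`𝔥*` in place of `𝔥`.

(ii), from a parabolic `W' = Stab(b)` to `W`: an aspherical realization for `𝔥/𝔥^{W'}` is extended
to `𝔥` by multiplication and differentiation operators along `𝔥^{W'}`. The argument of (i), applied
to `𝔥*` translated by the `W'`-fixed point `b`, yields a nonzero module on which `ℂ[𝔥]` has the
single generalized weight `b`. There every root of a reflection moving `b` is invertible, so a
Dunkl-type formula lets `𝔥` act on the equivariant functions from `W` to this module
(`Realization.induce`).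

(ii), from `W` to a parabolic: a module finitely generated over `ℂ[𝔥]` is finite dimensional or has
a nonzero fiber at some `b ≠ 0`. In the second case a functional on the fiber is a weight vector in
the dual module. The generalized weight space at `b` carries an action of the algebra of `Stab(b)`,
in which `y ∈ 𝔥` acts by its `b`-component (`Realization.restrict`). A second dualization restores
the parameter. If `𝔥^W = 0`, the stabilizer of `b ≠ 0` is proper. If `W' = W` is allowed, passing
from `𝔥` to `𝔥/𝔥^W` already suffices.

In both constructions the hard relation is `[y, y'] = 0`. The cross terms are indexed by
factorizations `g = s t` with `g` fixing `b` and `s`, `t` moving it, and they cancel by the rank two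
identity `Coupling.sum_wedge_eq_zero`. -/

theorem root_coroot [Finite W] (ρ : Representation ℂ W V) (s : reflections ρ) :
    root ρ s (coroot ρ s) = 2 :=
  (exists_root ρ s).choose_spec.2.2

theorem coroot_ne_zero [Finite W] (ρ : Representation ℂ W V) (s : reflections ρ) :
    coroot ρ s ≠ 0 := by
  intro h
  have := root_coroot ρ s
  rw [h, map_zero] at this
  exact two_ne_zero this.symm

theorem exists_smul_coroot [Finite W] (ρ : Representation ℂ W V) (s : reflections ρ) (v : V) :
    ∃ a : ℂ, a • coroot ρ s = ρ s.1 v - v := by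
  have h : ρ s.1 v - v ∈ Submodule.span ℂ {coroot ρ s} := by
    rw [coroot, (exists_root ρ s).choose_spec.2.1]
    exact ⟨v, rfl⟩
  exact Submodule.mem_span_singleton.mp h

theorem exists_coroot_eq [Finite W] (ρ : Representation ℂ W V) (s : reflections ρ) :
    ∃ v : V, ρ s.1 v - v = coroot ρ s := by
  have h : coroot ρ s ∈ LinearMap.range (ρ s.1 - 1) :=
    (exists_root ρ s).choose_spec.2.1 ▸ Submodule.mem_span_singleton_self (coroot ρ s)
  exact h

theorem root_eq_zero_of_fixed [Finite W] (ρ : Representation ℂ W V) (s : reflections ρ) {v : V}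
    (hv : ρ s.1 v = v) : root ρ s v = 0 := by
  have h : root ρ s ∈ LinearMap.range (ρ.dual s.1 - 1) :=
    (exists_root ρ s).choose_spec.1 ▸ Submodule.mem_span_singleton_self (root ρ s)
  obtain ⟨x, hx⟩ := h
  have hv' : ρ s.1⁻¹ v = v := by
    conv_lhs => rw [← hv]
    rw [← Module.End.mul_apply, ← map_mul, inv_mul_cancel, map_one, Module.End.one_apply]
  rw [← hx]
  simp [Representation.dual_apply, Module.Dual.transpose_apply, hv']

/-- The scalar `θ = 2 / (1 - λ)`, where `λ` is the nontrivial eigenvalue of `s`. -/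
theorem exists_theta [Finite W] (ρ : Representation ℂ W V) (s : reflections ρ) :
    ∃ θ : ℂ, θ ≠ 0 ∧ ∀ v, root ρ s v • coroot ρ s = θ • (v - ρ s.1 v) := by
  obtain ⟨a, ha⟩ := exists_smul_coroot ρ s (coroot ρ s)
  have ha0 : a ≠ 0 := by
    rintro rfl
    rw [zero_smul, eq_comm, sub_eq_zero] at ha
    obtain ⟨v, hv⟩ := exists_coroot_eq ρ s
    exact coroot_ne_zero ρ s (eq_zero_of_fixed ρ s.1 hv ha)
  -- The coroot is an eigenvector of `s` with eigenvalue `λ = 1 + a`, so `-2 / a = 2 / (1 - λ)`.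
  refine ⟨-2 / a, div_ne_zero (by norm_num) ha0, fun v => ?_⟩
  obtain ⟨r, hr⟩ := exists_smul_coroot ρ s v
  -- Subtracting this multiple of the coroot projects `v` onto the vectors fixed by `s`, where the
  -- root vanishes.
  have hw : root ρ s (v - (r / a) • coroot ρ s) = 0 := by
    apply root_eq_zero_of_fixed
    rw [map_sub, map_smul, ← sub_add_cancel (ρ s.1 (coroot ρ s)) (coroot ρ s), ← ha,
      ← sub_add_cancel (ρ s.1 v) v, ← hr, smul_add, smul_smul, div_mul_cancel₀ _ ha0]
    abel
  rw [map_sub, map_smul, root_coroot, sub_eq_zero] at hw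
  rw [← neg_sub, ← hr, hw, smul_neg, smul_smul, ← neg_smul, smul_eq_mul]
  congr 1
  ring

/-- The scalar `2 / (1 - λ)` attached to a reflection. -/
def theta [Finite W] (ρ : Representation ℂ W V) (s : reflections ρ) : ℂ :=
  (exists_theta ρ s).choose

theorem theta_ne_zero [Finite W] (ρ : Representation ℂ W V) (s : reflections ρ) :
    theta ρ s ≠ 0 :=
  (exists_theta ρ s).choose_spec.1

/-- Eliminates the choice of roots: the coefficient `c_s (y, α_s)(x, α_s^∨)` becomes `c_s θ_s (x, y
- s y)`, the form in which the commutation relation is used from here on. -/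
theorem root_smul_coroot [Finite W] (ρ : Representation ℂ W V) (s : reflections ρ) (v : V) :
    root ρ s v • coroot ρ s = theta ρ s • (v - ρ s.1 v) :=
  (exists_theta ρ s).choose_spec.2 v

theorem sub_apply_eq [Finite W] (ρ : Representation ℂ W V) (s : reflections ρ) (v : V) :
    v - ρ s.1 v = root ρ s v • (theta ρ s)⁻¹ • coroot ρ s := by
  rw [smul_comm, root_smul_coroot, smul_smul, inv_mul_cancel₀ (theta_ne_zero ρ s), one_smul]

theorem apply_coroot [Finite W] (ρ : Representation ℂ W V) (s : reflections ρ) :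
    ρ s.1 (coroot ρ s) = (1 - 2 * (theta ρ s)⁻¹) • coroot ρ s := by
  have h := sub_apply_eq ρ s (coroot ρ s)
  rw [root_coroot, smul_smul, sub_eq_iff_eq_add] at h
  rw [sub_smul, one_smul, eq_sub_iff_add_eq, add_comm]
  exact h.symm

/-- The scalar `θ` is determined by the eigenvalue `1 - 2/θ` on the coroot line, and `f` carries one
coroot line onto the other. Applied to conjugate reflections and to the projection `𝔥 → 𝔥/𝔥^{W'}`.
-/
theorem theta_eq_of_intertwine [Finite W] {W' : Type*} [Group W'] [Finite W'] {V' : Type*}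
    [AddCommGroup V'] [Module ℂ V'] (ρ : Representation ℂ W V) (ρ' : Representation ℂ W' V')
    (s : reflections ρ) (s' : reflections ρ') (f : V →ₗ[ℂ] V')
    (hf : ∀ v, f (ρ s.1 v) = ρ' s'.1 (f v)) (h0 : f (coroot ρ s) ≠ 0) :
    theta ρ s = theta ρ' s' := by
  obtain ⟨w, hw⟩ := exists_coroot_eq ρ s
  obtain ⟨r, hr⟩ := exists_smul_coroot ρ' s' (f w)
  have hu : f (coroot ρ s) = r • coroot ρ' s' := by rw [hr, ← hw, map_sub, hf]
  have h1 := hf (coroot ρ s)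
  rw [apply_coroot, map_smul, hu, map_smul, apply_coroot, smul_comm r] at h1
  rw [hu] at h0
  have h3 := smul_left_injective ℂ h0 h1
  have h4 : (theta ρ s)⁻¹ = (theta ρ' s')⁻¹ := by linear_combination -h3 / 2
  exact inv_injective h4

/-! ### Realizations of the defining relations -/

/-- A coupling: conjugation invariant weights supported on elements of the form
`v ↦ v - α v • β`, together with the weights `k'` of the opposite algebra. -/
structure Coupling (ρ : Representation ℂ W V) where
  k : W → ℂ
  k' : W → ℂ
  α : W → Module.Dual ℂ V
  β : W → V
  k_conj : ∀ h g, k (h * g * h⁻¹) = k g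
  k'_conj : ∀ h g, k' (h * g * h⁻¹) = k' g
  k_eq_zero_iff : ∀ g, k g = 0 ↔ k' g = 0
  sub_apply : ∀ g, k g ≠ 0 → ∀ v, v - ρ g v = α g v • β g
  compat : ∀ g v, k g • (v - ρ g v) = k' g • (v - ρ g⁻¹ v)

theorem conj_mem_reflections (ρ : Representation ℂ W V) (h g : W)
    (hg : g ∈ reflections ρ) : h * g * h⁻¹ ∈ reflections ρ := by
  have hmul : ρ (h * g * h⁻¹) - 1 = ρ h * (ρ g - 1) * ρ h⁻¹ := by
    rw [mul_sub, sub_mul, mul_one, map_mul, map_mul, ← map_mul ρ h h⁻¹, mul_inv_cancel, map_one]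
  have hinv : ∀ x : W, ρ x ∘ₗ ρ x⁻¹ = LinearMap.id := fun x => by
    rw [← Module.End.mul_eq_comp, ← map_mul, mul_inv_cancel, map_one]; rfl
  have hinv' : ∀ x : W, ρ x⁻¹ ∘ₗ ρ x = LinearMap.id := fun x => by
    rw [← Module.End.mul_eq_comp, ← map_mul, inv_mul_cancel, map_one]; rfl
  let e : V ≃ₗ[ℂ] V := LinearEquiv.ofLinearMap (ρ h) (ρ h⁻¹) (hinv h) (hinv' h)
  have hr : LinearMap.range (ρ (h * g * h⁻¹) - 1) =
      (LinearMap.range (ρ g - 1)).map (e : V →ₗ[ℂ] V) := by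
    rw [hmul]
    ext x
    constructor
    · rintro ⟨y, rfl⟩
      exact ⟨_, ⟨ρ h⁻¹ y, rfl⟩, rfl⟩
    · rintro ⟨_, ⟨y, rfl⟩, rfl⟩
      refine ⟨ρ h y, ?_⟩
      have : ρ h⁻¹ (ρ h y) = y := LinearMap.congr_fun (hinv' h) y
      simp only [Module.End.mul_apply, this]
      rfl
  have := (LinearEquiv.submoduleMap e (LinearMap.range (ρ g - 1))).finrank_eq
  simp only [reflections, Set.mem_ofPred_eq] at hg ⊢
  rw [hr]
  exact this.symm.trans hg

theorem conj_mem_reflections_iff (ρ : Representation ℂ W V) (h g : W) :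
    h * g * h⁻¹ ∈ reflections ρ ↔ g ∈ reflections ρ := by
  refine ⟨fun H => ?_, conj_mem_reflections ρ h g⟩
  have := conj_mem_reflections ρ h⁻¹ _ H
  simpa [mul_assoc] using this

theorem theta_conj [Finite W] (ρ : Representation ℂ W V) (h : W) (s t : reflections ρ)
    (hst : (t : W) = h * s * h⁻¹) : theta ρ t = theta ρ s := by
  refine (theta_eq_of_intertwine ρ ρ s t (ρ h) (fun v => ?_) ?_).symm
  · rw [hst, ← Module.End.mul_apply, ← Module.End.mul_apply, ← map_mul, ← map_mul,
      inv_mul_cancel_right]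
  · intro h0
    apply coroot_ne_zero ρ s
    have := congrArg (ρ h⁻¹) h0
    rwa [← Module.End.mul_apply, ← map_mul, inv_mul_cancel, map_one, map_zero] at this

open Classical in
/-- The coupling attached to a parameter `c`. -/
def Parameter.coupling [Finite W] {ρ : Representation ℂ W V} (c : Parameter ρ) : Coupling ρ where
  k g := if h : g ∈ reflections ρ then c.1 ⟨g, h⟩ * theta ρ ⟨g, h⟩ else 0
  -- With `λ = 1 - 2/θ` the eigenvalue on the coroot line, `v - s⁻¹ v = -λ⁻¹ (v - s v)`; hence `k' =
  -- -λ k` is forced by `compat`.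
  k' g := if h : g ∈ reflections ρ then
    -(1 - 2 * (theta ρ ⟨g, h⟩)⁻¹) * (c.1 ⟨g, h⟩ * theta ρ ⟨g, h⟩) else 0
  α g := if h : g ∈ reflections ρ then root ρ ⟨g, h⟩ else 0
  β g := if h : g ∈ reflections ρ then (theta ρ ⟨g, h⟩)⁻¹ • coroot ρ ⟨g, h⟩ else 0
  k_conj h g := by
    by_cases hg : g ∈ reflections ρ
    · have hg' := conj_mem_reflections ρ h g hg
      rw [dif_pos hg, dif_pos hg', c.2 h ⟨g, hg⟩ ⟨_, hg'⟩ rfl,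
        theta_conj ρ h ⟨g, hg⟩ ⟨_, hg'⟩ rfl]
    · rw [dif_neg hg, dif_neg (by rwa [conj_mem_reflections_iff])]
  k'_conj h g := by
    by_cases hg : g ∈ reflections ρ
    · have hg' := conj_mem_reflections ρ h g hg
      rw [dif_pos hg, dif_pos hg', c.2 h ⟨g, hg⟩ ⟨_, hg'⟩ rfl,
        theta_conj ρ h ⟨g, hg⟩ ⟨_, hg'⟩ rfl]
    · rw [dif_neg hg, dif_neg (by rwa [conj_mem_reflections_iff])]
  k_eq_zero_iff g := by
    by_cases hg : g ∈ reflections ρ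
    · rw [dif_pos hg, dif_pos hg, mul_eq_zero (a := -_), or_iff_right]
      intro h0
      have := apply_coroot ρ ⟨g, hg⟩
      rw [neg_eq_zero.mp h0, zero_smul] at this
      apply coroot_ne_zero ρ ⟨g, hg⟩
      have := congrArg (ρ g⁻¹) this
      rwa [← Module.End.mul_apply, ← map_mul, inv_mul_cancel, map_one, map_zero] at this
    · rw [dif_neg hg, dif_neg hg]
  sub_apply g hk v := by
    by_cases hg : g ∈ reflections ρ
    · rw [dif_pos hg, dif_pos hg]
      exact sub_apply_eq ρ ⟨g, hg⟩ v
    · rw [dif_neg hg] at hk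
      exact absurd rfl hk
  compat g v := by
    by_cases hg : g ∈ reflections ρ
    · rw [dif_pos hg, dif_pos hg]
      have h1 : ρ g (v - ρ g⁻¹ v) = ρ g v - v := by
        rw [map_sub, ← Module.End.mul_apply (ρ g) (ρ g⁻¹), ← map_mul, mul_inv_cancel, map_one,
          Module.End.one_apply]
      have h2 : ρ g (v - ρ g v) = (1 - 2 * (theta ρ ⟨g, hg⟩)⁻¹) • (v - ρ g v) := by
        rw [sub_apply_eq ρ ⟨g, hg⟩ v, map_smul, map_smul, apply_coroot ρ ⟨g, hg⟩]
        simp only [smul_smul]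
        congr 1
        ring
      have hinj : Function.Injective (ρ g) := by
        intro x y hxy
        have := congrArg (ρ g⁻¹) hxy
        simpa [← Module.End.mul_apply, ← map_mul] using this
      apply hinj
      rw [map_smul, map_smul, h1, h2, smul_smul, ← neg_sub v, smul_neg, ← neg_smul]
      congr 1
      ring
    · rw [dif_neg hg, dif_neg hg, zero_smul, zero_smul]

/-- Restriction of a coupling to a subgroup. -/
def Coupling.restrict {ρ : Representation ℂ W V} (κ : Coupling ρ) (P : Subgroup W) :
    Coupling (ρ.comp P.subtype : Representation ℂ P V) where
  k g := κ.k g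
  k' g := κ.k' g
  α g := κ.α g
  β g := κ.β g
  k_conj h g := κ.k_conj h g
  k'_conj h g := κ.k'_conj h g
  k_eq_zero_iff g := κ.k_eq_zero_iff g
  sub_apply g := κ.sub_apply g
  compat g v := κ.compat g v

/-- A realization of the relations of the rational Cherednik algebra in an algebra `A`. -/
structure Realization [Fintype W] (ρ : Representation ℂ W V) (k : W → ℂ) (A : Type*) [Ring A]
    [Algebra ℂ A] where
  T : W →* A
  X : Module.Dual ℂ V →ₗ[ℂ] A
  Y : V →ₗ[ℂ] A
  T_mul_X : ∀ g a, T g * X a = X (ρ.dual g a) * T g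
  T_mul_Y : ∀ g b, T g * Y b = Y (ρ g b) * T g
  X_comm : ∀ a a', X a * X a' = X a' * X a
  Y_comm : ∀ b b', Y b * Y b' = Y b' * Y b
  Y_X : ∀ b a, Y b * X a - X a * Y b =
    algebraMap ℂ A (a b) - ∑ g, (k g * a (b - ρ g b)) • T g

section

variable [Fintype W] {ρ : Representation ℂ W V} {k : W → ℂ} {A : Type*} [Ring A] [Algebra ℂ A]

/-- A realization is aspherical if the symmetrizer acts by zero. -/
def Realization.Aspherical (r : Realization ρ k A) : Prop := ∑ g, r.T g = 0

/-- The image of a realization under an algebra homomorphism. -/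
def Realization.map (r : Realization ρ k A) {B : Type*} [Ring B] [Algebra ℂ B] (f : A →ₐ[ℂ] B) :
    Realization ρ k B where
  T := (f : A →* B).comp r.T
  X := f.toLinearMap ∘ₗ r.X
  Y := f.toLinearMap ∘ₗ r.Y
  T_mul_X g a := by simpa using congrArg f (r.T_mul_X g a)
  T_mul_Y g a := by simpa using congrArg f (r.T_mul_Y g a)
  X_comm a a' := by simpa using congrArg f (r.X_comm a a')
  Y_comm a a' := by simpa using congrArg f (r.Y_comm a a')
  Y_X b a := by simpa using congrArg f (r.Y_X b a)

theorem Realization.Aspherical.map {r : Realization ρ k A} (hr : r.Aspherical) {B : Type*} [Ring B]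
    [Algebra ℂ B] (f : A →ₐ[ℂ] B) : (r.map f).Aspherical := by
  have := congrArg f hr
  simpa [Aspherical, Realization.map] using this

end

/-! ### `H_c` as the universal realization -/

/-- By `root_smul_coroot` each term depends only on `k = c θ`; elements outside `S` have `k = 0`, so
the sum may run over all of `W`. -/
theorem finsum_reflections_eq [Fintype W] {ρ : Representation ℂ W V} (c : Parameter ρ)
    {A : Type*} [Ring A] [Algebra ℂ A] (T : W → A) (b : V) (a : Module.Dual ℂ V) :
    (∑ᶠ s : reflections ρ, (c.1 s * root ρ s b * a (coroot ρ s)) • T (s : W)) =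
      ∑ g, (c.coupling.k g * a (b - ρ g b)) • T g := by
  classical
  rw [finsum_eq_sum_of_fintype]
  have h : ∀ s : reflections ρ, (c.1 s * root ρ s b * a (coroot ρ s)) • T (s : W) =
      (c.coupling.k s.1 * a (b - ρ s.1 b)) • T s.1 := by
    intro s
    have h1 := congrArg a (root_smul_coroot ρ s b)
    rw [map_smul, map_smul, smul_eq_mul, smul_eq_mul] at h1
    have h2 : c.coupling.k s.1 = c.1 s * theta ρ s := dif_pos s.2
    rw [h2, mul_assoc, h1, ← mul_assoc]
  refine Fintype.sum_of_injective _ Subtype.val_injective _ _ (fun g hg => ?_) h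
  have h2 : c.coupling.k g = 0 := dif_neg fun h => hg ⟨⟨g, h⟩, rfl⟩
  rw [h2, zero_mul, zero_smul]

section

variable [Fintype W] {ρ : Representation ℂ W V} (c : Parameter ρ)

theorem gen_rel {x y : FreeAlgebra ℂ (Gen W V)} (h : Rel ρ c x y) :
    RingQuot.mkAlgHom ℂ (Rel ρ c) x = RingQuot.mkAlgHom ℂ (Rel ρ c) y :=
  RingQuot.mkAlgHom_rel ℂ h

/-- The tautological realization in `H_c(W, 𝔥)`. -/
def universalRealization : Realization ρ c.coupling.k (H ρ c) where
  T :=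
    { toFun := fun g => gen ρ c (.w g)
      map_one' := by simpa [gen] using gen_rel c Rel.w_one
      map_mul' := fun g h => by simpa [gen] using gen_rel c (Rel.w_mul g h) }
  X :=
    { toFun := fun a => gen ρ c (.x a)
      map_add' := fun a b => by simpa [gen] using gen_rel c (Rel.x_add a b)
      map_smul' := fun t a => by simpa [gen] using gen_rel c (Rel.x_smul t a) }
  Y :=
    { toFun := fun a => gen ρ c (.y a)
      map_add' := fun a b => by simpa [gen] using gen_rel c (Rel.y_add a b)
      map_smul' := fun t a => by simpa [gen] using gen_rel c (Rel.y_smul t a) }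
  T_mul_X g a := by simpa [gen] using gen_rel c (Rel.w_x g a)
  T_mul_Y g a := by simpa [gen] using gen_rel c (Rel.w_y g a)
  X_comm a a' := by simpa [gen] using gen_rel c (Rel.x_comm a a')
  Y_comm a a' := by simpa [gen] using gen_rel c (Rel.y_comm a a')
  Y_X b a := by
    have h := gen_rel c (Rel.y_x b a)
    rw [finsum_reflections_eq c (fun g => FreeAlgebra.ι ℂ (Gen.w g)) b a] at h
    rw [map_sub, map_sub, map_mul, map_mul, map_sum, AlgHom.commutes] at h
    simp only [map_smul] at h
    exact h

variable {A : Type*} [Ring A] [Algebra ℂ A] {c}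

/-- The values of a realization on generators. -/
def Realization.genValue {k : W → ℂ} (r : Realization ρ k A) : Gen W V → A
  | .w g => r.T g
  | .x a => r.X a
  | .y b => r.Y b

/-- The homomorphism from `H_c(W, 𝔥)` defined by a realization. -/
def Realization.toAlgHom (r : Realization ρ c.coupling.k A) : H ρ c →ₐ[ℂ] A :=
  RingQuot.liftAlgHom ℂ ⟨FreeAlgebra.lift ℂ r.genValue, by
    intro x y h
    cases h with
    | w_one => simp [genValue]
    | w_mul g h => simp [genValue]
    | x_add a b => simp [genValue]
    | x_smul t a => simp [genValue]
    | y_add a b => simp [genValue]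
    | y_smul t a => simp [genValue]
    | w_x g a => simpa [genValue] using r.T_mul_X g a
    | w_y g a => simpa [genValue] using r.T_mul_Y g a
    | x_comm a b => simpa [genValue] using r.X_comm a b
    | y_comm a b => simpa [genValue] using r.Y_comm a b
    | y_x b a =>
      rw [finsum_reflections_eq c (fun g => FreeAlgebra.ι ℂ (Gen.w g)) b a]
      simpa [genValue] using r.Y_X b a⟩

theorem Realization.toAlgHom_gen (r : Realization ρ c.coupling.k A) (z : Gen W V) :
    r.toAlgHom (gen ρ c z) = r.genValue z := by
  simp [toAlgHom, gen]

theorem idem_eq : idem ρ c = (Nat.card W : ℂ)⁻¹ • ∑ g, gen ρ c (.w g) := by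
  rw [idem, finsum_eq_sum_of_fintype]

theorem Realization.Aspherical.toAlgHom_idem {r : Realization ρ c.coupling.k A}
    (hr : r.Aspherical) : r.toAlgHom (idem ρ c) = 0 := by
  rw [idem_eq, map_smul, map_sum]
  simp only [r.toAlgHom_gen, genValue]
  rw [show ∑ g, r.T g = 0 from hr, smul_zero]

/-- An algebra homomorphism to a nontrivial algebra that kills `e_W` shows that the spherical
ideal is proper. -/
theorem sphericalIdeal_ne_top_of_algHom [Nontrivial A] (f : H ρ c →ₐ[ℂ] A)
    (hf : f (idem ρ c) = 0) : sphericalIdeal ρ c ≠ ⊤ := by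
  intro h
  have hle : sphericalIdeal ρ c ≤ LinearMap.ker f.toLinearMap := by
    refine Submodule.mul_le.mpr fun x hx y _ => ?_
    have hx' : f x = 0 := by
      refine Submodule.mul_induction_on hx (fun m _ n hn => ?_) fun m n hm hn => ?_
      · obtain ⟨t, rfl⟩ := Submodule.mem_span_singleton.mp hn
        simp [hf]
      · rw [map_add, hm, hn, add_zero]
    simp [hx']
  have : (1 : H ρ c) ∈ LinearMap.ker f.toLinearMap := hle (h ▸ Submodule.mem_top)
  simp at this

theorem Realization.Aspherical.sphericalIdeal_ne_top [Nontrivial A]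
    {r : Realization ρ c.coupling.k A} (hr : r.Aspherical) : sphericalIdeal ρ c ≠ ⊤ :=
  sphericalIdeal_ne_top_of_algHom _ hr.toAlgHom_idem

/-! ### The quotient of `H_c` by the spherical ideal -/

variable (ρ c) in
/-- The spherical ideal as a left ideal. -/
def sphericalLeftIdeal : Ideal (H ρ c) :=
  { (sphericalIdeal ρ c).toAddSubmonoid with
    smul_mem' := fun a x hx => by
      change a * x ∈ sphericalIdeal ρ c
      have h : ⊤ * sphericalIdeal ρ c ≤ sphericalIdeal ρ c := by
        rw [sphericalIdeal, ← mul_assoc, ← mul_assoc]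
        exact mul_le_mul' (mul_le_mul' le_top le_rfl) le_rfl
      exact h (Submodule.mul_mem_mul Submodule.mem_top hx) }

theorem mem_sphericalLeftIdeal {x : H ρ c} :
    x ∈ sphericalLeftIdeal ρ c ↔ x ∈ sphericalIdeal ρ c := Iff.rfl

instance : (sphericalLeftIdeal ρ c).IsTwoSided :=
  ⟨fun {x} b hx => by
    have h : sphericalIdeal ρ c * ⊤ ≤ sphericalIdeal ρ c := by
      rw [sphericalIdeal, mul_assoc]
      exact mul_le_mul' le_rfl le_top
    exact h (Submodule.mul_mem_mul hx Submodule.mem_top)⟩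

theorem idem_mul_mem (x : H ρ c) : idem ρ c * x ∈ sphericalLeftIdeal ρ c := by
  have : 1 * idem ρ c * x ∈ sphericalIdeal ρ c :=
    Submodule.mul_mem_mul (Submodule.mul_mem_mul Submodule.mem_top
      (Submodule.mem_span_singleton_self _)) Submodule.mem_top
  rwa [one_mul] at this

theorem sphericalLeftIdeal_ne_top (h : sphericalIdeal ρ c ≠ ⊤) : sphericalLeftIdeal ρ c ≠ ⊤ := by
  intro h'
  apply h
  rw [eq_top_iff]
  intro x _
  rw [← mem_sphericalLeftIdeal, h']
  exact Submodule.mem_top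

/-- The realization in `H_c / H_c e_W H_c`. -/
def quotientRealization : Realization ρ c.coupling.k (H ρ c ⧸ sphericalLeftIdeal ρ c) :=
  (universalRealization c).map (Ideal.Quotient.mkₐ ℂ _)

theorem quotientRealization_aspherical :
    (quotientRealization : Realization ρ c.coupling.k _).Aspherical := by
  have h : Ideal.Quotient.mkₐ ℂ (sphericalLeftIdeal ρ c) (idem ρ c) = 0 := by
    rw [Ideal.Quotient.mkₐ_eq_mk, Ideal.Quotient.eq_zero_iff_mem]
    simpa using idem_mul_mem (1 : H ρ c)
  rw [idem_eq, map_smul, map_sum] at h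
  exact (smul_eq_zero.mp h).resolve_left
    (inv_ne_zero (Nat.cast_ne_zero.mpr Nat.card_pos.ne'))

theorem adjoin_gen : Algebra.adjoin ℂ (Set.range (gen ρ c)) = ⊤ := by
  have h : Set.range (gen ρ c) =
      RingQuot.mkAlgHom ℂ (Rel ρ c) '' Set.range (FreeAlgebra.ι ℂ) := by
    rw [← Set.range_comp]; rfl
  rw [h, ← AlgHom.map_adjoin, FreeAlgebra.adjoin_range_ι, Algebra.map_top,
    AlgHom.range_eq_top]
  exact RingQuot.mkAlgHom_surjective ℂ _

end

/-! ### Triangular decompositions -/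

section Triangular

variable {A : Type*} [Ring A] {W : Type*} [Group W]

theorem map_mul_map_inv (T : W →* A) (g : W) : T g * T g⁻¹ = 1 := by
  rw [← map_mul, mul_inv_cancel, map_one]

theorem map_inv_mul_map (T : W →* A) (g : W) : T g⁻¹ * T g = 1 := by
  rw [← map_mul, inv_mul_cancel, map_one]

theorem mul_eq_mul_conj (T : W →* A) (g : W) (z : A) : z * T g = T g * (T g⁻¹ * z * T g) := by
  rw [mul_assoc, ← mul_assoc (T g), map_mul_map_inv, one_mul]

theorem exists_pow_smul_add {M : Type*} [AddCommGroup M] [Module A M] {z : A} {m m' : M}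
    (hm : ∃ n : ℕ, z ^ n • m = 0) (hm' : ∃ n : ℕ, z ^ n • m' = 0) :
    ∃ n : ℕ, z ^ n • (m + m') = 0 := by
  obtain ⟨n, hn⟩ := hm
  obtain ⟨n', hn'⟩ := hm'
  refine ⟨n' + n, ?_⟩
  rw [smul_add, pow_add, mul_smul, hn, smul_zero, zero_add, ← pow_add, add_comm, pow_add,
    mul_smul, hn', smul_zero]

variable [Algebra ℂ A]

/-- Two subspaces `U`, `Z` of an algebra, normalized by a group `T`, whose commutators lie in the
span of `T`. -/
structure Triangular (T : W →* A) (U Z : Submodule ℂ A) : Prop where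
  conj_left : ∀ g, ∀ x ∈ U, T g * x * T g⁻¹ ∈ U
  conj_right : ∀ g, ∀ z ∈ Z, T g * z * T g⁻¹ ∈ Z
  commutator : ∀ z ∈ Z, ∀ x ∈ U, z * x - x * z ∈ Submodule.span ℂ (Set.range T)
  comm_left : ∀ x ∈ U, ∀ y ∈ U, x * y = y * x
  comm_right : ∀ x ∈ Z, ∀ y ∈ Z, x * y = y * x

namespace Triangular

variable {T : W →* A} {U Z : Submodule ℂ A}

theorem conj_mem_adjoin (h : Triangular T U Z) (g : W) {p : A}
    (hp : p ∈ Algebra.adjoin ℂ (U : Set A)) :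
    T g * p * T g⁻¹ ∈ Algebra.adjoin ℂ (U : Set A) := by
  induction hp using Algebra.adjoin_induction with
  | mem x hx => exact Algebra.subset_adjoin (h.conj_left g x hx)
  | algebraMap t =>
    rw [← Algebra.commutes, mul_assoc, map_mul_map_inv, mul_one]
    exact Subalgebra.algebraMap_mem _ t
  | add x y _ _ hx hy =>
    rw [mul_add, add_mul]
    exact add_mem hx hy
  | mul x y _ _ hx hy =>
    have : T g * (x * y) * T g⁻¹ = T g * x * T g⁻¹ * (T g * y * T g⁻¹) := by
      rw [mul_assoc (T g * x), ← mul_assoc (T g⁻¹), ← mul_assoc (T g⁻¹), map_inv_mul_map, one_mul]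
      simp only [mul_assoc]
    rw [this]
    exact mul_mem hx hy

theorem span_mul_adjoin_le (h : Triangular T U Z) :
    Submodule.span ℂ (Set.range T) * (Algebra.adjoin ℂ (U : Set A)).toSubmodule ≤
      (Algebra.adjoin ℂ (U : Set A)).toSubmodule * Submodule.span ℂ (Set.range T) := by
  refine Submodule.mul_le.mpr fun t ht p hp => ?_
  induction ht using Submodule.span_induction with
  | mem t ht =>
    obtain ⟨g, rfl⟩ := ht
    have : T g * p = T g * p * T g⁻¹ * T g := by
      rw [mul_assoc _ (T g⁻¹), map_inv_mul_map, mul_one]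
    rw [this]
    exact Submodule.mul_mem_mul (h.conj_mem_adjoin g hp) (Submodule.subset_span ⟨g, rfl⟩)
  | zero => rw [zero_mul]; exact zero_mem _
  | add x y _ _ hx hy => rw [add_mul]; exact add_mem hx hy
  | smul t x _ hx => rw [smul_mul_assoc]; exact Submodule.smul_mem _ _ hx

theorem span_mul_span_le (T : W →* A) :
    Submodule.span ℂ (Set.range T) * Submodule.span ℂ (Set.range T) ≤
      Submodule.span ℂ (Set.range T) := by
  rw [Submodule.span_mul_span]
  refine Submodule.span_mono ?_
  rintro _ ⟨_, ⟨g, rfl⟩, _, ⟨g', rfl⟩, rfl⟩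
  exact ⟨g * g', map_mul T g g'⟩

theorem one_mem_span (T : W →* A) : (1 : A) ∈ Submodule.span ℂ (Set.range T) :=
  Submodule.subset_span ⟨1, map_one T⟩

/-- Leibniz rule in `p`. The elements of `span T` that appear in the middle are moved to the right
at the cost of a conjugation (`span_mul_adjoin_le`). -/
theorem commutator_mem (h : Triangular T U Z) {z : A} (hz : z ∈ Z) {p : A}
    (hp : p ∈ Algebra.adjoin ℂ (U : Set A)) :
    z * p - p * z ∈
      (Algebra.adjoin ℂ (U : Set A)).toSubmodule * Submodule.span ℂ (Set.range T) := by
  induction hp using Algebra.adjoin_induction with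
  | mem x hx =>
    rw [← one_mul (z * x - x * z)]
    exact Submodule.mul_mem_mul (one_mem (Algebra.adjoin ℂ (U : Set A))) (h.commutator z hz x hx)
  | algebraMap t =>
    rw [← Algebra.commutes, sub_self]
    exact zero_mem _
  | add x y _ _ hx hy =>
    have : z * (x + y) - (x + y) * z = (z * x - x * z) + (z * y - y * z) := by noncomm_ring
    rw [this]
    exact add_mem hx hy
  | mul x y hxm hym hx hy =>
    have : z * (x * y) - x * y * z = (z * x - x * z) * y + x * (z * y - y * z) := by noncomm_ring
    rw [this]
    refine add_mem ?_ ?_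
    · have h1 := Submodule.mul_mem_mul hx (show y ∈ (Algebra.adjoin ℂ (U : Set A)).toSubmodule
        from hym)
      rw [mul_assoc] at h1
      have h2 := mul_le_mul' le_rfl h.span_mul_adjoin_le h1
      rwa [← mul_assoc, (Subalgebra.isIdempotentElem_toSubmodule _).eq] at h2
    · have h1 := Submodule.mul_mem_mul (show x ∈ (Algebra.adjoin ℂ (U : Set A)).toSubmodule
        from hxm) hy
      rwa [← mul_assoc, (Subalgebra.isIdempotentElem_toSubmodule _).eq] at h1

theorem adjoin_le_of_mul_mem {s : Set A} {N : Submodule ℂ A} (h1 : (1 : A) ∈ N)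
    (hs : ∀ x ∈ s, ∀ n ∈ N, x * n ∈ N) : (Algebra.adjoin ℂ s).toSubmodule ≤ N := by
  have key : ∀ x ∈ Algebra.adjoin ℂ s, ∀ n ∈ N, x * n ∈ N := by
    intro x hx
    induction hx using Algebra.adjoin_induction with
    | mem x hx => exact hs x hx
    | algebraMap t =>
      intro n hn
      rw [← Algebra.smul_def]
      exact N.smul_mem t hn
    | add x y _ _ hx hy =>
      intro n hn
      rw [add_mul]
      exact N.add_mem (hx n hn) (hy n hn)
    | mul x y _ _ hx hy =>
      intro n hn
      rw [mul_assoc]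
      exact hx _ (hy n hn)
  intro x hx
  simpa using key x hx 1 h1

theorem conj_right' (h : Triangular T U Z) (g : W) {z : A} (hz : z ∈ Z) :
    T g⁻¹ * z * T g ∈ Z := by
  simpa using h.conj_right g⁻¹ z hz

/-- The product space contains `1`, so it suffices that generators preserve it from the left. Only
`z ∈ Z` is not immediate: `z p g q = [z, p] g q + p g (g⁻¹ z g) q`, with `[z, p]` controlled by
`commutator_mem`. Only spanning is needed, not the linear independence in the PBW theorem. -/
theorem decomposition (h : Triangular T U Z)
    (hgen : Algebra.adjoin ℂ ((U : Set A) ∪ Z ∪ Set.range T) = ⊤) :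
    (Algebra.adjoin ℂ (U : Set A)).toSubmodule * Submodule.span ℂ (Set.range T) *
      (Algebra.adjoin ℂ (Z : Set A)).toSubmodule = ⊤ := by
  rw [eq_top_iff, ← Algebra.top_toSubmodule, ← hgen]
  set S := (Algebra.adjoin ℂ (U : Set A)).toSubmodule
  set C := Submodule.span ℂ (Set.range T)
  set R := (Algebra.adjoin ℂ (Z : Set A)).toSubmodule
  refine adjoin_le_of_mul_mem ?_ ?_
  · have : (1 : A) = 1 * 1 * 1 := by simp
    rw [this]
    exact Submodule.mul_mem_mul (Submodule.mul_mem_mul (one_mem (Algebra.adjoin ℂ (U : Set A)))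
      (one_mem_span T)) (one_mem (Algebra.adjoin ℂ (Z : Set A)))
  · have hleft : ∀ N : Submodule ℂ A, ∀ x, x ∈ N → N * (S * C * R) ≤ S * C * R →
        ∀ n ∈ S * C * R, x * n ∈ S * C * R :=
      fun N x hx hN n hn => hN (Submodule.mul_mem_mul hx hn)
    rintro x ((hx | hx) | ⟨g, rfl⟩) n hn
    · refine hleft S x (Algebra.subset_adjoin hx) ?_ n hn
      rw [← mul_assoc, ← mul_assoc, (Subalgebra.isIdempotentElem_toSubmodule _).eq]
    · refine Submodule.mul_induction_on hn (fun m hm q hq => ?_) fun m m' hm hm' => ?_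
      · refine Submodule.mul_induction_on hm (fun p hp t ht => ?_) fun m m' hm hm' => ?_
        · induction ht using Submodule.span_induction with
          | mem t ht =>
            obtain ⟨g, rfl⟩ := ht
            have e : x * (p * T g * q) = (x * p - p * x) * (T g * q) +
                p * T g * (T g⁻¹ * x * T g * q) := by
              have e' : p * T g * (T g⁻¹ * x * T g * q) = p * (x * T g) * q := by
                rw [mul_eq_mul_conj T g x]
                noncomm_ring
              rw [e']
              noncomm_ring
            rw [e]
            refine add_mem ?_ ?_
            · have := Submodule.mul_mem_mul (h.commutator_mem hx hp) (Submodule.mul_mem_mul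
                (Submodule.subset_span ⟨g, rfl⟩ : T g ∈ C) hq)
              rw [← mul_assoc, mul_assoc S] at this
              exact mul_le_mul' (mul_le_mul' le_rfl (span_mul_span_le T)) le_rfl this
            · exact Submodule.mul_mem_mul (Submodule.mul_mem_mul hp
                (Submodule.subset_span ⟨g, rfl⟩)) 
                (Subalgebra.mul_mem _ (Algebra.subset_adjoin (h.conj_right' g hx)) hq)
          | zero => simp
          | add t t' _ _ ht ht' =>
            rw [mul_add, add_mul, mul_add]
            exact add_mem ht ht'
          | smul r t _ ht =>
            rw [mul_smul_comm, smul_mul_assoc, mul_smul_comm]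
            exact Submodule.smul_mem _ _ ht
        · rw [add_mul, mul_add]
          exact add_mem hm hm'
      · rw [mul_add]
        exact add_mem hm hm'
    · refine hleft C (T g) (Submodule.subset_span ⟨g, rfl⟩) ?_ n hn
      rw [← mul_assoc, ← mul_assoc]
      refine mul_le_mul' ?_ le_rfl
      refine (mul_le_mul' h.span_mul_adjoin_le le_rfl).trans ?_
      rw [mul_assoc]
      exact mul_le_mul' le_rfl (span_mul_span_le T)

/-! ### The grading argument -/

/-- The derivation `[D, ·]` grades the picture: `L` has degree `0`, `R` has degree `1` (eigenvalue
`η`), so the product lies in degrees at least `1`. Since `1` has degree `0` and eigenspaces are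
independent, it is not there. -/
theorem one_notMem_of_graded [Nontrivial A] {D : A} {η : ℂ} (hη : η ≠ 0) {L R : Set A}
    (hL : ∀ f ∈ L, D * f = f * D) (hR : ∀ f ∈ R, D * f - f * D = η • f) :
    (1 : A) ∉ (Algebra.adjoin ℂ (L ∪ R)).toSubmodule * Submodule.span ℂ R := by
  intro hone
  let δ : Module.End ℂ A := LinearMap.mulLeft ℂ D - LinearMap.mulRight ℂ D
  have hδ : ∀ f, δ f = D * f - f * D := fun f => rfl
  let G : ℕ → Submodule ℂ A := fun n => δ.eigenspace (η * n)
  have hG : ∀ n f, f ∈ G n ↔ D * f - f * D = (η * n) • f := fun n f => by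
    rw [Module.End.mem_eigenspace_iff, hδ]
  have hGmul : ∀ m n, G m * G n ≤ G (m + n) := by
    intro m n
    refine Submodule.mul_le.mpr fun f hf g hg => ?_
    rw [hG] at hf hg ⊢
    have : D * (f * g) - f * g * D = (D * f - f * D) * g + f * (D * g - g * D) := by
      noncomm_ring
    rw [this, hf, hg, smul_mul_assoc, mul_smul_comm, ← add_smul]
    congr 1
    push_cast
    ring
  have hGR : Submodule.span ℂ R ≤ G 1 := by
    refine Submodule.span_le.mpr fun f hf => ?_
    rw [SetLike.mem_coe, hG, hR f hf, Nat.cast_one, mul_one]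
  have hC : (Algebra.adjoin ℂ (L ∪ R)).toSubmodule ≤ ⨆ n, G n := by
    intro f hf
    induction (show f ∈ Algebra.adjoin ℂ (L ∪ R) from hf) using Algebra.adjoin_induction with
    | mem x hx =>
      rcases hx with hx | hx
      · refine Submodule.mem_iSup_of_mem 0 ?_
        rw [hG, hL x hx]
        simp
      · exact Submodule.mem_iSup_of_mem 1 (hGR (Submodule.subset_span hx))
    | algebraMap t =>
      refine Submodule.mem_iSup_of_mem 0 ?_
      rw [hG, ← Algebra.commutes]
      simp
    | add x y hx hy hx' hy' => exact add_mem (hx' hx) (hy' hy)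
    | mul x y hx hy hx' hy' =>
      have := Submodule.mul_mem_mul (hx' hx) (hy' hy)
      rw [Submodule.iSup_mul] at this
      simp only [Submodule.mul_iSup] at this
      refine (show _ ≤ ⨆ n, G n from iSup_le fun m => iSup_le fun n => ?_) this
      exact (hGmul m n).trans (le_iSup G (m + n))
  have h1' : (1 : A) ∈ ⨆ n, G (n + 1) := by
    have := mul_le_mul' hC hGR hone
    rw [Submodule.iSup_mul] at this
    exact (show _ ≤ ⨆ n, G (n + 1) from
      iSup_le fun m => (hGmul m 1).trans (le_iSup (fun n => G (n + 1)) m)) this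
  have h10 : (1 : A) ∈ δ.eigenspace 0 := by
    rw [Module.End.mem_eigenspace_iff, hδ]
    simp
  have hind := (Module.End.eigenspaces_iSupIndep δ) 0
  have hsup : ⨆ n, G (n + 1) ≤ ⨆ μ, ⨆ (_ : μ ≠ 0), δ.eigenspace μ := by
    refine iSup_le fun n => ?_
    refine le_iSup₂_of_le (η * (n + 1 : ℕ)) ?_ le_rfl
    exact mul_ne_zero hη (Nat.cast_ne_zero.mpr n.succ_ne_zero)
  exact one_ne_zero (Submodule.disjoint_def.mp hind 1 h10 (hsup h1'))

theorem mulLeft_mem_adjoin {U : Set A} {p : A} (hp : p ∈ Algebra.adjoin ℂ U) :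
    LinearMap.mulLeft ℂ p ∈ Algebra.adjoin ℂ (LinearMap.mulLeft ℂ '' U) := by
  induction hp using Algebra.adjoin_induction with
  | mem x hx => exact Algebra.subset_adjoin ⟨x, hx, rfl⟩
  | algebraMap t =>
    have : LinearMap.mulLeft ℂ (algebraMap ℂ A t) = algebraMap ℂ (Module.End ℂ A) t := by
      ext a; simp [Algebra.smul_def]
    rw [this]; exact Subalgebra.algebraMap_mem _ t
  | add x y _ _ hx hy =>
    have : LinearMap.mulLeft ℂ (x + y) = LinearMap.mulLeft ℂ x + LinearMap.mulLeft ℂ y := by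
      ext a; simp [add_mul]
    rw [this]; exact add_mem hx hy
  | mul x y _ _ hx hy =>
    have : LinearMap.mulLeft ℂ (x * y) = LinearMap.mulLeft ℂ x * LinearMap.mulLeft ℂ y := by
      ext a; simp
    rw [this]; exact mul_mem hx hy

theorem mulRight_mem_adjoin {Z : Set A} {p : A} (hp : p ∈ Algebra.adjoin ℂ Z) :
    LinearMap.mulRight ℂ p ∈ Algebra.adjoin ℂ (LinearMap.mulRight ℂ '' Z) := by
  induction hp using Algebra.adjoin_induction with
  | mem x hx => exact Algebra.subset_adjoin ⟨x, hx, rfl⟩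
  | algebraMap t =>
    have : LinearMap.mulRight ℂ (algebraMap ℂ A t) = algebraMap ℂ (Module.End ℂ A) t := by
      ext a; simp [Algebra.smul_def, Algebra.commutes]
    rw [this]; exact Subalgebra.algebraMap_mem _ t
  | add x y _ _ hx hy =>
    have : LinearMap.mulRight ℂ (x + y) = LinearMap.mulRight ℂ x + LinearMap.mulRight ℂ y := by
      ext a; simp [mul_add]
    rw [this]; exact add_mem hx hy
  | mul x y _ _ hx hy =>
    have : LinearMap.mulRight ℂ (x * y) = LinearMap.mulRight ℂ y * LinearMap.mulRight ℂ x := by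
      ext a; simp
    rw [this]; exact mul_mem hy hx

/-- Nakayama in determinant form: for finitely generated `M = I M`, some element congruent to `1`
modulo `I` kills `M`, and its difference from `1` is an element of `I` acting as the identity. -/
theorem exists_mem_span_smul_eq {C : Type*} [CommRing C] [Algebra ℂ C] {M : Type*}
    [AddCommGroup M] [Module ℂ M] [Module C M] [IsScalarTower ℂ C M] {R : Set C} {s : Set M}
    (hs : s.Finite)
    (hgen : ∀ N : Submodule ℂ M, s ⊆ N → (∀ f : C, ∀ n ∈ N, f • n ∈ N) → N = ⊤)
    (hR : Submodule.span ℂ {m : M | ∃ f ∈ R, ∃ n : M, f • n = m} = ⊤) :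
    ∃ r ∈ Ideal.span R, ∀ m : M, r • m = m := by
  have hfg : (⊤ : Submodule C M).FG := by
    refine ⟨hs.toFinset, ?_⟩
    rw [Set.Finite.coe_toFinset]
    have := hgen ((Submodule.span C s).restrictScalars ℂ) Submodule.subset_span
      fun f n hn => Submodule.smul_mem (Submodule.span C s) f hn
    rwa [Submodule.restrictScalars_eq_top_iff] at this
  have hle : (⊤ : Submodule C M) ≤ Ideal.span R • ⊤ := by
    rw [← Submodule.restrictScalars_le (S := ℂ), Submodule.restrictScalars_top, ← hR]
    refine Submodule.span_le.mpr ?_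
    rintro _ ⟨f, hf, n, rfl⟩
    have hmem : f • n ∈ Ideal.span R • (⊤ : Submodule C M) :=
      Submodule.smul_mem_smul (Ideal.subset_span hf) Submodule.mem_top
    exact hmem
  obtain ⟨r, hr1, hr⟩ :=
    Submodule.exists_sub_one_mem_and_smul_eq_zero_of_fg_of_le_smul _ ⊤ hfg hle
  refine ⟨1 - r, ?_, fun m => ?_⟩
  · rw [← neg_sub]
    exact neg_mem hr1
  · rw [sub_smul, one_smul, hr m Submodule.mem_top, sub_zero]

open scoped IsMulCommutative in
/-- Nakayama's lemma for a commutative algebra of endomorphisms. -/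
theorem one_mem_mul_span_of_finite {M : Type*} [AddCommGroup M] [Module ℂ M]
    (C : Subalgebra ℂ (Module.End ℂ M)) [IsMulCommutative C] {R : Set (Module.End ℂ M)}
    (hRC : R ⊆ C) {s : Set M} (hs : s.Finite)
    (hgen : ∀ N : Submodule ℂ M, s ⊆ N → (∀ f ∈ C, ∀ n ∈ N, f n ∈ N) → N = ⊤)
    (hR : Submodule.span ℂ {m | ∃ f ∈ R, ∃ n, f n = m} = ⊤) :
    (1 : Module.End ℂ M) ∈ C.toSubmodule * Submodule.span ℂ R := by
  obtain ⟨r, hr, hr1⟩ := exists_mem_span_smul_eq (C := C) (M := M) (R := {x : C | x.1 ∈ R}) hs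
    (fun N hN h => hgen N hN fun f hf n hn => h ⟨f, hf⟩ n hn) (by
      rw [← hR]
      congr 1
      ext m
      exact ⟨fun ⟨f, hf, n, h⟩ => ⟨f.1, hf, n, h⟩,
        fun ⟨f, hf, n, h⟩ => ⟨⟨f, hRC hf⟩, hf, n, h⟩⟩)
  have h1 : r.1 = 1 := by
    ext m
    exact hr1 m
  rw [← h1]
  clear hr1 h1
  induction hr using Submodule.closure_induction with
  | zero => exact zero_mem _
  | add x y _ _ hx hy => exact add_mem hx hy
  | smul_mem r z hz => exact Submodule.mul_mem_mul r.2 (Submodule.subset_span hz)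

/-- If `ad E` acts on `Z` by a nonzero scalar, then the left ideal generated by `Z` is proper. -/
theorem one_notMem_span [Finite W] [Nontrivial A] (h : Triangular T U Z)
    (hgen : Algebra.adjoin ℂ ((U : Set A) ∪ Z ∪ Set.range T) = ⊤) {E : A} {ε : ℂ} (hε : ε ≠ 0)
    (hE : ∀ z ∈ Z, E * z - z * E = ε • z) : (1 : A) ∉ Ideal.span (Z : Set A) := by
  intro h1
  -- By the triangular decomposition the finite set of all `T g` generates `A` over the commutative
  -- algebra generated by `L` and `R`. If `1` lies in the left ideal of `Z`, then `R` maps onto `A`,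
  -- and Nakayama expresses the identity through `R`.
  set L : Set (Module.End ℂ A) := LinearMap.mulLeft ℂ '' (U : Set A) with hL
  set R : Set (Module.End ℂ A) := LinearMap.mulRight ℂ '' (Z : Set A) with hR
  have hcomm : ∀ x ∈ L ∪ R, ∀ y ∈ L ∪ R, x * y = y * x := by
    rintro _ (⟨x, hx, rfl⟩ | ⟨x, hx, rfl⟩) _ (⟨y, hy, rfl⟩ | ⟨y, hy, rfl⟩)
    · ext a; simp [← mul_assoc, h.comm_left x hx y hy]
    · ext a; simp [mul_assoc]
    · ext a; simp [mul_assoc]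
    · ext a; simp [mul_assoc, h.comm_right x hx y hy]
  have := Algebra.isMulCommutative_adjoin ℂ hcomm
  have hLmem : ∀ p ∈ Algebra.adjoin ℂ (U : Set A),
      LinearMap.mulLeft ℂ p ∈ Algebra.adjoin ℂ (L ∪ R) := fun p hp =>
    Algebra.adjoin_mono Set.subset_union_left (mulLeft_mem_adjoin hp)
  have hRmem : ∀ p ∈ Algebra.adjoin ℂ (Z : Set A),
      LinearMap.mulRight ℂ p ∈ Algebra.adjoin ℂ (L ∪ R) := fun p hp =>
    Algebra.adjoin_mono Set.subset_union_right (mulRight_mem_adjoin hp)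
  have hone : (1 : Module.End ℂ A) ∈
      (Algebra.adjoin ℂ (L ∪ R)).toSubmodule * Submodule.span ℂ R := by
    refine one_mem_mul_span_of_finite _ (fun f hf => Algebra.subset_adjoin (Or.inr hf))
      (Set.finite_range T) (fun N hN hCN => ?_) ?_
    · rw [eq_top_iff, ← h.decomposition hgen]
      refine Submodule.mul_le.mpr fun m hm q hq => ?_
      refine hCN _ (hRmem q hq) m ?_
      refine (Submodule.mul_le.mpr fun p hp t ht => ?_ :
        (Algebra.adjoin ℂ (U : Set A)).toSubmodule * Submodule.span ℂ (Set.range T) ≤ N) hm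
      exact hCN _ (hLmem p hp) t (Submodule.span_le.mpr hN ht)
    · rw [eq_top_iff]
      intro a _
      have ha : a ∈ Ideal.span (Z : Set A) := by
        rw [(Ideal.eq_top_iff_one _).mpr h1]; exact Submodule.mem_top
      refine Submodule.closure_induction (p := fun x _ => x ∈ Submodule.span ℂ
        {m | ∃ f ∈ R, ∃ n, f n = m}) ?_ ?_ ?_ ha
      · exact zero_mem _
      · exact fun x y _ _ hx hy => add_mem hx hy
      · exact fun r z hz => Submodule.subset_span ⟨_, ⟨z, hz, rfl⟩, r, rfl⟩
  -- Right multiplication by `E` commutes with all left multiplications. It reverses products, so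
  -- its commutators scale `R` by `-ε`.
  refine one_notMem_of_graded (D := LinearMap.mulRight ℂ E) (η := -ε) (neg_ne_zero.mpr hε)
    (L := L) (R := R) ?_ ?_ hone
  · rintro _ ⟨z, hz, rfl⟩
    ext a
    simp [mul_assoc]
  · rintro _ ⟨z, hz, rfl⟩
    ext a
    have := congrArg (fun x => a * x) (hE z hz)
    simp only [mul_sub, ← mul_assoc, mul_smul_comm] at this
    simp only [LinearMap.sub_apply, Module.End.mul_apply, LinearMap.mulRight_apply,
      LinearMap.smul_apply, LinearMap.neg_apply, neg_smul]
    rw [← this]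
    abel

/-! ### Local nilpotency -/

section Nilpotent

variable {M : Type*} [AddCommGroup M] [Module A M]

/-- Vectors that are locally nilpotent for `Z` are stable under the whole algebra. -/
theorem exists_pow_smul_eq_zero (h : Triangular T U Z)
    (hgen : Algebra.adjoin ℂ ((U : Set A) ∪ Z ∪ Set.range T) = ⊤) (x : A) :
    ∀ m : M, (∀ z ∈ Z, ∃ n : ℕ, z ^ n • m = 0) → ∀ z ∈ Z, ∃ n : ℕ, z ^ n • x • m = 0 := by
  have hT : ∀ g, ∀ m : M, (∀ z ∈ Z, ∃ n : ℕ, z ^ n • m = 0) →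
      ∀ z ∈ Z, ∃ n : ℕ, z ^ n • T g • m = 0 := by
    intro g m hm z hz
    obtain ⟨n, hn⟩ := hm _ (h.conj_right' g hz)
    refine ⟨n, ?_⟩
    have : ∀ n : ℕ, z ^ n * T g = T g * (T g⁻¹ * z * T g) ^ n := by
      intro n
      induction n with
      | zero => simp
      | succ n ih =>
        rw [pow_succ, mul_assoc, mul_eq_mul_conj T g z, ← mul_assoc, ih, mul_assoc, ← pow_succ]
    rw [← mul_smul, this, mul_smul, hn, smul_zero]
  have hspan : ∀ t ∈ Submodule.span ℂ (Set.range T), ∀ m : M,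
      (∀ z ∈ Z, ∃ n : ℕ, z ^ n • m = 0) → ∀ z ∈ Z, ∃ n : ℕ, z ^ n • t • m = 0 := by
    intro t ht m hm z hz
    induction ht using Submodule.span_induction with
    | mem t ht =>
      obtain ⟨g, rfl⟩ := ht
      exact hT g m hm z hz
    | zero => exact ⟨0, by simp⟩
    | add x y _ _ hx hy => rw [add_smul]; exact exists_pow_smul_add hx hy
    | smul r x _ hx =>
      obtain ⟨n, hn⟩ := hx
      refine ⟨n, ?_⟩
      rw [← mul_smul, mul_smul_comm, Algebra.smul_def, mul_smul, mul_smul, hn, smul_zero]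
  have hZ : ∀ x ∈ Z, ∀ m : M, (∀ z ∈ Z, ∃ n : ℕ, z ^ n • m = 0) →
      ∀ z ∈ Z, ∃ n : ℕ, z ^ n • x • m = 0 := by
    intro x hx m hm z hz
    obtain ⟨n, hn⟩ := hm z hz
    refine ⟨n, ?_⟩
    have hc : Commute z x := h.comm_right z hz x hx
    rw [← mul_smul, (hc.pow_left n).eq, mul_smul, hn, smul_zero]
  have hx : x ∈ Algebra.adjoin ℂ ((U : Set A) ∪ Z ∪ Set.range T) := hgen ▸ Algebra.mem_top
  induction hx using Algebra.adjoin_induction with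
  | mem x hx =>
    rcases hx with (hx | hx) | ⟨g, rfl⟩
    · intro m hm z hz
      -- The commutator `[z, x]` lies in `span T`, which preserves local nilpotency, so the error
      -- made by moving `z ^ n` past `x` stays locally nilpotent. For `n` with `z ^ n • m = 0` this
      -- error is `z ^ n • x • m` itself.
      have key : ∀ n : ℕ, ∀ z' ∈ Z, ∃ j : ℕ, z' ^ j • (z ^ n • x • m - x • z ^ n • m) = 0 := by
        intro n
        have hzn : ∀ n : ℕ, ∀ z' ∈ Z, ∃ j : ℕ, z' ^ j • z ^ n • m = 0 := by
          intro n
          induction n with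
          | zero => simpa using hm
          | succ n ih =>
            rw [pow_succ', mul_smul]
            exact hZ z hz _ ih
        induction n with
        | zero => exact fun z' _ => ⟨0, by simp⟩
        | succ n ih =>
          have e : z ^ (n + 1) • x • m - x • z ^ (n + 1) • m =
              z • (z ^ n • x • m - x • z ^ n • m) + (z * x - x * z) • z ^ n • m := by
            rw [pow_succ', smul_sub, sub_smul]
            simp only [mul_smul]
            abel
          intro z' hz'
          rw [e]
          exact exists_pow_smul_add (hZ z hz _ ih z' hz')
            (hspan _ (h.commutator z hz x hx) _ (hzn n) z' hz')
      obtain ⟨n, hn⟩ := hm z hz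
      obtain ⟨j, hj⟩ := key n z hz
      rw [hn, smul_zero, sub_zero, ← mul_smul, ← pow_add] at hj
      exact ⟨_, hj⟩
    · exact hZ x hx
    · exact hT g
  | algebraMap t =>
    intro m hm z hz
    obtain ⟨n, hn⟩ := hm z hz
    exact ⟨n, by rw [← mul_smul, ← Algebra.commutes, mul_smul, hn, smul_zero]⟩
  | add x y _ _ hx hy =>
    intro m hm z hz
    rw [add_smul]
    exact exists_pow_smul_add (hx m hm z hz) (hy m hm z hz)
  | mul x y _ _ hx hy =>
    intro m hm
    rw [mul_smul]
    exact hx _ (hy m hm)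

end Nilpotent

end Triangular

end Triangular

/-! ### The Euler element and modules in category `𝒪` -/

namespace Realization

section

variable [Fintype W] {ρ : Representation ℂ W V} {k : W → ℂ} {A : Type*} [Ring A] [Algebra ℂ A]
  (r : Realization ρ k A)

theorem conj_X (g : W) (a : Module.Dual ℂ V) : r.T g * r.X a * r.T g⁻¹ = r.X (ρ.dual g a) := by
  rw [r.T_mul_X, mul_assoc, map_mul_map_inv, mul_one]

theorem conj_Y (g : W) (b : V) : r.T g * r.Y b * r.T g⁻¹ = r.Y (ρ g b) := by
  rw [r.T_mul_Y, mul_assoc, map_mul_map_inv, mul_one]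

theorem Y_X_mem_span (b : V) (a : Module.Dual ℂ V) :
    r.Y b * r.X a - r.X a * r.Y b ∈ Submodule.span ℂ (Set.range r.T) := by
  rw [r.Y_X]
  refine sub_mem ?_ (sum_mem fun g _ => Submodule.smul_mem _ _ (Submodule.subset_span ⟨g, rfl⟩))
  rw [Algebra.algebraMap_eq_smul_one]
  exact Submodule.smul_mem _ _ (Triangular.one_mem_span r.T)

theorem triangular : Triangular r.T (LinearMap.range r.X) (LinearMap.range r.Y) where
  conj_left := by
    rintro g _ ⟨a, rfl⟩
    exact ⟨_, (r.conj_X g a).symm⟩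
  conj_right := by
    rintro g _ ⟨a, rfl⟩
    exact ⟨_, (r.conj_Y g a).symm⟩
  commutator := by
    rintro _ ⟨b, rfl⟩ _ ⟨a, rfl⟩
    exact r.Y_X_mem_span b a
  comm_left := by
    rintro _ ⟨a, rfl⟩ _ ⟨b, rfl⟩
    exact r.X_comm a b
  comm_right := by
    rintro _ ⟨a, rfl⟩ _ ⟨b, rfl⟩
    exact r.Y_comm a b

theorem triangular_swap : Triangular r.T (LinearMap.range r.Y) (LinearMap.range r.X) where
  conj_left := r.triangular.conj_right
  conj_right := r.triangular.conj_left
  commutator := by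
    rintro _ ⟨a, rfl⟩ _ ⟨b, rfl⟩
    rw [← neg_sub]
    exact neg_mem (r.Y_X_mem_span b a)
  comm_left := r.triangular.comm_right
  comm_right := r.triangular.comm_left

/-- Translation by a `W`-fixed vector. -/
def shift (b : V) (hb : ∀ g, ρ g b = b) : Realization ρ k A where
  T := r.T
  X := r.X - (Algebra.linearMap ℂ A) ∘ₗ Module.Dual.eval ℂ V b
  Y := r.Y
  T_mul_X g a := by
    simp only [LinearMap.sub_apply, LinearMap.comp_apply, Module.Dual.eval_apply,
      Algebra.linearMap_apply, mul_sub, sub_mul, r.T_mul_X, Representation.dual_apply,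
      Module.Dual.transpose_apply, hb]
    rw [Algebra.commutes]
  T_mul_Y := r.T_mul_Y
  X_comm a a' := by
    have h : Commute (r.X a) (r.X a') := r.X_comm a a'
    exact (h.sub_right (Algebra.commute_algebraMap_right _ _)).sub_left
      (Algebra.commute_algebraMap_left _ _)
  Y_comm := r.Y_comm
  Y_X b' a := by
    rw [← r.Y_X]
    simp only [LinearMap.sub_apply, LinearMap.comp_apply, Module.Dual.eval_apply,
      Algebra.linearMap_apply, mul_sub, sub_mul]
    rw [Algebra.commutes]
    abel

/-- The Euler element. -/
def euler [FiniteDimensional ℂ V] : A :=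
  ∑ i, r.Y (Module.finBasis ℂ V i) * r.X ((Module.finBasis ℂ V).coord i) + ∑ g, k g • r.T g

/-- Commuting `∑ Y_i X_i` with `Y b` gives `-Y b` plus `∑ k_g Y (b - g b) T_g`, and the group part
of the Euler element contributes exactly the negative of the last sum. -/
theorem euler_Y [FiniteDimensional ℂ V] (b : V) :
    r.euler * r.Y b - r.Y b * r.euler = (-1 : ℂ) • r.Y b := by
  set B := Module.finBasis ℂ V
  have hB : ∀ v : V, ∑ i, B.coord i v • r.Y (B i) = r.Y v := fun v => by
    simp only [← map_smul, ← map_sum, Module.Basis.coord_apply, B.sum_repr]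
  have h1 : ∀ i, r.Y (B i) * r.X (B.coord i) * r.Y b - r.Y b * (r.Y (B i) * r.X (B.coord i)) =
      -(B.coord i b • r.Y (B i)) +
        ∑ g, k g • (B.coord i (b - ρ g b) • r.Y (B i) * r.T g) := by
    intro i
    have h2 : r.Y (B i) * r.X (B.coord i) * r.Y b - r.Y b * (r.Y (B i) * r.X (B.coord i)) =
        -(r.Y (B i) * (r.Y b * r.X (B.coord i) - r.X (B.coord i) * r.Y b)) := by
      rw [← mul_assoc, r.Y_comm b (B i)]
      noncomm_ring
    rw [h2, r.Y_X, mul_sub, neg_sub, sub_eq_neg_add, Finset.mul_sum]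
    congr 1
    · rw [← Algebra.commutes, ← Algebra.smul_def]
    · refine Finset.sum_congr rfl fun g _ => ?_
      rw [mul_smul_comm, mul_smul, smul_mul_assoc]
  have h3 : ∀ g, k g • r.T g * r.Y b - r.Y b * k g • r.T g =
      -(k g • (r.Y (b - ρ g b) * r.T g)) := by
    intro g
    rw [smul_mul_assoc, mul_smul_comm, r.T_mul_Y, map_sub, sub_mul, smul_sub, neg_sub]
  rw [euler, add_mul, mul_add, Finset.sum_mul, Finset.mul_sum, Finset.sum_mul, Finset.mul_sum,
    add_sub_add_comm, ← Finset.sum_sub_distrib, ← Finset.sum_sub_distrib,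
    Finset.sum_congr rfl fun i _ => h1 i, Finset.sum_congr rfl fun g _ => h3 g,
    Finset.sum_add_distrib, Finset.sum_neg_distrib, hB, Finset.sum_comm]
  simp only [← Finset.smul_sum, ← Finset.sum_mul, hB, Finset.sum_neg_distrib]
  simp

/-- The same cancellation, after rewriting `a (v - g v)` as the value at `v` of `a - g⁻¹ a`. -/
theorem euler_X [FiniteDimensional ℂ V] (a : Module.Dual ℂ V) :
    r.euler * r.X a - r.X a * r.euler = (1 : ℂ) • r.X a := by
  set B := Module.finBasis ℂ V
  have hB : ∀ a : Module.Dual ℂ V, ∑ i, a (B i) • r.X (B.coord i) = r.X a := fun a => by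
    simp only [← map_smul, ← map_sum, B.sum_dual_apply_smul_coord]
  have h1 : ∀ i, r.Y (B i) * r.X (B.coord i) * r.X a - r.X a * (r.Y (B i) * r.X (B.coord i)) =
      a (B i) • r.X (B.coord i) -
        ∑ g, k g • (r.T g * (a - ρ.dual g⁻¹ a) (B i) • r.X (B.coord i)) := by
    intro i
    have h2 : r.Y (B i) * r.X (B.coord i) * r.X a - r.X a * (r.Y (B i) * r.X (B.coord i)) =
        (r.Y (B i) * r.X a - r.X a * r.Y (B i)) * r.X (B.coord i) := by
      rw [mul_assoc, r.X_comm (B.coord i) a]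
      noncomm_ring
    rw [h2, r.Y_X, sub_mul, Finset.sum_mul]
    congr 1
    · rw [← Algebra.smul_def]
    · refine Finset.sum_congr rfl fun g _ => ?_
      rw [smul_mul_assoc, mul_smul, mul_smul_comm]
      simp [Representation.dual_apply, Module.Dual.transpose_apply]
  have h3 : ∀ g, k g • r.T g * r.X a - r.X a * k g • r.T g =
      k g • (r.T g * r.X (a - ρ.dual g⁻¹ a)) := by
    intro g
    have : r.T g * r.X (ρ.dual g⁻¹ a) = r.X a * r.T g := by
      rw [r.T_mul_X, ← Module.End.mul_apply, ← map_mul, mul_inv_cancel, map_one,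
        Module.End.one_apply]
    rw [smul_mul_assoc, mul_smul_comm, map_sub, mul_sub, this, smul_sub]
  rw [euler, add_mul, mul_add, Finset.sum_mul, Finset.mul_sum, Finset.sum_mul, Finset.mul_sum,
    add_sub_add_comm, ← Finset.sum_sub_distrib, ← Finset.sum_sub_distrib,
    Finset.sum_congr rfl fun i _ => h1 i, Finset.sum_congr rfl fun g _ => h3 g,
    Finset.sum_sub_distrib, hB, Finset.sum_comm]
  simp only [← Finset.smul_sum, ← Finset.mul_sum, hB]
  simp

/-- The elements of a realization generate the algebra. -/
def Generates : Prop :=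
  Algebra.adjoin ℂ ((LinearMap.range r.X : Set A) ∪ LinearMap.range r.Y ∪ Set.range r.T) = ⊤

/-- The Euler element supplies the grading. Consequently `A / A 𝔥` is a nonzero module for every
nonzero algebra `A` generated by a realization, in particular for `H / H e H`. -/
theorem one_notMem_span_Y [FiniteDimensional ℂ V] [Nontrivial A] (hr : r.Generates) :
    (1 : A) ∉ Ideal.span (LinearMap.range r.Y : Set A) :=
  r.triangular.one_notMem_span hr (E := r.euler) (ε := -1) (by norm_num) (by
    rintro _ ⟨b, rfl⟩
    exact r.euler_Y b)

theorem one_notMem_span_X [FiniteDimensional ℂ V] [Nontrivial A] (hr : r.Generates) :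
    (1 : A) ∉ Ideal.span (LinearMap.range r.X : Set A) :=
  r.triangular_swap.one_notMem_span (by
    rw [Set.union_comm (LinearMap.range r.Y : Set A)]; exact hr)
    (E := r.euler) (ε := 1) one_ne_zero (by
    rintro _ ⟨b, rfl⟩
    exact r.euler_X b)

end

end Realization

/-! ### Aspherical modules in category `𝒪` and the spherical ideal -/

section CategoryO

variable [Fintype W] {ρ : Representation ℂ W V} {c : Parameter ρ}

theorem universalRealization_generates : (universalRealization c).Generates := by
  rw [Realization.Generates, eq_top_iff, ← adjoin_gen]
  refine Algebra.adjoin_mono ?_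
  rintro _ ⟨g | a | b, rfl⟩
  · exact Or.inr ⟨g, rfl⟩
  · exact Or.inl (Or.inl ⟨a, rfl⟩)
  · exact Or.inl (Or.inr ⟨b, rfl⟩)

theorem quotientRealization_generates :
    (quotientRealization : Realization ρ c.coupling.k _).Generates := by
  have h := congrArg (Subalgebra.map (Ideal.Quotient.mkₐ ℂ (sphericalLeftIdeal ρ c)))
    (universalRealization_generates (c := c))
  rw [AlgHom.map_adjoin, Algebra.map_top,
    (AlgHom.range_eq_top _).mpr (Ideal.Quotient.mkₐ_surjective ℂ _), Set.image_union,
    Set.image_union] at h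
  rw [Realization.Generates, ← h]
  congr 2
  · congr 1
    · ext x; simp [quotientRealization, Realization.map]
    · ext x; simp [quotientRealization, Realization.map]
  · ext x; simp [quotientRealization, Realization.map]

variable (ρ c) in
/-- The left ideal `H_c e_W H_c + H_c 𝔥`. -/
def lowestWeightIdeal : Ideal (H ρ c) :=
  sphericalLeftIdeal ρ c ⊔
    Ideal.span (LinearMap.range (universalRealization c).Y : Set (H ρ c))

/-- Modulo `H e H`, this ideal becomes the left ideal generated by `𝔥` in a nonzero algebra, to
which `one_notMem_span_Y` applies. -/
theorem lowestWeightIdeal_ne_top [FiniteDimensional ℂ V] (h : sphericalIdeal ρ c ≠ ⊤) :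
    lowestWeightIdeal ρ c ≠ ⊤ := by
  intro htop
  have : Nontrivial (H ρ c ⧸ sphericalLeftIdeal ρ c) :=
    Ideal.Quotient.nontrivial_iff.mpr (sphericalLeftIdeal_ne_top h)
  apply (quotientRealization (c := c)).one_notMem_span_Y quotientRealization_generates
  have h1 : (1 : H ρ c) ∈ lowestWeightIdeal ρ c := htop ▸ Submodule.mem_top
  obtain ⟨x, hx, y, hy, hxy⟩ := Submodule.mem_sup.mp h1
  have h2 : Ideal.Quotient.mk (sphericalLeftIdeal ρ c) y = 1 := by
    have := congrArg (Ideal.Quotient.mk (sphericalLeftIdeal ρ c)) hxy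
    rwa [map_add, Ideal.Quotient.eq_zero_iff_mem.mpr hx, zero_add, map_one] at this
  rw [← h2]
  have h3 := Ideal.mem_map_of_mem (Ideal.Quotient.mk (sphericalLeftIdeal ρ c)) hy
  rw [Ideal.map_span] at h3
  refine Ideal.span_mono ?_ h3
  rintro _ ⟨_, ⟨b, rfl⟩, rfl⟩
  exact ⟨b, rfl⟩

/-- In the decomposition `H = ℂ[𝔥] · ℂW · ℂ[𝔥*]` the last factor acts on the class of `1` through
scalars, so the classes of the group elements generate over `ℂ[𝔥]`. The class of `1` is killed by
`𝔥`, and local nilpotency spreads from it to the whole module. -/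
theorem inCatO_lowestWeight : InCatO ρ c (H ρ c ⧸ lowestWeightIdeal ρ c) := by
  set J := lowestWeightIdeal ρ c with hJ
  set r := universalRealization c
  have hYJ : ∀ b, r.Y b ∈ J := fun b =>
    Submodule.mem_sup_right (Ideal.subset_span ⟨b, rfl⟩)
  constructor
  · refine ⟨⟨(Set.finite_range fun g : W => (Submodule.Quotient.mk (r.T g) : H ρ c ⧸ J)).toFinset,
      ?_⟩⟩
    rw [Set.Finite.coe_toFinset, eq_top_iff]
    intro m _
    obtain ⟨x, rfl⟩ := Submodule.Quotient.mk_surjective J m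
    -- The scalar `t` plays the role of the constant term of `q`.
    have hq : ∀ q ∈ Algebra.adjoin ℂ (LinearMap.range r.Y : Set (H ρ c)),
        ∃ t : ℂ, q - algebraMap ℂ _ t ∈ J := by
      intro q hq
      induction hq using Algebra.adjoin_induction with
      | mem x hx =>
        obtain ⟨b, rfl⟩ := hx
        exact ⟨0, by simpa using hYJ b⟩
      | algebraMap t => exact ⟨t, by simp⟩
      | add x y _ _ hx hy =>
        obtain ⟨t, ht⟩ := hx
        obtain ⟨t', ht'⟩ := hy
        refine ⟨t + t', ?_⟩
        rw [map_add, add_sub_add_comm]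
        exact add_mem ht ht'
      | mul x y _ _ hx hy =>
        obtain ⟨t, ht⟩ := hx
        obtain ⟨t', ht'⟩ := hy
        refine ⟨t * t', ?_⟩
        have : x * y - algebraMap ℂ _ (t * t') =
            x * (y - algebraMap ℂ _ t') + algebraMap ℂ _ t' * (x - algebraMap ℂ _ t) := by
          rw [mul_sub, mul_sub, ← Algebra.commutes t' x, ← map_mul, mul_comm t t']
          abel
        rw [this]
        exact add_mem (J.mul_mem_left _ ht') (J.mul_mem_left _ ht)
    have hx : x ∈ (Algebra.adjoin ℂ (LinearMap.range r.X : Set (H ρ c))).toSubmodule *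
        Submodule.span ℂ (Set.range r.T) *
        (Algebra.adjoin ℂ (LinearMap.range r.Y : Set (H ρ c))).toSubmodule :=
      r.triangular.decomposition universalRealization_generates ▸ Submodule.mem_top
    have hpoly : Algebra.adjoin ℂ (LinearMap.range r.X : Set (H ρ c)) = polySubalgebra ρ c := rfl
    set N := Submodule.span (polySubalgebra ρ c)
      (Set.range fun g : W => (Submodule.Quotient.mk (r.T g) : H ρ c ⧸ J)) with hN
    have hsm : ∀ p ∈ Algebra.adjoin ℂ (LinearMap.range r.X : Set (H ρ c)), ∀ n ∈ N, p • n ∈ N :=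
      fun p hp n hn => N.smul_mem (⟨p, hpoly ▸ hp⟩ : polySubalgebra ρ c) hn
    have hsc : ∀ t : ℂ, ∀ n ∈ N, algebraMap ℂ (H ρ c) t • n ∈ N :=
      fun t => hsm _ (Subalgebra.algebraMap_mem _ t)
    have hmk : ∀ x y : H ρ c, (Submodule.Quotient.mk (x * y) : H ρ c ⧸ J) =
      x • Submodule.Quotient.mk y := fun x y => rfl
    have hT : ∀ t ∈ Submodule.span ℂ (Set.range r.T),
        (Submodule.Quotient.mk t : H ρ c ⧸ J) ∈ N := by
      intro t ht
      induction ht using Submodule.span_induction with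
      | mem t ht =>
        obtain ⟨g, rfl⟩ := ht
        exact Submodule.subset_span ⟨g, rfl⟩
      | zero => exact zero_mem _
      | add x y _ _ hx hy => rw [Submodule.Quotient.mk_add]; exact add_mem hx hy
      | smul t x _ hx =>
        rw [Algebra.smul_def, hmk]
        exact hsc t _ hx
    refine Submodule.mul_induction_on hx (fun m hm q hq' => ?_) fun m m' hm hm' => by
      rw [Submodule.Quotient.mk_add]; exact add_mem hm hm'
    obtain ⟨t, ht⟩ := hq q hq'
    have h1 : (Submodule.Quotient.mk (m * q) : H ρ c ⧸ J) =
        algebraMap ℂ (H ρ c) t • Submodule.Quotient.mk m := by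
      rw [← hmk, Algebra.commutes, Submodule.Quotient.eq, ← mul_sub]
      exact J.mul_mem_left _ ht
    rw [h1]
    apply hsc
    refine Submodule.mul_induction_on hm (fun p hp s hs => ?_) fun m m' hm hm' => by
      rw [Submodule.Quotient.mk_add]; exact add_mem hm hm'
    rw [hmk]
    exact hsm p hp _ (hT s hs)
  · intro b m
    obtain ⟨x, rfl⟩ := Submodule.Quotient.mk_surjective J m
    have h := r.triangular.exists_pow_smul_eq_zero universalRealization_generates x
      (Submodule.Quotient.mk 1 : H ρ c ⧸ J) (by
        rintro _ ⟨b, rfl⟩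
        refine ⟨1, ?_⟩
        rw [pow_one, ← Submodule.Quotient.mk_smul, Submodule.Quotient.mk_eq_zero, smul_eq_mul,
          mul_one]
        exact hYJ b) (r.Y b) ⟨b, rfl⟩
    rwa [← Submodule.Quotient.mk_smul, smul_eq_mul, mul_one] at h

theorem mem_asphericalSet_of_ne_top [FiniteDimensional ℂ V] (h : sphericalIdeal ρ c ≠ ⊤) :
    c ∈ asphericalSet ρ := by
  refine ⟨H ρ c ⧸ lowestWeightIdeal ρ c, inferInstance, inferInstance, inCatO_lowestWeight, ?_, ?_⟩
  · exact Submodule.Quotient.nontrivial_iff.mpr (lowestWeightIdeal_ne_top h)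
  · intro m
    obtain ⟨x, rfl⟩ := Submodule.Quotient.mk_surjective _ m
    rw [← Submodule.Quotient.mk_smul, Submodule.Quotient.mk_eq_zero]
    exact Submodule.mem_sup_left (idem_mul_mem x)

/-- A nonzero module killed by `e_W` shows that the spherical ideal is proper. -/
theorem sphericalIdeal_ne_top_of_isAspherical {M : Type*} [AddCommGroup M] [Module (H ρ c) M]
    (hM : IsAspherical ρ c M) : sphericalIdeal ρ c ≠ ⊤ := by
  let _ : Module ℂ M := Module.compHom M (algebraMap ℂ (H ρ c))
  have : IsScalarTower ℂ (H ρ c) M := ⟨fun t x m => by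
    rw [Algebra.smul_def, mul_smul]; rfl⟩
  have := hM.1
  refine sphericalIdeal_ne_top_of_algHom (Algebra.lsmul ℂ ℂ M : H ρ c →ₐ[ℂ] Module.End ℂ M) ?_
  ext m
  exact hM.2 m

theorem mem_asphericalSet_iff [FiniteDimensional ℂ V] :
    c ∈ asphericalSet ρ ↔ sphericalIdeal ρ c ≠ ⊤ := by
  refine ⟨?_, mem_asphericalSet_of_ne_top⟩
  rintro ⟨M, _, _, _, hM⟩
  exact sphericalIdeal_ne_top_of_isAspherical hM

/-- The detour through the spherical ideal replaces a proof that `𝔥` acts nilpotently on a finite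
dimensional module. -/
theorem fdaSet_subset_asphericalSet [FiniteDimensional ℂ V] : fdaSet ρ ⊆ asphericalSet ρ := by
  rintro c ⟨M, _, _, _, _, _, hM⟩
  exact mem_asphericalSet_of_ne_top (sphericalIdeal_ne_top_of_isAspherical hM)

end CategoryO

/-! ### The rank two identity -/

/-- Two elements `v ↦ v - α v • β` of a finite group with proportional `β` have proportional
`α`. -/
theorem root_ker_le_of_coroot_eq_smul [Finite W] (ρ : Representation ℂ W V) {s t : W}
    {α α' : Module.Dual ℂ V} {β β' : V} (hs : ∀ v, v - ρ s v = α v • β)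
    (ht : ∀ v, v - ρ t v = α' v • β') (hα : α ≠ 0) (hβ' : β' ≠ 0) {c : ℂ} (hc : β' = c • β)
    {u : V} (hu : α u = 0) : α' u = 0 := by
  have hc0 : c ≠ 0 := by
    rintro rfl
    exact hβ' (by rw [hc, zero_smul])
  have hβ : β ≠ 0 := by
    rintro rfl
    exact hβ' (by rw [hc, smul_zero])
  have hs' : ∀ v, ρ s v = v - α v • β := fun v => by rw [← hs]; abel
  have ht' : ∀ v, ρ t v = v - (α' v * c) • β := fun v => by
    rw [mul_smul, ← hc, ← ht]; abel
  -- Otherwise `s` would be a transvection, which has infinite order.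
  have hαβ : α β ≠ 0 := by
    intro h0
    obtain ⟨v, hv⟩ : ∃ v, α v ≠ 0 := by
      by_contra! h
      exact hα (LinearMap.ext h)
    have hfix : ρ s ((-α v) • β) = (-α v) • β := by
      rw [hs', map_smul, h0, smul_zero, zero_smul, sub_zero]
    have := eq_zero_of_fixed ρ s (u := (-α v) • β) (v := v) (by
      rw [neg_smul, ← hs v]; abel) hfix
    rcases smul_eq_zero.mp this with h | h
    · exact hv (neg_eq_zero.mp h)
    · exact hβ h
  have hts : ρ (t * s) β = ((1 - α' β * c) * (1 - α β)) • β := by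
    rw [map_mul, Module.End.mul_apply, hs', map_sub, map_smul, ht']
    module
  have hst : ρ (s * t) β = ((1 - α' β * c) * (1 - α β)) • β := by
    rw [map_mul, Module.End.mul_apply, ht', map_sub, map_smul, hs']
    module
  -- Both `s` and `t` scale the line of `β`, so their commutator `K` fixes `β`. It moves `t s u` by
  -- a multiple of `β` proportional to `α' u`; as `K` has finite order, that multiple is zero.
  set K := s * t * (t * s)⁻¹ with hK
  have hKts : ∀ v, ρ K (ρ (t * s) v) = ρ (s * t) v := fun v => by
    rw [← Module.End.mul_apply, ← map_mul, hK, inv_mul_cancel_right]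
  have hne : (1 - α' β * c) * (1 - α β) ≠ 0 := by
    intro h0
    rw [h0, zero_smul] at hts
    apply hβ
    have := congrArg (ρ (t * s)⁻¹) hts
    rwa [← Module.End.mul_apply, ← map_mul, inv_mul_cancel, map_one, map_zero] at this
  have hKβ : ρ K β = β := by
    have := hKts β
    rw [hts, hst, map_smul] at this
    exact smul_right_injective V hne this
  have hKu : ρ K (ρ (t * s) u) - ρ (t * s) u = (α' u * c * α β) • β := by
    rw [hKts, map_mul, map_mul, Module.End.mul_apply, Module.End.mul_apply, ht', hs' u, hu,
      zero_smul, sub_zero, ht', map_sub, map_smul, hs' u, hu, hs']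
    module
  have := eq_zero_of_fixed ρ K hKu (by rw [map_smul, hKβ])
  rcases smul_eq_zero.mp this with h | h
  · simpa [hc0, hαβ] using h
  · exact absurd h hβ

theorem exists_eq_smul_of_ker_le {α α' : Module.Dual ℂ V} (h : ∀ u, α u = 0 → α' u = 0) {b : V}
    (hb : α b ≠ 0) : α' = (α' b / α b) • α := by
  ext v
  have := h (v - (α v / α b) • b) (by
    rw [map_sub, map_smul, smul_eq_mul, div_mul_cancel₀ _ hb, sub_self])
  rw [map_sub, map_smul, smul_eq_mul, sub_eq_zero] at this
  rw [this, LinearMap.smul_apply, smul_eq_mul]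
  ring

theorem exists_dual_of_notMem_span {x y : V} (h : y ∉ Submodule.span ℂ {x}) :
    ∃ f : Module.Dual ℂ V, f x = 0 ∧ f y = 1 := by
  obtain ⟨f, hf, hle⟩ := Submodule.exists_le_ker_of_notMem h
  refine ⟨(f y)⁻¹ • f, ?_, ?_⟩
  · have : f x = 0 := hle (Submodule.mem_span_singleton_self x)
    simp [this]
  · simp [inv_mul_cancel₀ hf]

namespace Coupling

variable {ρ : Representation ℂ W V} (κ : Coupling ρ)

theorem apply_eq {g : W} (hg : κ.k g ≠ 0) (v : V) : ρ g v = v - κ.α g v • κ.β g := by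
  rw [← κ.sub_apply g hg]; abel

theorem α_ne_zero {g : W} (hg : κ.k g ≠ 0) {b : V} (hb : ρ g b ≠ b) : κ.α g b ≠ 0 := by
  intro h
  apply hb
  rw [κ.apply_eq hg, h, zero_smul, sub_zero]

theorem β_ne_zero {g : W} (hg : κ.k g ≠ 0) {b : V} (hb : ρ g b ≠ b) : κ.β g ≠ 0 := by
  intro h
  apply hb
  rw [κ.apply_eq hg, h, smul_zero, sub_zero]

/-- If `s t = s₀ t₀`, then either the roots of `s` and `t` are proportional, or both lie in the
span of the roots of `s₀` and `t₀`. -/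
theorem exists_coplanar [Finite W] {s t s₀ t₀ : W} (h : s * t = s₀ * t₀) (hs : κ.k s ≠ 0)
    (ht : κ.k t ≠ 0) (hs₀ : κ.k s₀ ≠ 0) (ht₀ : κ.k t₀ ≠ 0) {b : V} (hsb : ρ s b ≠ b)
    (htb : ρ t b ≠ b) (hker : ¬ ∀ u, κ.α s u = 0 → κ.α t u = 0) :
    (∃ p q : ℂ, κ.α s = p • κ.α s₀ + q • κ.α t₀) ∧
      ∃ p q : ℂ, κ.α t = p • κ.α s₀ + q • κ.α t₀ := by
  have hα : κ.α s ≠ 0 := fun h0 => κ.α_ne_zero hs hsb (by rw [h0]; rfl)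
  have hβ := κ.β_ne_zero hs hsb
  have hβ' := κ.β_ne_zero ht htb
  have hnot : ∀ c : ℂ, κ.β t ≠ c • κ.β s := fun c hc => hker fun u hu =>
    root_ker_le_of_coroot_eq_smul ρ (κ.sub_apply s hs) (κ.sub_apply t ht) hα hβ' hc hu
  -- Two expansions of `1 - s t = 1 - s₀ t₀`. As `β_s` and `β_t` are independent, functionals dual
  -- to them extract `α_t` and `α_s` from the left side, while the right side involves only `α_{s₀}`
  -- and `α_{t₀}`.
  have key : ∀ v, κ.α t v • κ.β t + κ.α s (ρ t v) • κ.β s =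
      κ.α t₀ v • κ.β t₀ + (κ.α s₀ v - κ.α t₀ v * κ.α s₀ (κ.β t₀)) • κ.β s₀ := by
    intro v
    have h1 : v - ρ (s * t) v = κ.α t v • κ.β t + κ.α s (ρ t v) • κ.β s := by
      rw [← κ.sub_apply t ht, ← κ.sub_apply s hs, map_mul, Module.End.mul_apply]
      abel
    have h2 : v - ρ (s₀ * t₀) v = κ.α t₀ v • κ.β t₀ + κ.α s₀ (ρ t₀ v) • κ.β s₀ := by
      rw [← κ.sub_apply t₀ ht₀, ← κ.sub_apply s₀ hs₀, map_mul, Module.End.mul_apply]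
      abel
    rw [← h1, h, h2, κ.apply_eq ht₀ v, map_sub, map_smul, smul_eq_mul]
  obtain ⟨f, hf0, hf1⟩ := exists_dual_of_notMem_span (x := κ.β s) (y := κ.β t) fun hm => by
    obtain ⟨c, hc⟩ := Submodule.mem_span_singleton.mp hm
    exact hnot c hc.symm
  obtain ⟨f', hf0', hf1'⟩ := exists_dual_of_notMem_span (x := κ.β t) (y := κ.β s) fun hm => by
    obtain ⟨c, hc⟩ := Submodule.mem_span_singleton.mp hm
    have hc0 : c ≠ 0 := by
      rintro rfl
      exact hβ (by rw [← hc, zero_smul])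
    exact hnot c⁻¹ (by rw [← hc, smul_smul, inv_mul_cancel₀ hc0, one_smul])
  have ht' : κ.α t = f (κ.β s₀) • κ.α s₀ +
      (f (κ.β t₀) - κ.α s₀ (κ.β t₀) * f (κ.β s₀)) • κ.α t₀ := by
    ext v
    have := congrArg f (key v)
    simp only [map_add, map_smul, smul_eq_mul, hf0, hf1, mul_one, mul_zero, add_zero] at this
    rw [this]
    simp only [LinearMap.add_apply, LinearMap.smul_apply, smul_eq_mul]
    ring
  refine ⟨?_, ⟨_, _, ht'⟩⟩
  refine ⟨f' (κ.β s₀) + κ.α s (κ.β t) * f (κ.β s₀),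
    f' (κ.β t₀) - κ.α s₀ (κ.β t₀) * f' (κ.β s₀) +
      κ.α s (κ.β t) * (f (κ.β t₀) - κ.α s₀ (κ.β t₀) * f (κ.β s₀)), ?_⟩
  ext v
  have h1 := congrArg f' (key v)
  have h2 : κ.α s v = κ.α s (ρ t v) + κ.α t v * κ.α s (κ.β t) := by
    rw [κ.apply_eq ht v, map_sub, map_smul, smul_eq_mul]; ring
  simp only [map_add, map_smul, smul_eq_mul, hf0', hf1', mul_one, mul_zero, zero_add] at h1
  rw [h2, h1, ht']
  simp only [LinearMap.add_apply, LinearMap.smul_apply, smul_eq_mul]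
  ring

/-- The bivector `α_s ∧ α_t`. -/
def wedge (s t : W) (v v' : V) : ℂ := κ.α s v * κ.α t v' - κ.α s v' * κ.α t v

section

variable {R : Type*} [CommRing R] [Algebra ℂ R] (X : Module.Dual ℂ V →ₗ[ℂ] R) {ω : W → R}

/-- After clearing denominators this is the relation `(α_s ∧ α_t) α_{s₀} - (α_{s₀} ∧ α_t) α_s +
(α_{s₀} ∧ α_s) α_t = 0`, valid for three linear forms in a plane. Coplanarity is `exists_coplanar`;
if `α_t` is proportional to `α_s`, the relation holds without it. -/
theorem wedge_cocycle [Finite W] {b : V}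
    (hω : ∀ s, κ.k s ≠ 0 → ρ s b ≠ b → X (κ.α s) * ω s = 1)
    {s t s₀ t₀ : W} (h : s * t = s₀ * t₀) (hs : κ.k s ≠ 0)
    (ht : κ.k t ≠ 0) (hs₀ : κ.k s₀ ≠ 0) (ht₀ : κ.k t₀ ≠ 0) (hsb : ρ s b ≠ b)
    (htb : ρ t b ≠ b) (hsb₀ : ρ s₀ b ≠ b) (v v' : V) :
    κ.wedge s t v v' • (ω s * ω t) =
      κ.wedge s₀ t v v' • (ω s₀ * ω t) - κ.wedge s₀ s v v' • (ω s₀ * ω s) := by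
  have h1 := hω s hs hsb
  have h2 := hω t ht htb
  have h0 := hω s₀ hs₀ hsb₀
  have hid : algebraMap ℂ R (κ.wedge s t v v') * X (κ.α s₀) -
      algebraMap ℂ R (κ.wedge s₀ t v v') * X (κ.α s) +
      algebraMap ℂ R (κ.wedge s₀ s v v') * X (κ.α t) = 0 := by
    by_cases hker : ∀ u, κ.α s u = 0 → κ.α t u = 0
    · have e := exists_eq_smul_of_ker_le hker (κ.α_ne_zero hs hsb)
      generalize κ.α t b / κ.α s b = c at e
      simp only [wedge, e, map_smul, LinearMap.smul_apply, smul_eq_mul, Algebra.smul_def, map_sub,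
        map_mul]
      ring
    · obtain ⟨⟨p, q, hp⟩, ⟨p', q', hp'⟩⟩ := κ.exists_coplanar h hs ht hs₀ ht₀ hsb htb hker
      simp only [wedge, hp, hp', map_smul, map_add, LinearMap.add_apply, LinearMap.smul_apply,
        smul_eq_mul, Algebra.smul_def, map_sub, map_mul]
      ring
  simp only [Algebra.smul_def]
  linear_combination (ω s₀ * ω s * ω t) * hid -
    algebraMap ℂ R (κ.wedge s t v v') * ω s * ω t * h0 +
    algebraMap ℂ R (κ.wedge s₀ t v v') * ω s₀ * ω t * h1 -
    algebraMap ℂ R (κ.wedge s₀ s v v') * ω s₀ * ω s * h2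

open Classical in
/-- The sum of `q_s q_t α_s ∧ α_t / (α_s α_t)` over all factorizations `g = s t` into elements
that do not fix `b` vanishes, if `g` fixes `b`. -/
theorem sum_wedge_eq_zero [Fintype W] {b : V}
    (hω : ∀ s, κ.k s ≠ 0 → ρ s b ≠ b → X (κ.α s) * ω s = 1) {q : W → ℂ}
    (hqc : ∀ h g, q (h * g * h⁻¹) = q g) (hq : ∀ g, κ.k g = 0 → q g = 0) {g : W}
    (hg : ρ g b = b) (v v' : V) :
    ∑ s, (if ρ s b = b then 0 else
      (q s * q (s⁻¹ * g) * κ.wedge s (s⁻¹ * g) v v') • (ω s * ω (s⁻¹ * g))) = 0 := by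
  have hfix : ∀ s, ρ (s⁻¹ * g) b = b ↔ ρ s b = b := by
    intro s
    rw [map_mul, Module.End.mul_apply, hg]
    constructor
    · intro h
      conv_lhs => rw [← h]
      rw [← Module.End.mul_apply, ← map_mul, mul_inv_cancel, map_one, Module.End.one_apply]
    · intro h
      conv_lhs => rw [← h]
      rw [← Module.End.mul_apply, ← map_mul, inv_mul_cancel, map_one, Module.End.one_apply]
  by_cases hQ : ∃ s₀, ρ s₀ b ≠ b ∧ q s₀ ≠ 0 ∧ q (s₀⁻¹ * g) ≠ 0
  · obtain ⟨s₀, hb₀, hq₀, hq₀'⟩ := hQ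
    -- Relative to one fixed nonzero factorization, the cocycle relation turns each term into `φ s
    -- (F (s⁻¹ g) - F s)`. The substitution `s ↦ s⁻¹ g` preserves `φ`, because `q` is a class
    -- function, and exchanges the two halves.
    set F : W → R := fun s => κ.wedge s₀ s v v' • (ω s₀ * ω s)
    set φ : W → ℂ := fun s => if ρ s b = b then 0 else q s * q (s⁻¹ * g)
    have hterm : ∀ s, (if ρ s b = b then 0 else
        (q s * q (s⁻¹ * g) * κ.wedge s (s⁻¹ * g) v v') • (ω s * ω (s⁻¹ * g))) =
        φ s • F (s⁻¹ * g) - φ s • F s := by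
      intro s
      by_cases hb : ρ s b = b
      · simp [φ, hb]
      · simp only [φ, if_neg hb]
        by_cases h0 : q s * q (s⁻¹ * g) = 0
        · simp [h0]
        · have h1 := left_ne_zero_of_mul h0
          have h2 := right_ne_zero_of_mul h0
          rw [mul_smul, κ.wedge_cocycle X hω (s := s) (t := s⁻¹ * g) (s₀ := s₀) (t₀ := s₀⁻¹ * g)
            (by simp) (fun h => h1 (hq _ h)) (fun h => h2 (hq _ h)) (fun h => hq₀ (hq _ h))
            (fun h => hq₀' (hq _ h)) hb (by rwa [Ne, hfix]) hb₀ v v', smul_sub]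
    rw [Finset.sum_congr rfl fun s _ => hterm s, Finset.sum_sub_distrib, sub_eq_zero]
    refine Fintype.sum_equiv ((Equiv.inv W).trans (Equiv.mulRight g)) _ _ fun s => ?_
    have hφ : φ (s⁻¹ * g) = φ s := by
      have : q ((s⁻¹ * g)⁻¹ * g) = q s := by
        have := hqc g⁻¹ s
        rw [← this]
        group
      simp only [φ, hfix, this, mul_comm]
    change φ s • F (s⁻¹ * g) = φ (s⁻¹ * g) • F (s⁻¹ * g)
    rw [hφ]
  · push Not at hQ
    refine Finset.sum_eq_zero fun s _ => ?_
    split_ifs with hb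
    · rfl
    · by_cases h : q s = 0
      · simp [h]
      · simp [hQ s hb h]

end

end Coupling

/-! ### Generalized weight spaces -/

/-- The operator `f - μ` is only locally nilpotent, with exponents possibly unbounded, so
bijectivity is checked one vector at a time. -/
theorem isUnit_of_forall_mem_maxGenEigenspace {N : Type*} [AddCommGroup N] [Module ℂ N]
    {f : Module.End ℂ N} {μ : ℂ} (hμ : μ ≠ 0) (h : ∀ m, m ∈ f.maxGenEigenspace μ) : IsUnit f := by
  rw [Module.End.isUnit_iff]
  constructor
  · rw [injective_iff_map_eq_zero]
    intro m hm
    obtain ⟨n, hn⟩ := (Module.End.mem_maxGenEigenspace f μ m).mp (h m)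
    have key : ∀ n : ℕ, ((f - μ • 1) ^ n) m = (-μ) ^ n • m := by
      intro n
      induction n with
      | zero => simp
      | succ n ih =>
        rw [pow_succ', Module.End.mul_apply, ih, map_smul, LinearMap.sub_apply, hm, zero_sub,
          LinearMap.smul_apply, Module.End.one_apply, pow_succ, mul_smul, neg_smul μ]
    rw [key] at hn
    exact (smul_eq_zero.mp hn).resolve_left (pow_ne_zero _ (neg_ne_zero.mpr hμ))
  · intro m
    obtain ⟨n, hn⟩ := (Module.End.mem_maxGenEigenspace f μ m).mp (h m)
    clear h
    induction n generalizing m with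
    | zero => exact ⟨0, by simpa using hn.symm⟩
    | succ n ih =>
      rw [pow_succ, Module.End.mul_apply] at hn
      obtain ⟨y, hy⟩ := ih _ hn
      -- From `(f - μ) m = f y` one gets `μ m = f (m - y)`.
      refine ⟨μ⁻¹ • (m - y), ?_⟩
      rw [map_smul, map_sub, hy]
      simp [smul_smul, inv_mul_cancel₀ hμ]

section CommutingInverses

theorem commute_ringInverse {E : Type*} [Ring E] {x y : E} (h : Commute x y) :
    Commute x (Ring.inverse y) := by
  by_cases hy : IsUnit y
  · obtain ⟨u, rfl⟩ := hy
    rw [Ring.inverse_unit]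
    exact h.units_inv_right
  · rw [Ring.inverse_non_unit _ hy]
    exact Commute.zero_right x

variable {ρ : Representation ℂ W V} (κ : Coupling ρ) {E : Type*} [Ring E] [Algebra ℂ E]

-- The identity is applied in the commutative algebra generated by the linear forms and the
-- inverses. The default value of `Ring.inverse` at a non-unit only meets a zero weight.
open scoped IsMulCommutative in
open Classical in
theorem Coupling.sum_wedge_inverse_eq_zero [Fintype W] (X : Module.Dual ℂ V →ₗ[ℂ] E)
    (hX : ∀ a a', X a * X a' = X a' * X a) {b : V}
    (hu : ∀ s, κ.k s ≠ 0 → ρ s b ≠ b → IsUnit (X (κ.α s))) {q : W → ℂ}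
    (hqc : ∀ h g, q (h * g * h⁻¹) = q g) (hq : ∀ g, κ.k g = 0 → q g = 0) {g : W}
    (hg : ρ g b = b) (v v' : V) :
    ∑ s, (if ρ s b = b then 0 else
      (q s * q (s⁻¹ * g) * κ.wedge s (s⁻¹ * g) v v') •
        (Ring.inverse (X (κ.α s)) * Ring.inverse (X (κ.α (s⁻¹ * g))))) = 0 := by
  set S : Set E := Set.range X ∪ Set.range fun s => Ring.inverse (X (κ.α s)) with hS
  have hc : ∀ a a', Commute (X a) (X a') := hX
  have hcomm : ∀ x ∈ S, ∀ y ∈ S, x * y = y * x := by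
    rintro _ (⟨a, rfl⟩ | ⟨s, rfl⟩) _ (⟨a', rfl⟩ | ⟨s', rfl⟩)
    · exact hX a a'
    · exact commute_ringInverse (hc _ _)
    · exact (commute_ringInverse (hc _ _)).symm
    · exact (hc _ _).ringInverse_ringInverse
  have := Algebra.isMulCommutative_adjoin ℂ hcomm
  let R := Algebra.adjoin ℂ S
  let XR : Module.Dual ℂ V →ₗ[ℂ] R := X.codRestrict R.toSubmodule fun a =>
    Algebra.subset_adjoin (Or.inl ⟨a, rfl⟩)
  let ω : W → R := fun s => ⟨Ring.inverse (X (κ.α s)), Algebra.subset_adjoin (Or.inr ⟨s, rfl⟩)⟩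
  have key := κ.sum_wedge_eq_zero XR (ω := ω) (b := b) (fun s hs hb => Subtype.ext
    (Ring.mul_inverse_cancel _ (hu s hs hb))) hqc hq hg v v'
  have := congrArg R.val key
  rw [map_sum, map_zero] at this
  refine Eq.trans (Finset.sum_congr rfl fun s _ => ?_) this
  split_ifs
  · rw [map_zero]
  · rw [map_smul, map_mul]; rfl

end CommutingInverses

namespace Realization

variable [Fintype W] {ρ : Representation ℂ W V} {k : W → ℂ} {L : Type*} [AddCommGroup L]
  [Module ℂ L] (r : Realization ρ k (Module.End ℂ L))

/-- The generalized weight space of `ℂ[𝔥]` at the point `u`. -/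
def weightSpace (u : V) : Submodule ℂ L := ⨅ a : Module.Dual ℂ V, (r.X a).maxGenEigenspace (a u)

theorem mem_weightSpace {u : V} {m : L} :
    m ∈ r.weightSpace u ↔ ∀ a : Module.Dual ℂ V, ∃ n : ℕ, ((r.X a - a u • 1) ^ n) m = 0 := by
  simp only [weightSpace, Submodule.mem_iInf, Module.End.mem_maxGenEigenspace]

theorem X_mem_weightSpace {u : V} {m : L} (hm : m ∈ r.weightSpace u) (a : Module.Dual ℂ V) :
    r.X a m ∈ r.weightSpace u := by
  rw [mem_weightSpace] at hm ⊢
  intro a'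
  obtain ⟨n, hn⟩ := hm a'
  have h : Commute (r.X a' - a' u • 1) (r.X a) :=
    Commute.sub_left (r.X_comm a' a) ((Commute.one_left _).smul_left _)
  refine ⟨n, ?_⟩
  rw [← Module.End.mul_apply, (h.pow_left n).eq, Module.End.mul_apply, hn, map_zero]

theorem X_T (g : W) (a : Module.Dual ℂ V) : r.X a * r.T g = r.T g * r.X (ρ.dual g⁻¹ a) := by
  rw [r.T_mul_X, ← Module.End.mul_apply (ρ.dual g), ← map_mul, mul_inv_cancel, map_one,
    Module.End.one_apply]

theorem Y_T (g : W) (b : V) : r.Y b * r.T g = r.T g * r.Y (ρ g⁻¹ b) := by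
  rw [r.T_mul_Y, ← Module.End.mul_apply (ρ g), ← map_mul, mul_inv_cancel, map_one,
    Module.End.one_apply]

theorem T_mem_weightSpace {u : V} {m : L} (hm : m ∈ r.weightSpace u) (g : W) :
    r.T g m ∈ r.weightSpace (ρ g u) := by
  rw [mem_weightSpace] at hm ⊢
  intro a
  obtain ⟨n, hn⟩ := hm (ρ.dual g⁻¹ a)
  refine ⟨n, ?_⟩
  have h1 : (r.X a - a (ρ g u) • 1) * r.T g =
      r.T g * (r.X (ρ.dual g⁻¹ a) - (ρ.dual g⁻¹ a) u • 1) := by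
    rw [sub_mul, mul_sub, r.X_T, smul_one_mul, mul_smul_one]
    simp [Representation.dual_apply, Module.Dual.transpose_apply]
  have h2 : ∀ n : ℕ, (r.X a - a (ρ g u) • 1) ^ n * r.T g =
      r.T g * (r.X (ρ.dual g⁻¹ a) - (ρ.dual g⁻¹ a) u • 1) ^ n := by
    intro n
    induction n with
    | zero => simp
    | succ n ih => rw [pow_succ, mul_assoc, h1, ← mul_assoc, ih, mul_assoc, ← pow_succ]
  rw [← Module.End.mul_apply, h2, Module.End.mul_apply, hn, map_zero]

theorem iSupIndep_weightSpace : iSupIndep r.weightSpace := by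
  have h := Module.End.independent_iInf_maxGenEigenspace_of_forall_mapsTo (fun a => r.X a)
    (fun a a' φ => Module.End.mapsTo_maxGenEigenspace_of_comm (r.X_comm a' a) φ)
  refine h.comp (f := fun u : V => fun a : Module.Dual ℂ V => a u) fun u u' huu => ?_
  rw [← sub_eq_zero, ← Module.forall_dual_apply_eq_zero_iff ℂ]
  intro a
  rw [map_sub, sub_eq_zero]
  exact congrFun huu a

theorem eq_zero_of_mem_weightSpace {b : V} {m : L} (hm : m ∈ r.weightSpace b)
    (hm' : m ∈ ⨆ (u) (_ : u ≠ b), r.weightSpace u) : m = 0 :=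
  Submodule.disjoint_def.mp (r.iSupIndep_weightSpace b) m hm hm'

/-- The action of `𝔥*` on a generalized weight space. -/
def weightX (b : V) : Module.Dual ℂ V →ₗ[ℂ] Module.End ℂ (r.weightSpace b) where
  toFun a := (r.X a).restrict fun _ hm => r.X_mem_weightSpace hm a
  map_add' a a' := by ext; simp
  map_smul' t a := by ext; simp

@[simp]
theorem coe_weightX (b : V) (a : Module.Dual ℂ V) (m : r.weightSpace b) :
    (r.weightX b a m : L) = r.X a m := rfl

theorem weightX_comm (b : V) (a a' : Module.Dual ℂ V) :
    r.weightX b a * r.weightX b a' = r.weightX b a' * r.weightX b a := by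
  ext m
  exact LinearMap.congr_fun (r.X_comm a a') m.1

theorem coe_weightX_sub_pow (b : V) (a : Module.Dual ℂ V) (t : ℂ) (m : r.weightSpace b) (n : ℕ) :
    (((r.weightX b a - t • 1) ^ n) m : L) = ((r.X a - t • 1) ^ n) m := by
  induction n generalizing m with
  | zero => simp
  | succ n ih =>
    rw [pow_succ, pow_succ, Module.End.mul_apply, Module.End.mul_apply, ih]
    rfl

theorem mem_maxGenEigenspace_weightX (b : V) (a : Module.Dual ℂ V) (m : r.weightSpace b) :
    m ∈ (r.weightX b a).maxGenEigenspace (a b) := by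
  rw [Module.End.mem_maxGenEigenspace]
  obtain ⟨n, hn⟩ := r.mem_weightSpace.mp m.2 a
  exact ⟨n, Subtype.ext (by rw [coe_weightX_sub_pow, hn]; rfl)⟩

theorem isUnit_weightX {b : V} {a : Module.Dual ℂ V} (h : a b ≠ 0) : IsUnit (r.weightX b a) :=
  isUnit_of_forall_mem_maxGenEigenspace h (r.mem_maxGenEigenspace_weightX b a)

end Realization

/-! ### Restriction to a parabolic subgroup -/

theorem Coupling.α_inv_apply {ρ : Representation ℂ W V} (κ : Coupling ρ) {s : W}
    (hs : κ.k s ≠ 0) (t : W) (v : V) :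
    κ.α t (ρ s⁻¹ v) = κ.α t v + κ.α s v * κ.α t (ρ s⁻¹ (κ.β s)) := by
  have h := congrArg (fun x => κ.α t (ρ s⁻¹ x)) (κ.sub_apply s hs v)
  simp only [map_sub, map_smul, smul_eq_mul] at h
  rw [← Module.End.mul_apply (ρ s⁻¹) (ρ s), ← map_mul, inv_mul_cancel, map_one,
    Module.End.one_apply] at h
  linear_combination h

theorem fix_inv_mul_iff {ρ : Representation ℂ W V} {b : V} {s g : W} (hg : ρ g b = b) : ρ (s⁻¹ * g) b = b ↔ ρ s b = b := by
  rw [map_mul, Module.End.mul_apply, hg]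
  constructor
  · intro h
    conv_lhs => rw [← h]
    rw [← Module.End.mul_apply, ← map_mul, mul_inv_cancel, map_one, Module.End.one_apply]
  · intro h
    conv_lhs => rw [← h]
    rw [← Module.End.mul_apply, ← map_mul, inv_mul_cancel, map_one, Module.End.one_apply]

namespace Realization

variable [Fintype W] {ρ : Representation ℂ W V} {κ : Coupling ρ} {L : Type*} [AddCommGroup L]
  [Module ℂ L] (r : Realization ρ κ.k (Module.End ℂ L)) (b : V)

/-- The inverse of a root on a generalized weight space. -/
def rootInv (s : W) : Module.End ℂ (r.weightSpace b) := Ring.inverse (r.weightX b (κ.α s))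

theorem weightX_rootInv {s : W} (hs : κ.k s ≠ 0) (hb : ρ s b ≠ b) (m : r.weightSpace b) :
    r.weightX b (κ.α s) (r.rootInv b s m) = m :=
  LinearMap.congr_fun (Ring.mul_inverse_cancel _ (r.isUnit_weightX (κ.α_ne_zero hs hb))) m

theorem rootInv_weightX (s : W) (a : Module.Dual ℂ V) (m : r.weightSpace b) :
    r.rootInv b s (r.weightX b a m) = r.weightX b a (r.rootInv b s m) :=
  LinearMap.congr_fun (commute_ringInverse (x := r.weightX b a)
    (r.weightX_comm b a (κ.α s))).symm.eq m

theorem rootInv_comm (s t : W) (m : r.weightSpace b) :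
    r.rootInv b s (r.rootInv b t m) = r.rootInv b t (r.rootInv b s m) :=
  LinearMap.congr_fun (Commute.ringInverse_ringInverse (a := r.weightX b (κ.α s))
    (b := r.weightX b (κ.α t)) (r.weightX_comm b _ _)).eq m

/-- The `s`-component of the action of `v` on a generalized weight space, up to sign. -/
def offTerm (v : V) (s : W) : r.weightSpace b →ₗ[ℂ] L :=
  (κ.k s * κ.α s v) • (r.T s ∘ₗ (r.weightSpace b).subtype ∘ₗ r.rootInv b s)

theorem offTerm_apply (v : V) (s : W) (m : r.weightSpace b) :
    r.offTerm b v s m = (κ.k s * κ.α s v) • r.T s (r.rootInv b s m) := rfl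

theorem offTerm_mem (v : V) (s : W) (m : r.weightSpace b) :
    r.offTerm b v s m ∈ r.weightSpace (ρ s b) :=
  Submodule.smul_mem _ _ (r.T_mem_weightSpace (r.rootInv b s m).2 s)

/-- Since `s⁻¹ a = a - a(β_s) α_s`, moving `a` past `T_s α_s⁻¹` cancels the inverse root. Adding
this operator to `Y v` therefore removes the `s`-term from the commutator with `𝔥*`. -/
theorem offTerm_X (v : V) {s : W} (hb : ρ s b ≠ b) (a : Module.Dual ℂ V) (m : r.weightSpace b) :
    r.offTerm b v s (r.weightX b a m) - r.X a (r.offTerm b v s m) =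
      (κ.k s * a (v - ρ s v)) • r.T s m := by
  by_cases hs : κ.k s = 0
  · simp [offTerm_apply, hs]
  have h1 : ρ.dual s⁻¹ a = a - a (κ.β s) • κ.α s := by
    ext v
    have := congrArg a (κ.apply_eq hs v)
    rw [map_sub, map_smul, smul_eq_mul] at this
    simp only [Representation.dual_apply, Module.Dual.transpose_apply, LinearMap.comp_apply,
      inv_inv, this, LinearMap.sub_apply, LinearMap.smul_apply, smul_eq_mul, mul_comm]
  have h2 : r.X a (r.T s (r.rootInv b s m)) =
      r.T s (r.weightX b a (r.rootInv b s m)) - a (κ.β s) • r.T s m := by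
    rw [← Module.End.mul_apply, r.X_T, h1, Module.End.mul_apply, map_sub, map_smul,
      LinearMap.sub_apply, LinearMap.smul_apply, map_sub, map_smul, ← coe_weightX, ← coe_weightX,
      r.weightX_rootInv b hs hb]
  rw [offTerm_apply, offTerm_apply, map_smul, h2, r.rootInv_weightX, ← smul_sub, sub_sub_cancel,
    smul_smul, κ.sub_apply s hs, map_smul, smul_eq_mul, mul_assoc]

open Classical in
/-- The diagonal part of the action of `v` on a generalized weight space. -/
def resYAux (v : V) : r.weightSpace b →ₗ[ℂ] L :=
  r.Y v ∘ₗ (r.weightSpace b).subtype + ∑ s, if ρ s b = b then 0 else r.offTerm b v s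

open Classical in
theorem resYAux_apply (v : V) (m : r.weightSpace b) :
    r.resYAux b v m = r.Y v m + ∑ s, if ρ s b = b then 0 else r.offTerm b v s m := by
  simp only [resYAux, LinearMap.add_apply, LinearMap.comp_apply, Submodule.subtype_apply,
    LinearMap.sum_apply]
  congr 1
  refine Finset.sum_congr rfl fun s _ => ?_
  split_ifs <;> rfl

open Classical in
theorem resYAux_X (v : V) (a : Module.Dual ℂ V) (m : r.weightSpace b) :
    r.resYAux b v (r.weightX b a m) - r.X a (r.resYAux b v m) =
      a v • (m : L) - ∑ s, if ρ s b = b then (κ.k s * a (v - ρ s v)) • r.T s m else 0 := by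
  have h1 := LinearMap.congr_fun (r.Y_X v a) (m : L)
  simp only [LinearMap.sub_apply, Module.End.mul_apply, Module.algebraMap_end_apply,
    LinearMap.sum_apply, LinearMap.smul_apply] at h1
  rw [resYAux_apply, resYAux_apply, map_add, map_sum, coe_weightX, add_sub_add_comm, h1,
    ← Finset.sum_sub_distrib, sub_add, ← Finset.sum_sub_distrib]
  congr 1
  refine Finset.sum_congr rfl fun s _ => ?_
  split_ifs with hb
  · simp
  · rw [r.offTerm_X b v hb, sub_self]

/-- The commutator of this operator with `X a` involves only elements fixing `b`, hence preserves
the weight space. Modulo the weight space it thus intertwines powers of `X a - a b`. A high power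
kills `m`, and a further power kills the remainder. -/
theorem resYAux_mem (v : V) (m : r.weightSpace b) : r.resYAux b v m ∈ r.weightSpace b := by
  classical
  rw [mem_weightSpace]
  intro a
  have hZ : ∀ x ∈ r.weightSpace b, (r.X a - a b • 1) x ∈ r.weightSpace b := fun x hx =>
    sub_mem (r.X_mem_weightSpace hx a) (Submodule.smul_mem _ _ hx)
  have key : ∀ (n : ℕ) (m : r.weightSpace b), ((r.X a - a b • 1) ^ n) (r.resYAux b v m) -
      r.resYAux b v (((r.weightX b a - a b • 1) ^ n) m) ∈ r.weightSpace b := by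
    intro n
    induction n with
    | zero => intro m; simp
    | succ n ih =>
      intro m
      have h1 : (r.X a - a b • 1) (r.resYAux b v m) -
          r.resYAux b v ((r.weightX b a - a b • 1) m) ∈ r.weightSpace b := by
        have e : (r.X a - a b • 1) (r.resYAux b v m) -
            r.resYAux b v ((r.weightX b a - a b • 1) m) =
            -(r.resYAux b v (r.weightX b a m) - r.X a (r.resYAux b v m)) := by
          simp only [LinearMap.sub_apply, LinearMap.smul_apply, Module.End.one_apply, map_sub,
            map_smul]
          abel
        rw [e, resYAux_X]
        refine neg_mem (sub_mem (Submodule.smul_mem _ _ m.2) (sum_mem fun s _ => ?_))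
        split_ifs with hs
        · refine Submodule.smul_mem _ _ ?_
          have := r.T_mem_weightSpace m.2 s
          rwa [hs] at this
        · exact zero_mem _
      have hZn : ∀ x ∈ r.weightSpace b, ((r.X a - a b • 1) ^ n) x ∈ r.weightSpace b := by
        clear ih h1
        induction n with
        | zero => simp
        | succ n ih =>
          intro x hx
          rw [pow_succ', Module.End.mul_apply]
          exact hZ _ (ih x hx)
      have h2 := ih ((r.weightX b a - a b • 1) m)
      have h3 := hZn _ h1
      rw [pow_succ, pow_succ, Module.End.mul_apply, Module.End.mul_apply]
      rw [map_sub] at h3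
      have := add_mem h3 h2
      rwa [sub_add_sub_cancel] at this
  obtain ⟨n, hn⟩ := (Module.End.mem_maxGenEigenspace _ _ _).mp
    (r.mem_maxGenEigenspace_weightX b a m)
  have h := key n m
  rw [hn, map_zero, sub_zero] at h
  obtain ⟨n', hn'⟩ := r.mem_weightSpace.mp h a
  exact ⟨n' + n, by rw [pow_add, Module.End.mul_apply, hn']⟩

/-- The sum of the generalized weight spaces away from `b`. -/
def offWeight : Submodule ℂ L := ⨆ (u) (_ : u ≠ b), r.weightSpace u

theorem weightSpace_le_offWeight {u : V} (hu : u ≠ b) : r.weightSpace u ≤ r.offWeight b :=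
  le_iSup₂_of_le u hu le_rfl

theorem T_mem_offWeight {x : L} (hx : x ∈ r.offWeight b) {g : W} (hg : ρ g b = b) :
    r.T g x ∈ r.offWeight b := by
  have : r.offWeight b ≤ (r.offWeight b).comap (r.T g) := by
    refine iSup₂_le fun u hu y hy => r.weightSpace_le_offWeight b ?_ (r.T_mem_weightSpace hy g)
    intro h
    apply hu
    have := congrArg (ρ g⁻¹) (h.trans hg.symm)
    simpa [← Module.End.mul_apply, ← map_mul] using this
  exact this hx

/-- The correction terms lie in the weight spaces at `s b ≠ b`, so `resY` is the `b`-component of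
`Y`. Relations for it are read off from those of `Y` modulo `offWeight`. -/
theorem Y_sub_resYAux_mem (v : V) (m : r.weightSpace b) :
    r.Y v m - r.resYAux b v m ∈ r.offWeight b := by
  classical
  rw [resYAux_apply, sub_add_cancel_left]
  refine neg_mem (sum_mem fun s _ => ?_)
  split_ifs with hs
  · exact zero_mem _
  · exact r.weightSpace_le_offWeight b hs (r.offTerm_mem b v s m)

theorem eq_of_sub_mem_offWeight {x y : L} (hx : x ∈ r.weightSpace b) (hy : y ∈ r.weightSpace b)
    (h : x - y ∈ r.offWeight b) : x = y :=
  sub_eq_zero.mp (r.eq_zero_of_mem_weightSpace (sub_mem hx hy) h)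

/-- The diagonal part of the action of `𝔥` on a generalized weight space. -/
def resY : V →ₗ[ℂ] Module.End ℂ (r.weightSpace b) where
  toFun v := (r.resYAux b v).codRestrict _ (r.resYAux_mem b v)
  map_add' v v' := by
    classical
    ext m
    simp only [LinearMap.codRestrict_apply, LinearMap.add_apply, Submodule.coe_add, resYAux_apply,
      map_add, offTerm_apply, mul_add, add_smul]
    rw [add_add_add_comm, ← Finset.sum_add_distrib]
    congr 1
    refine Finset.sum_congr rfl fun s _ => ?_
    split_ifs <;> simp
  map_smul' t v := by
    classical
    ext m
    simp only [LinearMap.codRestrict_apply, LinearMap.smul_apply, Submodule.coe_smul,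
      resYAux_apply, map_smul, offTerm_apply, RingHom.id_apply, smul_add, Finset.smul_sum]
    congr 1
    refine Finset.sum_congr rfl fun s _ => ?_
    split_ifs
    · simp
    · rw [smul_smul, smul_eq_mul]
      congr 1
      ring

theorem coe_resY (v : V) (m : r.weightSpace b) : (r.resY b v m : L) = r.resYAux b v m := rfl

open Classical in
/-- The contribution of pairs of elements moving `b` to the composition of two operators. -/
def resCross (v v' : V) (m : r.weightSpace b) : L :=
  ∑ s, if ρ s b = b then 0 else (κ.k s * κ.α s v') • ∑ g, if ρ g b = b then
    (κ.k (s⁻¹ * g) * κ.α (s⁻¹ * g) (ρ s⁻¹ v)) •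
      r.T g (r.rootInv b (s⁻¹ * g) (r.rootInv b s m)) else 0

/-- The `b`-component of a product has two sources: both factors stay at `b`, or the first applied
leaves through `s` and the other returns through `s⁻¹ g`, where `g` fixes `b`. -/
theorem Y_Y_sub_mem (v v' : V) (m : r.weightSpace b) :
    r.Y v (r.Y v' m) - (r.resY b v (r.resY b v' m) + r.resCross b v v' m) ∈ r.offWeight b := by
  classical
  have h1 : r.Y v' (m : L) = r.resY b v' m -
      ∑ s, if ρ s b = b then 0 else r.offTerm b v' s m := by
    rw [coe_resY, resYAux_apply, add_sub_cancel_right]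
  have h2 : ∀ s, ρ s b ≠ b → ∀ n : r.weightSpace b, r.Y v (r.T s n) +
      (∑ g, if ρ g b = b then (κ.k (s⁻¹ * g) * κ.α (s⁻¹ * g) (ρ s⁻¹ v)) •
        r.T g (r.rootInv b (s⁻¹ * g) n) else 0) ∈ r.offWeight b := by
    intro s hs n
    have e1 : r.Y v (r.T s n) = r.T s (r.resY b (ρ s⁻¹ v) n) -
        ∑ g, if ρ (s⁻¹ * g) b = b then 0 else
          (κ.k (s⁻¹ * g) * κ.α (s⁻¹ * g) (ρ s⁻¹ v)) • r.T g (r.rootInv b (s⁻¹ * g) n) := by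
      rw [← Module.End.mul_apply, r.Y_T, Module.End.mul_apply]
      have : r.Y (ρ s⁻¹ v) (n : L) = r.resY b (ρ s⁻¹ v) n -
          ∑ t, if ρ t b = b then 0 else r.offTerm b (ρ s⁻¹ v) t n := by
        rw [coe_resY, resYAux_apply, add_sub_cancel_right]
      rw [this, map_sub, map_sum]
      congr 1
      refine (Fintype.sum_equiv (Equiv.mulLeft s⁻¹) _ _ fun g => ?_).symm
      rw [Equiv.coe_mulLeft]
      by_cases hg : ρ (s⁻¹ * g) b = b
      · rw [if_pos hg, if_pos hg, map_zero]
      · rw [if_neg hg, if_neg hg, offTerm_apply, map_smul, ← Module.End.mul_apply, ← map_mul,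
          mul_inv_cancel_left]
    rw [e1, sub_add, ← Finset.sum_sub_distrib]
    refine sub_mem ?_ (sum_mem fun g _ => ?_)
    · exact r.weightSpace_le_offWeight b hs (r.T_mem_weightSpace (r.resY b _ n).2 s)
    · by_cases hg : ρ g b = b
      · rw [if_neg (by rwa [fix_inv_mul_iff hg]), if_pos hg, sub_self]
        exact zero_mem _
      · rw [if_neg hg, sub_zero]
        split_ifs
        · exact zero_mem _
        · exact Submodule.smul_mem _ _ (r.weightSpace_le_offWeight b hg
            (r.T_mem_weightSpace (r.rootInv b (s⁻¹ * g) n).2 g))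
  have h3 : r.Y v (r.Y v' m) - (r.resY b v (r.resY b v' m) + r.resCross b v v' m) =
      (r.Y v (r.resY b v' m) - r.resY b v (r.resY b v' m)) -
      ∑ s, (if ρ s b = b then 0 else (κ.k s * κ.α s v') • (r.Y v (r.T s (r.rootInv b s m)) +
      (∑ g, if ρ g b = b then (κ.k (s⁻¹ * g) * κ.α (s⁻¹ * g) (ρ s⁻¹ v)) •
        r.T g (r.rootInv b (s⁻¹ * g) (r.rootInv b s m)) else 0))) := by
    have h4 : ∑ s, (if ρ s b = b then 0 else (κ.k s * κ.α s v') •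
        (r.Y v (r.T s (r.rootInv b s m)) +
        (∑ g, if ρ g b = b then (κ.k (s⁻¹ * g) * κ.α (s⁻¹ * g) (ρ s⁻¹ v)) •
          r.T g (r.rootInv b (s⁻¹ * g) (r.rootInv b s m)) else 0))) =
        (∑ s, if ρ s b = b then 0 else r.Y v (r.offTerm b v' s m)) + r.resCross b v v' m := by
      rw [resCross, ← Finset.sum_add_distrib]
      refine Finset.sum_congr rfl fun s _ => ?_
      split_ifs
      · rw [add_zero]
      · rw [smul_add, offTerm_apply, map_smul]
    have h5 : r.Y v (∑ s, if ρ s b = b then 0 else r.offTerm b v' s m) =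
        ∑ s, if ρ s b = b then 0 else r.Y v (r.offTerm b v' s m) := by
      rw [map_sum]
      refine Finset.sum_congr rfl fun s _ => ?_
      split_ifs
      · rw [map_zero]
      · rfl
    rw [h4, h1, map_sub, h5]
    abel
  rw [h3]
  refine sub_mem (r.Y_sub_resYAux_mem b v _) (sum_mem fun s _ => ?_)
  split_ifs with hs
  · exact zero_mem _
  · exact Submodule.smul_mem _ _ (h2 s hs _)

/-- Grouped by the element `g` of the stabilizer, the antisymmetrization in `v`, `v'` is the rank
two sum over factorizations of `g`. This is what makes the restricted `𝔥` commute. -/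
theorem resCross_symm (v v' : V) (m : r.weightSpace b) :
    r.resCross b v v' m = r.resCross b v' v m := by
  classical
  have hrew : ∀ v v', r.resCross b v v' m = ∑ g, if ρ g b = b then
      r.T g ((∑ s, if ρ s b = b then 0 else (κ.k s * κ.k (s⁻¹ * g) *
        (κ.α s v' * κ.α (s⁻¹ * g) (ρ s⁻¹ v))) •
        (r.rootInv b s * r.rootInv b (s⁻¹ * g)) : Module.End ℂ (r.weightSpace b)) m) else 0 := by
    intro v v'
    have e1 : r.resCross b v v' m = ∑ s, ∑ g, if ρ s b = b then 0 else if ρ g b = b then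
        (κ.k s * κ.k (s⁻¹ * g) * (κ.α s v' * κ.α (s⁻¹ * g) (ρ s⁻¹ v))) •
          r.T g (r.rootInv b s (r.rootInv b (s⁻¹ * g) m)) else 0 := by
      refine Finset.sum_congr rfl fun s _ => ?_
      split_ifs with hs
      · rw [Finset.sum_const_zero]
      · rw [Finset.smul_sum]
        refine Finset.sum_congr rfl fun g _ => ?_
        split_ifs
        · rw [smul_smul, r.rootInv_comm b s]
          congr 1
          ring
        · rw [smul_zero]
    rw [e1, Finset.sum_comm]
    refine Finset.sum_congr rfl fun g _ => ?_
    split_ifs with hg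
    · rw [LinearMap.sum_apply, AddSubmonoidClass.coe_finsetSum, map_sum]
      refine Finset.sum_congr rfl fun s _ => ?_
      split_ifs
      · simp
      · rw [LinearMap.smul_apply, Submodule.coe_smul, map_smul]; rfl
    · simp
  rw [← sub_eq_zero, hrew, hrew, ← Finset.sum_sub_distrib]
  refine Finset.sum_eq_zero fun g _ => ?_
  split_ifs with hg
  · rw [← map_sub, ← Submodule.coe_sub, ← LinearMap.sub_apply, ← Finset.sum_sub_distrib]
    have h := κ.sum_wedge_inverse_eq_zero (r.weightX b) (r.weightX_comm b) (b := b)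
      (fun s hs hb => r.isUnit_weightX (κ.α_ne_zero hs hb)) κ.k_conj (fun _ h => h) hg v' v
    have e : (∑ s, ((if ρ s b = b then 0 else (κ.k s * κ.k (s⁻¹ * g) *
        (κ.α s v' * κ.α (s⁻¹ * g) (ρ s⁻¹ v))) • (r.rootInv b s * r.rootInv b (s⁻¹ * g))) -
        (if ρ s b = b then 0 else (κ.k s * κ.k (s⁻¹ * g) *
        (κ.α s v * κ.α (s⁻¹ * g) (ρ s⁻¹ v'))) • (r.rootInv b s * r.rootInv b (s⁻¹ * g))) :
        Module.End ℂ (r.weightSpace b))) = 0 := by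
      refine Eq.trans (Finset.sum_congr rfl fun s _ => ?_) h
      split_ifs
      · rw [sub_zero]
      · refine (sub_smul _ _ (r.rootInv b s * r.rootInv b (s⁻¹ * g))).symm.trans ?_
        change _ = _ • (r.rootInv b s * r.rootInv b (s⁻¹ * g))
        by_cases hs : κ.k s = 0
        · simp [hs]
        -- The corrections caused by `s⁻¹` are symmetric in `v` and `v'` and drop out of the
        -- difference.
        · rw [κ.α_inv_apply hs _ v, κ.α_inv_apply hs _ v', Coupling.wedge]
          congr 1
          ring
    rw [e, LinearMap.zero_apply, Submodule.coe_zero, map_zero]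
  · rw [sub_zero]

/-- The restriction of a realization to the stabilizer of `b`, acting on the generalized weight
space at `b`. -/
def restrict {P : Subgroup W} [Fintype P] (hP : ∀ g, g ∈ P ↔ ρ g b = b) :
    Realization (ρ.comp P.subtype : Representation ℂ P V) (κ.restrict P).k
      (Module.End ℂ (r.weightSpace b)) where
  T :=
    { toFun := fun g => (r.T g.1).restrict fun m hm => by
        have := r.T_mem_weightSpace hm g.1
        rwa [(hP g.1).mp g.2] at this
      map_one' := by ext m; simp
      map_mul' := fun g h => by ext m; simp }
  X := r.weightX b
  Y := r.resY b
  T_mul_X g a := by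
    ext m
    exact LinearMap.congr_fun (r.T_mul_X g.1 a) m.1
  T_mul_Y g v := by
    have hg := (hP g.1).mp g.2
    ext m
    have hTm : ∀ m : r.weightSpace b, r.T g.1 m ∈ r.weightSpace b := fun m => by
      have := r.T_mem_weightSpace m.2 g.1
      rwa [hg] at this
    change r.T g.1 (r.resYAux b v m) = r.resYAux b (ρ g.1 v) ⟨r.T g.1 m, hTm m⟩
    refine r.eq_of_sub_mem_offWeight b (hTm (r.resY b v m)) (r.resYAux_mem b _ _) ?_
    have h1 := r.T_mem_offWeight b (r.Y_sub_resYAux_mem b v m) hg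
    have h2 := r.Y_sub_resYAux_mem b (ρ g.1 v) ⟨r.T g.1 m, hTm m⟩
    have h3 : r.T g.1 (r.Y v m) = r.Y (ρ g.1 v) (r.T g.1 m) :=
      LinearMap.congr_fun (r.T_mul_Y g.1 v) m.1
    rw [map_sub, h3] at h1
    have := sub_mem h2 h1
    rwa [sub_sub_sub_cancel_left] at this
  X_comm := r.weightX_comm b
  Y_comm v v' := by
    ext m
    change (r.resY b v (r.resY b v' m) : L) = r.resY b v' (r.resY b v m)
    refine r.eq_of_sub_mem_offWeight b (Subtype.prop _) (Subtype.prop _) ?_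
    have h1 := r.Y_Y_sub_mem b v v' m
    have h2 := r.Y_Y_sub_mem b v' v m
    have h3 : r.Y v (r.Y v' m) = r.Y v' (r.Y v m) := LinearMap.congr_fun (r.Y_comm v v') m.1
    rw [← r.resCross_symm b v v', ← h3] at h2
    have := sub_mem h2 h1
    rwa [sub_sub_sub_cancel_left, add_sub_add_right_eq_sub] at this
  Y_X v a := by
    classical
    ext m
    have h := r.resYAux_X b v a m
    have e : (∑ s, if ρ s b = b then (κ.k s * a (v - ρ s v)) • r.T s (m : L) else 0) =
        ∑ g : P, (κ.k g.1 * a (v - ρ g.1 v)) • r.T g.1 (m : L) := by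
      refine (Fintype.sum_of_injective _ (Subtype.val_injective (p := (· ∈ P))) _ _
        (fun s hs => ?_) fun g => ?_).symm
      · rw [if_neg]
        intro h
        exact hs ⟨⟨s, (hP s).mpr h⟩, rfl⟩
      · rw [if_pos ((hP g.1).mp g.2)]
    rw [e] at h
    refine h.trans ?_
    simp only [LinearMap.sub_apply, Module.algebraMap_end_apply, LinearMap.sum_apply,
      LinearMap.smul_apply, Submodule.coe_sub, Submodule.coe_smul, AddSubmonoidClass.coe_finsetSum]
    rfl

/-- The `b`-component of `∑ g, T g m = 0` is the sum over the stabilizer, as every other `g` moves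
`m` to a different weight space. -/
theorem Aspherical.restrict {r : Realization ρ κ.k (Module.End ℂ L)} (hr : r.Aspherical) {b : V}
    {P : Subgroup W} [Fintype P] (hP : ∀ g, g ∈ P ↔ ρ g b = b) :
    (r.restrict b hP).Aspherical := by
  classical
  have hmem : ∀ (g : P) (m : r.weightSpace b), r.T g.1 m ∈ r.weightSpace b := fun g m => by
    have := r.T_mem_weightSpace m.2 g.1
    rwa [(hP g.1).mp g.2] at this
  have e : ∀ f : W → L, ∑ g : P, f g.1 = ∑ g, if ρ g b = b then f g else 0 := fun f => by
    refine Fintype.sum_of_injective _ (Subtype.val_injective (p := (· ∈ P))) _ _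
      (fun s hs => ?_) fun g => ?_
    · rw [if_neg]
      intro h
      exact hs ⟨⟨s, (hP s).mpr h⟩, rfl⟩
    · rw [if_pos ((hP g.1).mp g.2)]
  ext m
  rw [LinearMap.sum_apply, AddSubmonoidClass.coe_finsetSum]
  change ∑ g : P, r.T g.1 (m : L) = 0
  refine r.eq_of_sub_mem_offWeight b (sum_mem fun g _ => hmem g m) (zero_mem _) ?_
  have h := LinearMap.congr_fun (show ∑ g, r.T g = 0 from hr) (m : L)
  rw [LinearMap.sum_apply, LinearMap.zero_apply] at h
  rw [e fun g => r.T g m]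
  nth_rw 2 [← h]
  rw [← Finset.sum_sub_distrib]
  refine sum_mem fun g _ => ?_
  split_ifs with hg
  · rw [sub_self]
    exact zero_mem _
  · rw [zero_sub]
    exact neg_mem (r.weightSpace_le_offWeight b hg (r.T_mem_weightSpace m.2 g))

end Realization

/-! ### Induction from a parabolic subgroup -/

/-- The commutators `[y, y']` commute with `𝔥*` as soon as the relations between `W`, `𝔥` and
`𝔥*` hold. -/
theorem Coupling.commute_commutator_X [Fintype W] {ρ : Representation ℂ W V} (κ : Coupling ρ)
    {A : Type*} [Ring A] [Algebra ℂ A] {T : W → A} {X : Module.Dual ℂ V → A} {Y : V →ₗ[ℂ] A}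
    (hT : ∀ g v, T g * Y v = Y (ρ g v) * T g)
    (hY : ∀ v a, Y v * X a - X a * Y v = algebraMap ℂ A (a v) -
      ∑ g, (κ.k g * a (v - ρ g v)) • T g) (v v' : V) (a : Module.Dual ℂ V) :
    Commute (Y v * Y v' - Y v' * Y v) (X a) := by
  have h1 : ∀ v v', Y v * (Y v' * X a - X a * Y v') - (Y v' * X a - X a * Y v') * Y v =
      -∑ g, (κ.k g * a (v' - ρ g v')) • (Y (v - ρ g v) * T g) := by
    intro v v'
    rw [hY, mul_sub, sub_mul, Algebra.commutes, sub_sub_sub_cancel_left, Finset.mul_sum,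
      Finset.sum_mul, ← Finset.sum_sub_distrib, ← Finset.sum_neg_distrib]
    refine Finset.sum_congr rfl fun g _ => ?_
    rw [smul_mul_assoc, hT, mul_smul_comm, ← smul_sub, ← smul_neg, map_sub Y, sub_mul, neg_sub]
  -- In this form the double commutator is visibly symmetric in `v` and `v'`, so its
  -- antisymmetrization vanishes by the Jacobi identity.
  have h2 : ∀ v v', ∑ g, (κ.k g * a (v' - ρ g v')) • (Y (v - ρ g v) * T g) =
      ∑ g, (κ.k g * κ.α g v * κ.α g v' * a (κ.β g)) • (Y (κ.β g) * T g) := by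
    intro v v'
    refine Finset.sum_congr rfl fun g _ => ?_
    by_cases hg : κ.k g = 0
    · simp [hg]
    · rw [κ.sub_apply g hg, κ.sub_apply g hg, map_smul, map_smul, smul_mul_assoc, smul_smul,
        smul_eq_mul]
      congr 1
      ring
  have h3 : (Y v * Y v' - Y v' * Y v) * X a - X a * (Y v * Y v' - Y v' * Y v) =
      (Y v * (Y v' * X a - X a * Y v') - (Y v' * X a - X a * Y v') * Y v) -
      (Y v' * (Y v * X a - X a * Y v) - (Y v * X a - X a * Y v) * Y v') := by
    noncomm_ring
  rw [Commute, SemiconjBy, ← sub_eq_zero, h3, h1, h1, h2, h2, sub_eq_zero]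
  congr 1
  refine Finset.sum_congr rfl fun g _ => ?_
  congr 1
  ring

/-- The forms `α` of conjugate elements are chosen independently and agree with the transported ones
only up to a scalar. This cross-multiplied proportionality avoids naming that scalar. -/
theorem Coupling.α_conj_mul {ρ : Representation ℂ W V} (κ : Coupling ρ) {t p : W} {b : V}
    (ht : κ.k t ≠ 0) (hb : ρ (p⁻¹ * t * p) b ≠ b) (u x : V) :
    κ.α t (ρ p u) * κ.α (p⁻¹ * t * p) (ρ p⁻¹ x) = κ.α (p⁻¹ * t * p) u * κ.α t x := by
  have hs : κ.k (p⁻¹ * t * p) ≠ 0 := by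
    have := κ.k_conj p⁻¹ t
    rw [inv_inv] at this
    rwa [this]
  have hinv : ∀ y, ρ p⁻¹ (ρ p y) = y := fun y => by
    rw [← Module.End.mul_apply, ← map_mul, inv_mul_cancel, map_one, Module.End.one_apply]
  have hinv' : ∀ y, ρ p (ρ p⁻¹ y) = y := fun y => by
    rw [← Module.End.mul_apply, ← map_mul, mul_inv_cancel, map_one, Module.End.one_apply]
  have h : ∀ y, κ.α (p⁻¹ * t * p) y • κ.β (p⁻¹ * t * p) = κ.α t (ρ p y) • ρ p⁻¹ (κ.β t) := by
    intro y
    rw [← κ.sub_apply _ hs, ← map_smul, ← κ.sub_apply _ ht, map_sub, hinv, map_mul, map_mul]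
    rfl
  have h1 := h u
  have h2 := h (ρ p⁻¹ x)
  rw [hinv'] at h2
  apply smul_left_injective ℂ (κ.β_ne_zero hs hb)
  dsimp only
  rw [mul_smul, h2, mul_comm, mul_smul, h1, smul_comm]

namespace Realization

variable {ρ : Representation ℂ W V} {κ : Coupling ρ} {P : Subgroup W} [Fintype P]
  {N : Type*} [AddCommGroup N] [Module ℂ N]
  (r : Realization (ρ.comp P.subtype : Representation ℂ P V) (κ.restrict P).k (Module.End ℂ N))
  (b : V)

/-- The space of the induced realization. -/
def indSpace : Submodule ℂ (W → N) where
  carrier := {f | ∀ (w : W) (p : P), f (w * p) = r.T p⁻¹ (f w)}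
  add_mem' hf hg w p := by simp [hf w p, hg w p]
  zero_mem' w p := by simp
  smul_mem' t f hf w p := by simp [hf w p]

variable (W N) in
/-- Left translation of functions. -/
def translate : W →* Module.End ℂ (W → N) where
  toFun g := LinearMap.funLeft ℂ N (g⁻¹ * ·)
  map_one' := by ext; simp [LinearMap.funLeft]
  map_mul' g h := by ext; simp [LinearMap.funLeft, mul_assoc]

/-- The action of `𝔥*` on functions. -/
def indX : Module.Dual ℂ V →ₗ[ℂ] Module.End ℂ (W → N) where
  toFun a := LinearMap.pi fun w => r.X (ρ.dual w⁻¹ a) ∘ₗ LinearMap.proj w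
  map_add' a a' := by ext; simp
  map_smul' t a := by ext; simp

open Classical in
variable (κ) in
/-- The linear form `k'_s α_s`, or zero if `s` fixes `b`. -/
def indForm (s : W) : Module.Dual ℂ V := if ρ s b = b then 0 else κ.k' s • κ.α s

theorem indForm_of_fixed {s : W} (hb : ρ s b = b) : indForm κ b s = 0 := if_pos hb

theorem indForm_of_not_fixed {s : W} (hb : ρ s b ≠ b) : indForm κ b s = κ.k' s • κ.α s := if_neg hb

theorem indForm_of_eq_zero {s : W} (hs : κ.k s = 0) : indForm κ b s = 0 := by
  rw [indForm, (κ.k_eq_zero_iff s).mp hs, zero_smul, ite_self]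

theorem translate_apply (g : W) (f : W → N) (w : W) : translate W N g f w = f (g⁻¹ * w) := rfl

theorem indX_apply (a : Module.Dual ℂ V) (f : W → N) (w : W) :
    r.indX a f w = r.X (ρ.dual w⁻¹ a) (f w) := rfl

theorem translate_mem {f : W → N} (hf : f ∈ r.indSpace) (g : W) :
    translate W N g f ∈ r.indSpace := fun w p => by
  simp only [translate_apply, ← mul_assoc]
  exact hf _ p

theorem dual_mul_apply (w p : W) (a : Module.Dual ℂ V) :
    ρ.dual (w * p)⁻¹ a = ρ.dual p⁻¹ (ρ.dual w⁻¹ a) := by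
  rw [mul_inv_rev, map_mul, Module.End.mul_apply]

theorem indX_mem {f : W → N} (hf : f ∈ r.indSpace) (a : Module.Dual ℂ V) :
    r.indX a f ∈ r.indSpace := fun w p => by
  rw [indX_apply, indX_apply, hf w p, dual_mul_apply]
  exact (LinearMap.congr_fun (r.T_mul_X p⁻¹ (ρ.dual w⁻¹ a)) (f w)).symm

theorem isUnit_X_α {b : V} (hX : ∀ a m, m ∈ (r.X a).maxGenEigenspace (a b)) {s : W} (hs : κ.k s ≠ 0)
    (hb : ρ s b ≠ b) : IsUnit (r.X (κ.α s)) :=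
  isUnit_of_forall_mem_maxGenEigenspace (κ.α_ne_zero hs hb) (hX _)

/-- Equivariance under `P` of the off-diagonal terms, needed for `indY` to preserve `indSpace`. The
expression `k'_t α_t(v) / α_t` does not depend on the scaling of `α_t`. -/
theorem indForm_conj {b : V} (hP : ∀ g, g ∈ P ↔ ρ g b = b)
    (hX : ∀ a m, m ∈ (r.X a).maxGenEigenspace (a b)) (t : W) (p : P) (v : V) (n : N) :
    indForm κ b (p.1⁻¹ * t * p.1) (ρ p.1⁻¹ v) •
      Ring.inverse (r.X (κ.α (p.1⁻¹ * t * p.1))) (r.T p⁻¹ n) =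
    r.T p⁻¹ (indForm κ b t v • Ring.inverse (r.X (κ.α t)) n) := by
  have hiff : ρ (p.1⁻¹ * t * p.1) b = b ↔ ρ t b = b := by
    rw [← hP, ← hP]
    constructor
    · intro h
      have := P.mul_mem (P.mul_mem p.2 h) (P.inv_mem p.2)
      simpa [mul_assoc] using this
    · intro h
      exact P.mul_mem (P.mul_mem (P.inv_mem p.2) h) p.2
  have hk' : κ.k' (p.1⁻¹ * t * p.1) = κ.k' t := by
    have := κ.k'_conj p.1⁻¹ t
    rwa [inv_inv] at this
  have hk : κ.k (p.1⁻¹ * t * p.1) = κ.k t := by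
    have := κ.k_conj p.1⁻¹ t
    rwa [inv_inv] at this
  by_cases hb : ρ t b = b
  · rw [indForm_of_fixed b hb, indForm_of_fixed b (hiff.mpr hb)]
    simp
  by_cases h0 : κ.k t = 0
  · rw [indForm_of_eq_zero b h0, indForm_of_eq_zero b (hk.trans h0)]
    simp
  have hbs : ρ (p.1⁻¹ * t * p.1) b ≠ b := fun h => hb (hiff.mp h)
  have hu := r.isUnit_X_α hX (hk.trans_ne h0) hbs
  have hu' := r.isUnit_X_α hX h0 hb
  rw [indForm_of_not_fixed b hb, indForm_of_not_fixed b hbs, hk', LinearMap.smul_apply,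
    LinearMap.smul_apply, smul_assoc, smul_assoc, map_smul (r.T p⁻¹)]
  congr 1
  have hinj : Function.Injective (r.X (κ.α (p.1⁻¹ * t * p.1))) :=
    ((Module.End.isUnit_iff _).mp hu).1
  apply hinj
  have e1 : ∀ x, r.X (κ.α (p.1⁻¹ * t * p.1)) (Ring.inverse (r.X (κ.α (p.1⁻¹ * t * p.1))) x) = x :=
    LinearMap.congr_fun (Ring.mul_inverse_cancel _ hu)
  have e2 : ∀ x, r.X (κ.α t) (Ring.inverse (r.X (κ.α t)) x) = x :=
    LinearMap.congr_fun (Ring.mul_inverse_cancel _ hu')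
  have e3 : ∀ x, r.X (κ.α (p.1⁻¹ * t * p.1)) (r.T p⁻¹ x) =
      r.T p⁻¹ (r.X (ρ.dual p.1 (κ.α (p.1⁻¹ * t * p.1))) x) := by
    intro x
    have := LinearMap.congr_fun (r.X_T p⁻¹ (κ.α (p.1⁻¹ * t * p.1))) x
    rw [inv_inv] at this
    exact this
  have e4 : κ.α t v • ρ.dual p.1 (κ.α (p.1⁻¹ * t * p.1)) =
      κ.α (p.1⁻¹ * t * p.1) (ρ p.1⁻¹ v) • κ.α t := by
    ext x
    have := κ.α_conj_mul h0 hbs (ρ p.1⁻¹ v) x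
    rw [← Module.End.mul_apply (ρ p.1), ← map_mul, mul_inv_cancel, map_one,
      Module.End.one_apply] at this
    exact this
  rw [map_smul, e1, e3, map_smul,
    ← LinearMap.smul_apply (κ.α t v) (r.X _), ← map_smul r.X, e4, map_smul, LinearMap.smul_apply, e2, map_smul]

/-- By `compat`, `k'_s (s a - a) = -k_s a(β_s) α_s`, and the root cancels its inverse. This is why
`k'` rather than `k` enters the induced action. -/
theorem indForm_X {b : V} (hX : ∀ a m, m ∈ (r.X a).maxGenEigenspace (a b)) (s : W) (u : V)
    (a : Module.Dual ℂ V) (n : N) [Decidable (ρ s b = b)] :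
    indForm κ b s u • Ring.inverse (r.X (κ.α s)) (r.X (ρ.dual s a) n) -
      r.X a (indForm κ b s u • Ring.inverse (r.X (κ.α s)) n) =
      -(if ρ s b = b then 0 else (κ.k s * a (u - ρ s u)) • n) := by
  by_cases hb : ρ s b = b
  · simp [indForm_of_fixed b hb, hb]
  by_cases h0 : κ.k s = 0
  · simp [indForm_of_eq_zero b h0, h0]
  have hu := r.isUnit_X_α hX h0 hb
  have hcomm : ∀ x, r.X a (Ring.inverse (r.X (κ.α s)) x) = Ring.inverse (r.X (κ.α s)) (r.X a x) :=
    LinearMap.congr_fun (commute_ringInverse (r.X_comm a (κ.α s))).eq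
  have hform : κ.k' s • (ρ.dual s a - a) = -(κ.k s * a (κ.β s)) • κ.α s := by
    ext x
    have := congrArg a (κ.compat s x)
    rw [κ.sub_apply s h0] at this
    simp only [map_smul, smul_eq_mul, map_sub] at this
    simp only [LinearMap.smul_apply, LinearMap.sub_apply, Representation.dual_apply,
      Module.Dual.transpose_apply, LinearMap.comp_apply, smul_eq_mul]
    linear_combination this
  rw [if_neg hb, map_smul, hcomm, ← smul_sub, ← map_sub, ← LinearMap.sub_apply, ← map_sub]
  rw [indForm_of_not_fixed b hb, LinearMap.smul_apply, smul_eq_mul, mul_comm, mul_smul,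
    ← map_smul (Ring.inverse _) (κ.k' s), ← LinearMap.smul_apply (κ.k' s), ← map_smul r.X, hform,
    map_smul, LinearMap.smul_apply, map_smul, ← Module.End.mul_apply, Ring.inverse_mul_cancel _ hu,
    Module.End.one_apply, smul_smul, ← neg_smul, κ.sub_apply s h0, map_smul, smul_eq_mul]
  congr 1
  ring

variable [Fintype W]

/-- The action of `𝔥` on functions. -/
def indY : V →ₗ[ℂ] Module.End ℂ (W → N) where
  toFun v := LinearMap.pi fun w => r.Y (ρ w⁻¹ v) ∘ₗ LinearMap.proj w +
    ∑ s, indForm κ b s (ρ w⁻¹ v) • (Ring.inverse (r.X (κ.α s)) ∘ₗ LinearMap.proj (w * s⁻¹))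
  map_add' a a' := by
    refine LinearMap.ext fun f => funext fun w => ?_
    simp only [LinearMap.pi_apply, LinearMap.add_apply, map_add, add_smul, Finset.sum_add_distrib,
      LinearMap.comp_apply, LinearMap.proj_apply, Pi.add_apply]
    abel
  map_smul' t a := by
    refine LinearMap.ext fun f => funext fun w => ?_
    simp only [LinearMap.pi_apply, LinearMap.add_apply, map_smul, LinearMap.smul_apply,
      Pi.smul_apply, LinearMap.comp_apply, LinearMap.proj_apply, LinearMap.sum_apply, smul_add,
      Finset.smul_sum, RingHom.id_apply, smul_assoc]

theorem indY_apply (v : V) (f : W → N) (w : W) : r.indY b v f w = r.Y (ρ w⁻¹ v) (f w) +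
    ∑ s, indForm κ b s (ρ w⁻¹ v) • Ring.inverse (r.X (κ.α s)) (f (w * s⁻¹)) := by
  simp [indY]

section

variable {b}

theorem indY_mem (hP : ∀ g, g ∈ P ↔ ρ g b = b)
    (hX : ∀ a m, m ∈ (r.X a).maxGenEigenspace (a b)) {f : W → N} (hf : f ∈ r.indSpace) (v : V) :
    r.indY b v f ∈ r.indSpace := fun w p => by
  have hρ : ρ (w * p.1)⁻¹ v = ρ p.1⁻¹ (ρ w⁻¹ v) := by
    rw [mul_inv_rev, map_mul, Module.End.mul_apply]
  rw [indY_apply, indY_apply, hf w p, map_add, map_sum, hρ]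
  congr 1
  · exact (LinearMap.congr_fun (r.T_mul_Y p⁻¹ (ρ w⁻¹ v)) (f w)).symm
  · refine (Fintype.sum_equiv (MulAut.conj p.1⁻¹).toEquiv _ _ fun t => ?_).symm
    have e : (MulAut.conj p.1⁻¹).toEquiv t = (p.1⁻¹ * t * p.1) := by simp
    have e' : w * p * (p.1⁻¹ * t * p.1)⁻¹ = w * t⁻¹ * p := by group
    rw [e, e', hf, r.indForm_conj hP hX]

-- At each `w` the relation for `P` accounts for the elements fixing `b` and the off-diagonal terms
-- for those moving `b`. Conjugation by `w` identifies the combined sum with the required one.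
open Classical in
theorem indY_X (hP : ∀ g, g ∈ P ↔ ρ g b = b) (hX : ∀ a m, m ∈ (r.X a).maxGenEigenspace (a b))
    {f : W → N} (hf : f ∈ r.indSpace) (v : V) (a : Module.Dual ℂ V) :
    r.indY b v (r.indX a f) - r.indX a (r.indY b v f) =
      a v • f - ∑ g, (κ.k g * a (v - ρ g v)) • translate W N g f := by
  funext w
  have hdiag := LinearMap.congr_fun (r.Y_X (ρ w⁻¹ v) (ρ.dual w⁻¹ a)) (f w)
  simp only [LinearMap.sub_apply, Module.End.mul_apply, Module.algebraMap_end_apply,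
    LinearMap.sum_apply, LinearMap.smul_apply] at hdiag
  have hinv : ∀ (y : V), ρ w (ρ w⁻¹ y) = y := fun y => by
    rw [← Module.End.mul_apply, ← map_mul, mul_inv_cancel, map_one, Module.End.one_apply]
  have hpair : (ρ.dual w⁻¹ a) (ρ w⁻¹ v) = a v := by
    simp [Representation.dual_apply, Module.Dual.transpose_apply, hinv]
  have hoff : ∀ s, indForm κ b s (ρ w⁻¹ v) • Ring.inverse (r.X (κ.α s))
      (r.indX a f (w * s⁻¹)) - r.X (ρ.dual w⁻¹ a) (indForm κ b s (ρ w⁻¹ v) •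
        Ring.inverse (r.X (κ.α s)) (f (w * s⁻¹))) =
      -(if ρ s b = b then 0 else
        (κ.k s * (ρ.dual w⁻¹ a) (ρ w⁻¹ v - ρ s (ρ w⁻¹ v))) • f (w * s⁻¹)) := by
    intro s
    rw [← r.indForm_X hX, indX_apply, dual_mul_apply, inv_inv]
  have hon : ∑ p : P, ((κ.restrict P).k p * (ρ.dual w⁻¹ a) (ρ w⁻¹ v -
      (ρ.comp P.subtype : Representation ℂ P V) p (ρ w⁻¹ v))) • r.T p (f w) =
      ∑ s, if ρ s b = b then
        (κ.k s * (ρ.dual w⁻¹ a) (ρ w⁻¹ v - ρ s (ρ w⁻¹ v))) • f (w * s⁻¹) else 0 := by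
    refine Fintype.sum_of_injective _ (Subtype.val_injective (p := (· ∈ P))) _ _
      (fun s hs => ?_) fun p => ?_
    · rw [if_neg]
      intro h
      exact hs ⟨⟨s, (hP s).mpr h⟩, rfl⟩
    · rw [if_pos ((hP p.1).mp p.2)]
      have := hf w p⁻¹
      rw [inv_inv] at this
      rw [← this]
      rfl
  have hall : (∑ g, (κ.k g * a (v - ρ g v)) • translate W N g f) w =
      ∑ s, (κ.k s * (ρ.dual w⁻¹ a) (ρ w⁻¹ v - ρ s (ρ w⁻¹ v))) • f (w * s⁻¹) := by
    rw [Finset.sum_apply]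
    refine (Fintype.sum_equiv (MulAut.conj w).toEquiv _ _ fun s => ?_).symm
    have e : (MulAut.conj w).toEquiv s = w * s * w⁻¹ := by simp
    rw [e, Pi.smul_apply, translate_apply, κ.k_conj]
    congr 1
    · congr 1
      simp only [map_sub, Representation.dual_apply, Module.Dual.transpose_apply,
        LinearMap.comp_apply, inv_inv, hinv, map_mul, Module.End.mul_apply]
    · group
  rw [Pi.sub_apply, Pi.sub_apply, hall, indX_apply, indY_apply, indY_apply, indX_apply, map_add,
    map_sum, add_sub_add_comm, hdiag, ← Finset.sum_sub_distrib,
    Finset.sum_congr rfl fun s _ => hoff s, hon, hpair, sub_add, ← Finset.sum_sub_distrib,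
    Pi.smul_apply]
  congr 1
  refine Finset.sum_congr rfl fun s _ => ?_
  split_ifs <;> simp

end

end Realization

/-- Commutators in `𝔥` commute with `𝔥*` before `[y, y'] = 0` is known, so they preserve generalized
weights. -/
theorem Coupling.sub_pow_commutator_eq_zero [Fintype W] {ρ : Representation ℂ W V}
    (κ : Coupling ρ) {L : Type*} [AddCommGroup L] [Module ℂ L] {T : W →* Module.End ℂ L}
    {X : Module.Dual ℂ V →ₗ[ℂ] Module.End ℂ L} {Y : V →ₗ[ℂ] Module.End ℂ L}
    (hT : ∀ g v, T g * Y v = Y (ρ g v) * T g)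
    (hY : ∀ v a, Y v * X a - X a * Y v = algebraMap ℂ _ (a v) -
      ∑ g, (κ.k g * a (v - ρ g v)) • T g) (v v' : V) {a : Module.Dual ℂ V} {t : ℂ} {n : ℕ} {f : L}
    (hf : ((X a - t • 1) ^ n) f = 0) :
    ((X a - t • 1) ^ n) ((Y v * Y v' - Y v' * Y v) f) = 0 := by
  have h : Commute (Y v * Y v' - Y v' * Y v) (X a - t • 1) :=
    (κ.commute_commutator_X hT hY v v' a).sub_right ((Commute.one_right _).smul_right _)
  rw [← Module.End.mul_apply, ← (h.pow_right n).eq, Module.End.mul_apply, hf, map_zero]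

/-! ### The relations on the induced space -/

namespace Realization

variable {ρ : Representation ℂ W V} {κ : Coupling ρ} {P : Subgroup W} [Fintype P]
  {N : Type*} [AddCommGroup N] [Module ℂ N]
  (r : Realization (ρ.comp P.subtype : Representation ℂ P V) (κ.restrict P).k (Module.End ℂ N))
  {b : V}

theorem translate_indX (g : W) (a : Module.Dual ℂ V) (f : W → N) :
    translate W N g (r.indX a f) = r.indX (ρ.dual g a) (translate W N g f) := by
  funext w
  rw [translate_apply, indX_apply, indX_apply, translate_apply, mul_inv_rev, inv_inv, map_mul,
    Module.End.mul_apply]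

theorem indX_comm (a a' : Module.Dual ℂ V) (f : W → N) :
    r.indX a (r.indX a' f) = r.indX a' (r.indX a f) := by
  funext w
  exact LinearMap.congr_fun (r.X_comm (ρ.dual w⁻¹ a) (ρ.dual w⁻¹ a')) (f w)

open Classical in
variable (P) in
/-- The restriction of a function to the coset `u P`, extended by zero. -/
def cosetPart (u : W) (f : W → N) : W → N := fun w => if u⁻¹ * w ∈ P then f w else 0

theorem cosetPart_mem {f : W → N} (hf : f ∈ r.indSpace) (u : W) :
    cosetPart P u f ∈ r.indSpace := fun w p => by
  have : u⁻¹ * (w * p) ∈ P ↔ u⁻¹ * w ∈ P := by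
    rw [← mul_assoc]
    exact P.mul_mem_cancel_right p.2
  by_cases h : u⁻¹ * w ∈ P
  · simp only [cosetPart, if_pos h, if_pos (this.mpr h)]
    exact hf w p
  · simp only [cosetPart, if_neg h, if_neg (mt this.mp h), map_zero]

theorem sum_cosetPart [Fintype W] (f : W → N) :
    ∑ u, cosetPart P u f = (Fintype.card P : ℂ) • f := by
  classical
  funext w
  rw [Finset.sum_apply, Pi.smul_apply]
  have : (∑ u, cosetPart P u f w) = ∑ _p : P, f w := by
    refine (Fintype.sum_of_injective (fun p : P => w * p.1) (fun p q h => ?_) _ _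
      (fun u hu => ?_) fun p => ?_).symm
    · exact Subtype.ext (mul_left_cancel h)
    · refine if_neg fun h => hu ⟨⟨w⁻¹ * u, ?_⟩, mul_inv_cancel_left _ _⟩
      have := P.inv_mem h
      rwa [mul_inv_rev, inv_inv] at this
    · refine (if_pos ?_).symm
      rw [mul_inv_rev, inv_mul_cancel_right]
      exact P.inv_mem p.2
  rw [this, Finset.sum_const, Finset.card_univ, Nat.cast_smul_eq_nsmul]

theorem indX_sub_pow_apply (a : Module.Dual ℂ V) (t : ℂ) (n : ℕ) (f : W → N) (w : W) :
    ((r.indX a - t • 1) ^ n) f w = ((r.X (ρ.dual w⁻¹ a) - t • 1) ^ n) (f w) := by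
  induction n generalizing f with
  | zero => simp
  | succ n ih =>
    rw [pow_succ, pow_succ, Module.End.mul_apply, Module.End.mul_apply, ih]
    rfl

theorem dual_inv_apply (w : W) (a : Module.Dual ℂ V) (x : V) : ρ.dual w⁻¹ a x = a (ρ w x) := by
  simp [Representation.dual_apply, Module.Dual.transpose_apply]

/-- Functions supported on the coset `u P` have generalized weight `u b`, since `w b = u b` there.
Distinct cosets give distinct weights, whence the converse `apply_eq_zero_of_indX_sub_pow`. -/
theorem exists_indX_sub_pow_eq_zero [Finite W] (hP : ∀ g, g ∈ P ↔ ρ g b = b)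
    (hX : ∀ a m, m ∈ (r.X a).maxGenEigenspace (a b)) {u : W} {f : W → N}
    (hf : ∀ w, u⁻¹ * w ∉ P → f w = 0) (a : Module.Dual ℂ V) :
    ∃ n : ℕ, ((r.indX a - a (ρ u b) • 1) ^ n) f = 0 := by
  classical
  have := Fintype.ofFinite W
  have h : ∀ w, ∃ n : ℕ, ((r.X (ρ.dual w⁻¹ a) - a (ρ u b) • 1) ^ n) (f w) = 0 := by
    intro w
    by_cases hw : u⁻¹ * w ∈ P
    · have e : ρ w b = ρ u b := by
        have h1 := (hP _).mp hw
        rw [← mul_inv_cancel_left u w, map_mul, Module.End.mul_apply, h1]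
      have := (Module.End.mem_maxGenEigenspace _ _ _).mp (hX (ρ.dual w⁻¹ a) (f w))
      rwa [dual_inv_apply, e] at this
    · exact ⟨0, by rw [hf w hw, map_zero]⟩
  choose n hn using h
  refine ⟨∑ w, n w, funext fun w => ?_⟩
  rw [indX_sub_pow_apply, ← Finset.sum_erase_add _ _ (Finset.mem_univ w), pow_add,
    Module.End.mul_apply, hn, map_zero, Pi.zero_apply]

theorem apply_eq_zero_of_indX_sub_pow (hP : ∀ g, g ∈ P ↔ ρ g b = b)
    (hX : ∀ a m, m ∈ (r.X a).maxGenEigenspace (a b)) {u w : W} (huw : u⁻¹ * w ∉ P) {f : W → N}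
    (hf : ∀ a : Module.Dual ℂ V, ∃ n : ℕ, ((r.indX a - a (ρ u b) • 1) ^ n) f = 0) : f w = 0 := by
  have hne : ρ u b - ρ w b ≠ 0 := by
    intro h
    apply huw
    rw [hP, map_mul, Module.End.mul_apply, ← sub_eq_zero.mp h, ← Module.End.mul_apply, ← map_mul,
      inv_mul_cancel, map_one, Module.End.one_apply]
  obtain ⟨a, ha⟩ := Module.Projective.exists_dual_ne_zero ℂ hne
  rw [map_sub, sub_ne_zero] at ha
  obtain ⟨n, hn⟩ := hf a
  have h1 : f w ∈ (r.X (ρ.dual w⁻¹ a)).maxGenEigenspace (a (ρ u b)) := by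
    rw [Module.End.mem_maxGenEigenspace]
    exact ⟨n, by rw [← indX_sub_pow_apply, hn, Pi.zero_apply]⟩
  have h2 := hX (ρ.dual w⁻¹ a) (f w)
  rw [dual_inv_apply] at h2
  exact Submodule.disjoint_def.mp (Module.End.disjoint_genEigenspace _ ha ⊤ ⊤) _ h1 h2

/-- The restriction of translation to the space of the induced realization. -/
def indSpaceT : W →* Module.End ℂ r.indSpace where
  toFun g := (translate W N g).restrict fun _ hf => r.translate_mem hf g
  map_one' := by ext f : 2; simp
  map_mul' g h := by ext f : 2; simp

/-- The action of `𝔥*` on the space of the induced realization. -/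
def indSpaceX : Module.Dual ℂ V →ₗ[ℂ] Module.End ℂ r.indSpace where
  toFun a := (r.indX a).restrict fun _ hf => r.indX_mem hf a
  map_add' a a' := by ext f : 2; simp
  map_smul' t a := by ext f : 2; simp

theorem coe_indSpaceX_sub_pow (a : Module.Dual ℂ V) (t : ℂ) (n : ℕ) (f : r.indSpace) :
    (((r.indSpaceX a - t • 1) ^ n) f : W → N) = ((r.indX a - t • 1) ^ n) f := by
  induction n generalizing f with
  | zero => simp
  | succ n ih =>
    rw [pow_succ, pow_succ, Module.End.mul_apply, Module.End.mul_apply, ih]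
    rfl

instance nontrivial_indSpace [Nontrivial N] : Nontrivial r.indSpace := by
  classical
  obtain ⟨n, hn⟩ := exists_ne (0 : N)
  refine ⟨⟨⟨fun w => if h : w ∈ P then r.T (⟨w, h⟩⁻¹ : P) n else 0, fun w p => ?_⟩, 0, ?_⟩⟩
  · by_cases hw : w ∈ P
    · have h1 : w * p ∈ P := P.mul_mem hw p.2
      have h2 : (⟨w * p, h1⟩⁻¹ : P) = p⁻¹ * ⟨w, hw⟩⁻¹ := by
        rw [← mul_inv_rev]; rfl
      beta_reduce
      rw [dif_pos hw, dif_pos h1, h2, map_mul, Module.End.mul_apply]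
    · have h1 : w * p ∉ P := fun h => hw ((P.mul_mem_cancel_right p.2).mp h)
      beta_reduce
      rw [dif_neg hw, dif_neg h1, map_zero]
  · intro h
    have := congrFun (congrArg Subtype.val h) 1
    simp only [dif_pos P.one_mem] at this
    apply hn
    have e : (⟨1, P.one_mem⟩⁻¹ : P) = 1 := by rw [inv_eq_one]; rfl
    rw [e, map_one] at this
    exact this

variable [Fintype W]

theorem translate_indY (g : W) (v : V) (f : W → N) :
    translate W N g (r.indY b v f) = r.indY b (ρ g v) (translate W N g f) := by
  funext w
  rw [translate_apply, indY_apply, indY_apply, translate_apply, mul_inv_rev, inv_inv, map_mul,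
    Module.End.mul_apply]
  simp only [translate_apply, mul_assoc]

/-- The rank two identity again, this time with the weights `k'`. -/
theorem indForm_inverse_antisymm (hX : ∀ a m, m ∈ (r.X a).maxGenEigenspace (a b)) {g : W}
    (hg : ρ g b = b) (u u' : V) :
    ∑ t, (indForm κ b (t⁻¹ * g) u * indForm κ b t (ρ (t⁻¹ * g) u')) •
      (Ring.inverse (r.X (κ.α (t⁻¹ * g))) * Ring.inverse (r.X (κ.α t))) =
    ∑ t, (indForm κ b (t⁻¹ * g) u' * indForm κ b t (ρ (t⁻¹ * g) u)) •
      (Ring.inverse (r.X (κ.α (t⁻¹ * g))) * Ring.inverse (r.X (κ.α t))) := by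
  classical
  have h := κ.sum_wedge_inverse_eq_zero r.X r.X_comm (b := b)
    (fun s hs hb => r.isUnit_X_α hX hs hb) κ.k'_conj (fun g => (κ.k_eq_zero_iff g).mp) hg u' u
  rw [← sub_eq_zero, ← Finset.sum_sub_distrib, ← h]
  refine Finset.sum_congr rfl fun t _ => ?_
  by_cases hb : ρ t b = b
  · simp [indForm_of_fixed b hb, hb]
  have hb' : ρ (t⁻¹ * g) b ≠ b := by rwa [Ne, fix_inv_mul_iff hg]
  have hc : Ring.inverse (r.X (κ.α (t⁻¹ * g))) * Ring.inverse (r.X (κ.α t)) =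
      Ring.inverse (r.X (κ.α t)) * Ring.inverse (r.X (κ.α (t⁻¹ * g))) :=
    Commute.ringInverse_ringInverse (r.X_comm _ _)
  rw [if_neg hb, ← sub_smul, hc]
  congr 1
  by_cases hk : κ.k (t⁻¹ * g) = 0
  · simp [indForm_of_eq_zero b hk, (κ.k_eq_zero_iff _).mp hk]
  rw [indForm_of_not_fixed b hb, indForm_of_not_fixed b hb', κ.apply_eq hk u, κ.apply_eq hk u']
  simp only [LinearMap.smul_apply, map_sub, map_smul, smul_eq_mul, Coupling.wedge]
  ring

/-- A single step `s` that moves `b` leads outside `w P`, where `f` vanishes. Only the diagonal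
product and the pairs of off-diagonal steps can survive. -/
theorem indY_indY_apply (hP : ∀ g, g ∈ P ↔ ρ g b = b) {w : W} {f : W → N}
    (hf : ∀ x, w⁻¹ * x ∉ P → f x = 0) (v v' : V) :
    r.indY b v (r.indY b v' f) w = r.Y (ρ w⁻¹ v) (r.Y (ρ w⁻¹ v') (f w)) +
      ∑ g, (∑ t, (indForm κ b (t⁻¹ * g) (ρ w⁻¹ v) *
        indForm κ b t (ρ (t⁻¹ * g) (ρ w⁻¹ v'))) •
        (Ring.inverse (r.X (κ.α (t⁻¹ * g))) * Ring.inverse (r.X (κ.α t)))) (f (w * g⁻¹)) := by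
  have hz : ∀ s, ∀ n : N → N, ∀ y, n 0 = 0 → indForm κ b s y • n (f (w * s⁻¹)) = 0 := by
    intro s n y h0
    by_cases hb : ρ s b = b
    · rw [indForm_of_fixed b hb, LinearMap.zero_apply, zero_smul]
    · rw [hf, h0, smul_zero]
      rw [inv_mul_cancel_left, P.inv_mem_iff, hP]
      exact hb
  have h1 : r.indY b v' f w = r.Y (ρ w⁻¹ v') (f w) := by
    rw [indY_apply, Finset.sum_eq_zero, add_zero]
    exact fun s _ => hz s _ _ (map_zero _)
  rw [indY_apply, h1]
  congr 1
  have h2 : ∀ s, indForm κ b s (ρ w⁻¹ v) • Ring.inverse (r.X (κ.α s)) (r.indY b v' f (w * s⁻¹)) =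
      ∑ t, (indForm κ b s (ρ w⁻¹ v) * indForm κ b t (ρ s (ρ w⁻¹ v'))) •
        Ring.inverse (r.X (κ.α s)) (Ring.inverse (r.X (κ.α t)) (f (w * s⁻¹ * t⁻¹))) := by
    intro s
    rw [indY_apply, map_add, smul_add]
    rw [hz s (fun n => Ring.inverse (r.X (κ.α s)) (r.Y (ρ (w * s⁻¹)⁻¹ v') n)) _ (by simp),
      zero_add, map_sum, Finset.smul_sum]
    refine Finset.sum_congr rfl fun t _ => ?_
    rw [map_smul, smul_smul, mul_inv_rev, inv_inv, map_mul, Module.End.mul_apply]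
  rw [Finset.sum_congr rfl fun s _ => h2 s, Finset.sum_comm]
  simp only [LinearMap.sum_apply, LinearMap.smul_apply, Module.End.mul_apply]
  rw [Finset.sum_comm (γ := W) (s := Finset.univ (α := W)) (t := Finset.univ (α := W))
    (f := fun g t => (indForm κ b (t⁻¹ * g) (ρ w⁻¹ v) *
        indForm κ b t (ρ (t⁻¹ * g) (ρ w⁻¹ v'))) •
        Ring.inverse (r.X (κ.α (t⁻¹ * g))) (Ring.inverse (r.X (κ.α t)) (f (w * g⁻¹))))]
  refine Finset.sum_congr rfl fun t _ => ?_
  refine Fintype.sum_equiv (Equiv.mulLeft t) _ _ fun s => ?_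
  rw [Equiv.coe_mulLeft, inv_mul_cancel_left, mul_inv_rev, mul_assoc]

section

variable (hP : ∀ g, g ∈ P ↔ ρ g b = b) (hX : ∀ a m, m ∈ (r.X a).maxGenEigenspace (a b))

/-- The action of `𝔥` on the space of the induced realization. -/
def indSpaceY : V →ₗ[ℂ] Module.End ℂ r.indSpace where
  toFun v := (r.indY b v).restrict fun _ hf => r.indY_mem hP hX hf v
  map_add' a a' := by ext f : 2; simp
  map_smul' t a := by ext f : 2; simp

theorem indSpaceT_mul_indSpaceY (g : W) (v : V) :
    r.indSpaceT g * r.indSpaceY hP hX v = r.indSpaceY hP hX (ρ g v) * r.indSpaceT g :=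
  LinearMap.ext fun f => Subtype.ext (r.translate_indY g v f.1)

theorem indSpaceY_X (v : V) (a : Module.Dual ℂ V) :
    r.indSpaceY hP hX v * r.indSpaceX a - r.indSpaceX a * r.indSpaceY hP hX v =
      algebraMap ℂ _ (a v) - ∑ g, (κ.k g * a (v - ρ g v)) • r.indSpaceT g := by
  refine LinearMap.ext fun f => Subtype.ext ((r.indY_X hP hX f.2 v a).trans ?_)
  simp only [LinearMap.sub_apply, Module.algebraMap_end_apply, LinearMap.sum_apply,
    LinearMap.smul_apply, Submodule.coe_sub, Submodule.coe_smul, AddSubmonoidClass.coe_finsetSum]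
  rfl

/-- The commutator keeps the generalized weight `u b`, so its values off `u P` vanish without
computation. On `u P` the two-step formula and the rank two identity apply. -/
theorem commutator_indSpaceY_eq_zero (v v' : V) {u : W} {f : r.indSpace}
    (hf : ∀ w, u⁻¹ * w ∉ P → f.1 w = 0) :
    (r.indSpaceY hP hX v * r.indSpaceY hP hX v' - r.indSpaceY hP hX v' * r.indSpaceY hP hX v) f =
      0 := by
  refine Subtype.ext (funext fun w => ?_)
  by_cases huw : u⁻¹ * w ∈ P
  · have hf' : ∀ x, w⁻¹ * x ∉ P → f.1 x = 0 := fun x hx => hf x fun h => hx (by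
      have := P.mul_mem (P.inv_mem huw) h
      rwa [mul_inv_rev, inv_inv, mul_assoc, mul_inv_cancel_left] at this)
    change r.indY b v (r.indY b v' f.1) w - r.indY b v' (r.indY b v f.1) w = 0
    rw [r.indY_indY_apply hP hf', r.indY_indY_apply hP hf', sub_eq_zero]
    congr 1
    · exact LinearMap.congr_fun (r.Y_comm (ρ w⁻¹ v) (ρ w⁻¹ v')) (f.1 w)
    · refine Finset.sum_congr rfl fun g _ => ?_
      by_cases hg : ρ g b = b
      · rw [r.indForm_inverse_antisymm hX hg]
      · rw [hf', map_zero, map_zero]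
        rwa [inv_mul_cancel_left, P.inv_mem_iff, hP]
  · refine r.apply_eq_zero_of_indX_sub_pow hP hX huw fun a => ?_
    obtain ⟨n, hn⟩ := r.exists_indX_sub_pow_eq_zero hP hX hf a
    refine ⟨n, ?_⟩
    have h0 : ((r.indSpaceX a - a (ρ u b) • 1) ^ n) f = 0 :=
      Subtype.ext (by rw [coe_indSpaceX_sub_pow, hn]; rfl)
    have h1 := κ.sub_pow_commutator_eq_zero (r.indSpaceT_mul_indSpaceY hP hX)
      (r.indSpaceY_X hP hX) v v' h0
    rw [← coe_indSpaceX_sub_pow, h1]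
    rfl

/-- The realization induced from the stabilizer of `b`. -/
def induce : Realization ρ κ.k (Module.End ℂ r.indSpace) where
  T := r.indSpaceT
  X := r.indSpaceX
  Y := r.indSpaceY hP hX
  T_mul_X g a := LinearMap.ext fun f => Subtype.ext (r.translate_indX g a f.1)
  T_mul_Y := r.indSpaceT_mul_indSpaceY hP hX
  X_comm a a' := LinearMap.ext fun f => Subtype.ext (r.indX_comm a a' f.1)
  Y_comm v v' := by
    rw [← sub_eq_zero]
    ext f : 1
    -- Each coset part occurs once for every `u` in that coset, hence the factor `|P|`.
    have h : (Fintype.card P : ℂ) • f =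
        ∑ u, (⟨cosetPart P u f.1, r.cosetPart_mem f.2 u⟩ : r.indSpace) :=
      Subtype.ext (by rw [AddSubmonoidClass.coe_finsetSum]; exact (sum_cosetPart f.1).symm)
    have h' := congrArg (r.indSpaceY hP hX v * r.indSpaceY hP hX v' -
      r.indSpaceY hP hX v' * r.indSpaceY hP hX v) h
    rw [map_smul, map_sum, Finset.sum_eq_zero fun u _ =>
      r.commutator_indSpaceY_eq_zero hP hX v v' (u := u) fun w hw => if_neg hw] at h'
    exact (smul_eq_zero.mp h').resolve_left (Nat.cast_ne_zero.mpr Fintype.card_ne_zero)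
  Y_X := r.indSpaceY_X hP hX

/-- The symmetrizer sends `f` to the constant function with value `∑ f(g)`. Averaging this sum over
right translations by `P` applies `∑ T p = 0`. -/
theorem Aspherical.induce {r : Realization (ρ.comp P.subtype : Representation ℂ P V)
    (κ.restrict P).k (Module.End ℂ N)} (hr : r.Aspherical) (hP : ∀ g, g ∈ P ↔ ρ g b = b)
    (hX : ∀ a m, m ∈ (r.X a).maxGenEigenspace (a b)) : (r.induce hP hX).Aspherical := by
  refine LinearMap.ext fun f => Subtype.ext (funext fun w => ?_)
  rw [LinearMap.sum_apply, AddSubmonoidClass.coe_finsetSum, Finset.sum_apply]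
  change ∑ g : W, f.1 (g⁻¹ * w) = 0
  have h1 : ∑ g : W, f.1 (g⁻¹ * w) = ∑ g, f.1 g :=
    Fintype.sum_equiv ((Equiv.inv W).trans (Equiv.mulRight w)) _ _ fun g => rfl
  have h2 : ∀ p : P, ∑ g, f.1 g = ∑ g, r.T p⁻¹ (f.1 g) := fun p =>
    (Fintype.sum_equiv (Equiv.mulRight p.1) _ _ fun g => (f.2 g p).symm).symm
  have h3 : ∑ _p : P, ∑ g, f.1 g = 0 := by
    rw [Finset.sum_congr rfl fun p _ => h2 p, Finset.sum_comm]
    refine Finset.sum_eq_zero fun g _ => ?_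
    rw [← LinearMap.sum_apply]
    have : ∑ p : P, r.T p⁻¹ = ∑ p, r.T p := Fintype.sum_equiv (Equiv.inv P) _ _ fun p => rfl
    rw [this, show ∑ p, r.T p = 0 from hr, LinearMap.zero_apply]
  rw [Finset.sum_const, Finset.card_univ, ← Nat.cast_smul_eq_nsmul ℂ] at h3
  rw [h1]
  exact (smul_eq_zero.mp h3).resolve_left (Nat.cast_ne_zero.mpr Fintype.card_ne_zero)

end

end Realization

/-! ### Passing to the quotient by the fixed vectors -/

open scoped TensorProduct

theorem tmul_commutator {A B : Type*} [Ring A] [Algebra ℂ A] [Ring B] [Algebra ℂ B] (x y : A)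
    (x' y' : B) :
    (y ⊗ₜ[ℂ] 1 + 1 ⊗ₜ[ℂ] y') * (x ⊗ₜ[ℂ] 1 + 1 ⊗ₜ[ℂ] x') -
      (x ⊗ₜ[ℂ] 1 + 1 ⊗ₜ[ℂ] x') * (y ⊗ₜ[ℂ] 1 + 1 ⊗ₜ[ℂ] y') =
      (y * x - x * y) ⊗ₜ[ℂ] (1 : B) + (1 : A) ⊗ₜ[ℂ] (y' * x' - x' * y') := by
  simp only [mul_add, add_mul, Algebra.TensorProduct.tmul_mul_tmul, one_mul, mul_one,
    TensorProduct.sub_tmul, TensorProduct.tmul_sub]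
  abel

/-- A splitting of a representation into `ρ'` and a trivial representation. -/
structure Splitting (ρ : Representation ℂ W V) {V' : Type*} [AddCommGroup V'] [Module ℂ V']
    (ρ' : Representation ℂ W V') where
  π : V →ₗ[ℂ] V'
  σ : V' →ₗ[ℂ] V
  π_σ : ∀ q, π (σ q) = q
  π_map : ∀ g v, π (ρ g v) = ρ' g (π v)
  σ_map : ∀ g q, σ (ρ' g q) = ρ g (σ q)
  fixed : ∀ g v, ρ g (v - σ (π v)) = v - σ (π v)

namespace Splitting

variable {ρ : Representation ℂ W V} {V' : Type*} [AddCommGroup V'] [Module ℂ V']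
  {ρ' : Representation ℂ W V'} (S : Splitting ρ ρ')

/-- The projection to the trivial summand. -/
def proj : V →ₗ[ℂ] V := LinearMap.id - S.σ ∘ₗ S.π

theorem proj_apply (v : V) : S.proj v = v - S.σ (S.π v) := rfl

theorem map_proj (g : W) (v : V) : ρ g (S.proj v) = S.proj v := S.fixed g v

theorem proj_map (g : W) (v : V) : S.proj (ρ g v) = S.proj v := by
  rw [← S.map_proj g v, proj_apply, proj_apply, S.π_map, S.σ_map, map_sub]

theorem proj_proj (v : V) : S.proj (S.proj v) = S.proj v := by
  rw [proj_apply S (S.proj v), proj_apply, map_sub, S.π_σ, sub_self, map_zero, sub_zero]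

theorem sub_eq (g : W) (v : V) : v - ρ g v = S.σ (S.π v - ρ' g (S.π v)) := by
  have := S.fixed g v
  rw [map_sub, sub_eq_sub_iff_sub_eq_sub] at this
  rw [map_sub, S.σ_map, ← neg_sub, this, neg_sub]

theorem dual_comp_π (g : W) (a : Module.Dual ℂ V') : ρ.dual g (a ∘ₗ S.π) = ρ'.dual g a ∘ₗ S.π := by
  ext v
  simp [Representation.dual_apply, Module.Dual.transpose_apply, S.π_map]

theorem dual_comp_σ (g : W) (a : Module.Dual ℂ V) : ρ.dual g a ∘ₗ S.σ = ρ'.dual g (a ∘ₗ S.σ) := by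
  ext v
  simp [Representation.dual_apply, Module.Dual.transpose_apply, S.σ_map]

/-- Multiplication operators on polynomials attached to linear forms. -/
def polyX [FiniteDimensional ℂ V] :
    Module.Dual ℂ V →ₗ[ℂ] MvPolynomial (Fin (Module.finrank ℂ V)) ℂ where
  -- Variables are kept for a basis of all of `𝔥`; projecting both forms and vectors gives the
  -- commutator `a (proj v)` without a basis of the trivial summand.
  toFun a := ∑ i, a (S.proj (Module.finBasis ℂ V i)) • MvPolynomial.X i
  map_add' a a' := by simp [add_smul, Finset.sum_add_distrib]
  map_smul' t a := by simp [Finset.smul_sum, mul_smul]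

/-- Differentiation operators on polynomials attached to vectors. -/
def polyY [FiniteDimensional ℂ V] :
    V →ₗ[ℂ] Derivation ℂ (MvPolynomial (Fin (Module.finrank ℂ V)) ℂ)
      (MvPolynomial (Fin (Module.finrank ℂ V)) ℂ) where
  toFun v := MvPolynomial.mkDerivation ℂ fun i =>
    algebraMap ℂ _ ((Module.finBasis ℂ V).coord i (S.proj v))
  map_add' v v' := by ext i; simp [MvPolynomial.mkDerivation_X]
  map_smul' t v := by ext i; simp [MvPolynomial.mkDerivation_X]

theorem polyY_polyX [FiniteDimensional ℂ V] (v : V) (a : Module.Dual ℂ V) :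
    S.polyY v (S.polyX a) = algebraMap ℂ _ (a (S.proj v)) := by
  have h : a (S.proj v) = ∑ i, a (S.proj (Module.finBasis ℂ V i)) *
      (Module.finBasis ℂ V).coord i (S.proj v) := by
    conv_lhs => rw [← S.proj_proj, ← (Module.finBasis ℂ V).sum_repr (S.proj v)]
    rw [map_sum, map_sum]
    refine Finset.sum_congr rfl fun i _ => ?_
    rw [map_smul, map_smul, smul_eq_mul, mul_comm, Module.Basis.coord_apply]
  rw [h, map_sum]
  simp only [polyX, polyY, LinearMap.coe_mk, AddHom.coe_mk, map_sum]
  refine Finset.sum_congr rfl fun i _ => ?_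
  rw [Derivation.map_smul, MvPolynomial.mkDerivation_X, Algebra.smul_def, map_mul]

theorem polyY_comm [FiniteDimensional ℂ V] (v v' : V)
    (p : MvPolynomial (Fin (Module.finrank ℂ V)) ℂ) :
    S.polyY v (S.polyY v' p) = S.polyY v' (S.polyY v p) := by
  have h : ⁅S.polyY v, S.polyY v'⁆ = 0 := by
    refine MvPolynomial.derivation_ext fun i => ?_
    rw [Derivation.commutator_apply]
    simp [polyY, MvPolynomial.mkDerivation_X]
  have := DFunLike.congr_fun h p
  rwa [Derivation.commutator_apply, Derivation.zero_apply, sub_eq_zero] at this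

theorem polyX_dual [FiniteDimensional ℂ V] (g : W) (a : Module.Dual ℂ V) :
    S.polyX (ρ.dual g a) = S.polyX a := by
  simp [polyX, Representation.dual_apply, Module.Dual.transpose_apply, S.map_proj]

theorem polyY_map [FiniteDimensional ℂ V] (g : W) (v : V) : S.polyY (ρ g v) = S.polyY v := by
  simp only [polyY, LinearMap.coe_mk, AddHom.coe_mk, S.proj_map]

/-- Multiplication operators on polynomials. -/
def weylX [FiniteDimensional ℂ V] :
    Module.Dual ℂ V →ₗ[ℂ] Module.End ℂ (MvPolynomial (Fin (Module.finrank ℂ V)) ℂ) :=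
  (Algebra.lmul ℂ _).toLinearMap ∘ₗ S.polyX

/-- Differentiation operators on polynomials. -/
def weylY [FiniteDimensional ℂ V] :
    V →ₗ[ℂ] Module.End ℂ (MvPolynomial (Fin (Module.finrank ℂ V)) ℂ) where
  toFun v := (S.polyY v).toLinearMap
  map_add' v v' := by rw [map_add]; rfl
  map_smul' t v := by rw [map_smul]; rfl

theorem weylX_comm [FiniteDimensional ℂ V] (a a' : Module.Dual ℂ V) :
    S.weylX a * S.weylX a' = S.weylX a' * S.weylX a :=
  LinearMap.ext fun _ => mul_left_comm _ _ _

theorem weylY_comm [FiniteDimensional ℂ V] (v v' : V) :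
    S.weylY v * S.weylY v' = S.weylY v' * S.weylY v :=
  LinearMap.ext fun p => S.polyY_comm v v' p

theorem weylY_X [FiniteDimensional ℂ V] (v : V) (a : Module.Dual ℂ V) :
    S.weylY v * S.weylX a - S.weylX a * S.weylY v = algebraMap ℂ _ (a (S.proj v)) := by
  refine LinearMap.ext fun p => ?_
  change S.polyY v (S.polyX a * p) - S.polyX a * S.polyY v p = _
  rw [Derivation.leibniz, polyY_polyX, smul_eq_mul, smul_eq_mul, add_sub_cancel_left, mul_comm,
    Module.algebraMap_end_apply, Algebra.smul_def]

variable [Fintype W] {k : W → ℂ} {A : Type*} [Ring A] [Algebra ℂ A]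

/-- The realization of the nontrivial summand. -/
def descend (r : Realization ρ k A) : Realization ρ' k A where
  T := r.T
  X := r.X ∘ₗ S.π.dualMap
  Y := r.Y ∘ₗ S.σ
  T_mul_X g a := by
    change r.T g * r.X (a ∘ₗ S.π) = r.X (ρ'.dual g a ∘ₗ S.π) * r.T g
    rw [r.T_mul_X, S.dual_comp_π]
  T_mul_Y g q := by
    rw [LinearMap.comp_apply, LinearMap.comp_apply, r.T_mul_Y, S.σ_map]
  X_comm _ _ := r.X_comm _ _
  Y_comm _ _ := r.Y_comm _ _
  Y_X q a := by
    refine (r.Y_X (S.σ q) (S.π.dualMap a)).trans ?_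
    simp only [LinearMap.dualMap_apply, map_sub, S.π_σ, S.π_map]

theorem _root_.Cherednik.Realization.Aspherical.descend {r : Realization ρ k A}
    (hr : r.Aspherical) : (S.descend r).Aspherical := hr

/-- The extension of a realization of `ρ'` by polynomial differential operators. -/
def extend [FiniteDimensional ℂ V] (r : Realization ρ' k A) : Realization ρ k
    (A ⊗[ℂ] Module.End ℂ (MvPolynomial (Fin (Module.finrank ℂ V)) ℂ)) where
  T := (Algebra.TensorProduct.includeLeft : A →ₐ[ℂ] _).toMonoidHom.comp r.T
  X := Algebra.TensorProduct.includeLeft.toLinearMap ∘ₗ r.X ∘ₗ S.σ.dualMap +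
    Algebra.TensorProduct.includeRight.toLinearMap ∘ₗ S.weylX
  Y := Algebra.TensorProduct.includeLeft.toLinearMap ∘ₗ r.Y ∘ₗ S.π +
    Algebra.TensorProduct.includeRight.toLinearMap ∘ₗ S.weylY
  T_mul_X g a := by
    have h1 := r.T_mul_X g (a ∘ₗ S.σ)
    rw [← S.dual_comp_σ] at h1
    have h2 : S.weylX (ρ.dual g a) = S.weylX a := by
      simp only [weylX, LinearMap.comp_apply, S.polyX_dual]
    change r.T g ⊗ₜ[ℂ] 1 * (r.X (a ∘ₗ S.σ) ⊗ₜ[ℂ] 1 + 1 ⊗ₜ[ℂ] S.weylX a) =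
      (r.X (ρ.dual g a ∘ₗ S.σ) ⊗ₜ[ℂ] 1 + 1 ⊗ₜ[ℂ] S.weylX (ρ.dual g a)) * r.T g ⊗ₜ[ℂ] 1
    simp only [mul_add, add_mul, Algebra.TensorProduct.tmul_mul_tmul, one_mul, mul_one, h1, h2]
  T_mul_Y g v := by
    have h1 := r.T_mul_Y g (S.π v)
    rw [← S.π_map] at h1
    have h2 : S.weylY (ρ g v) = S.weylY v := by
      simp only [weylY, LinearMap.coe_mk, AddHom.coe_mk, S.polyY_map]
    change r.T g ⊗ₜ[ℂ] 1 * (r.Y (S.π v) ⊗ₜ[ℂ] 1 + 1 ⊗ₜ[ℂ] S.weylY v) =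
      (r.Y (S.π (ρ g v)) ⊗ₜ[ℂ] 1 + 1 ⊗ₜ[ℂ] S.weylY (ρ g v)) * r.T g ⊗ₜ[ℂ] 1
    simp only [mul_add, add_mul, Algebra.TensorProduct.tmul_mul_tmul, one_mul, mul_one, h1, h2]
  X_comm a a' := by
    change (r.X (a ∘ₗ S.σ) ⊗ₜ[ℂ] 1 + 1 ⊗ₜ[ℂ] S.weylX a) * (r.X (a' ∘ₗ S.σ) ⊗ₜ[ℂ] 1 + 1 ⊗ₜ[ℂ] S.weylX a') =
      (r.X (a' ∘ₗ S.σ) ⊗ₜ[ℂ] 1 + 1 ⊗ₜ[ℂ] S.weylX a') * (r.X (a ∘ₗ S.σ) ⊗ₜ[ℂ] 1 + 1 ⊗ₜ[ℂ] S.weylX a)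
    simp only [mul_add, add_mul, Algebra.TensorProduct.tmul_mul_tmul, one_mul, mul_one,
      r.X_comm (a ∘ₗ S.σ), S.weylX_comm a]
    abel
  Y_comm v v' := by
    change (r.Y (S.π v) ⊗ₜ[ℂ] 1 + 1 ⊗ₜ[ℂ] S.weylY v) * (r.Y (S.π v') ⊗ₜ[ℂ] 1 + 1 ⊗ₜ[ℂ] S.weylY v') =
      (r.Y (S.π v') ⊗ₜ[ℂ] 1 + 1 ⊗ₜ[ℂ] S.weylY v') * (r.Y (S.π v) ⊗ₜ[ℂ] 1 + 1 ⊗ₜ[ℂ] S.weylY v)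
    simp only [mul_add, add_mul, Algebra.TensorProduct.tmul_mul_tmul, one_mul, mul_one,
      r.Y_comm (S.π v), S.weylY_comm v]
    abel
  Y_X v a := by
    have e' : a v = (a ∘ₗ S.σ) (S.π v) + a (S.proj v) := by
      rw [LinearMap.comp_apply, ← map_add, S.proj_apply, add_sub_cancel]
    refine (tmul_commutator (r.X (a ∘ₗ S.σ)) (r.Y (S.π v)) (S.weylX a) (S.weylY v)).trans ?_
    rw [r.Y_X, S.weylY_X, e', map_add, TensorProduct.sub_tmul, TensorProduct.sum_tmul,
      sub_add_eq_add_sub]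
    refine congrArg₂ (· - ·) ?_ (Finset.sum_congr rfl fun g _ => ?_)
    · simp only [Algebra.algebraMap_eq_smul_one, TensorProduct.tmul_smul,
        ← TensorProduct.smul_tmul', Algebra.TensorProduct.one_def]
    · rw [S.sub_eq, ← TensorProduct.smul_tmul']
      rfl

theorem _root_.Cherednik.Realization.Aspherical.extend [FiniteDimensional ℂ V]
    {r : Realization ρ' k A} (hr : r.Aspherical) : (S.extend r).Aspherical :=
  hr.map Algebra.TensorProduct.includeLeft

end Splitting

/-- The splitting of `𝔥` into the fixed vectors of a finite subgroup and the quotient. -/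
def quotSplitting (ρ : Representation ℂ W V) (P : Subgroup W) [Fintype P] :
    Splitting (ρ.comp P.subtype : Representation ℂ P V) (quotRep ρ P) where
  π := (fixedSpace ρ P).mkQ
  σ := (fixedSpace ρ P).liftQ (LinearMap.id -
    Representation.averageMap (ρ.comp P.subtype : Representation ℂ P V)) fun v hv => by
      rw [LinearMap.mem_ker, LinearMap.sub_apply, LinearMap.id_apply,
        Representation.averageMap_id _ v hv, sub_self]
  π_σ q := by
    obtain ⟨v, rfl⟩ := (fixedSpace ρ P).mkQ_surjective q
    set ρP : Representation ℂ P V := ρ.comp P.subtype with hρP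
    change (fixedSpace ρ P).mkQ (v - ρP.averageMap v) = (fixedSpace ρ P).mkQ v
    rw [map_sub, sub_eq_self, Submodule.mkQ_apply, Submodule.Quotient.mk_eq_zero]
    exact Representation.averageMap_invariant ρP v
  π_map g v := rfl
  σ_map g q := by
    obtain ⟨v, rfl⟩ := (fixedSpace ρ P).mkQ_surjective q
    set ρP : Representation ℂ P V := ρ.comp P.subtype with hρP
    change ρP g v - ρP.averageMap (ρP g v) = ρP g (v - ρP.averageMap v)
    rw [map_sub, Representation.averageMap_invariant ρP v g, Representation.averageMap,
      ← Representation.asAlgebraHom_single_one, ← Module.End.mul_apply, ← map_mul,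
      GroupAlgebra.mul_average_right]
  fixed g v := by
    set ρP : Representation ℂ P V := ρ.comp P.subtype with hρP
    change ρP g (v - (v - ρP.averageMap v)) = v - (v - ρP.averageMap v)
    rw [sub_sub_cancel]
    exact Representation.averageMap_invariant ρP v g

/-- The coroot of `s ∈ P` is not fixed by `s`, so it survives in `𝔥/𝔥^P` and `θ` is unchanged. -/
theorem coupling_restrict_k [Finite W] {ρ : Representation ℂ W V} (P : Subgroup W)
    (c : Parameter ρ) :
    (Parameter.restrict P c).coupling.k = (c.coupling.restrict P).k := by
  funext p
  by_cases hp : p ∈ reflections (quotRep ρ P)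
  · have hp' := (mem_reflections_quotRep ρ P p).mp hp
    have h1 : (Parameter.restrict P c).coupling.k p =
      (Parameter.restrict P c).1 ⟨p, hp⟩ * theta (quotRep ρ P) ⟨p, hp⟩ := dif_pos hp
    have h2 : (c.coupling.restrict P).k p = c.1 ⟨p, hp'⟩ * theta ρ ⟨p, hp'⟩ := dif_pos hp'
    rw [h1, h2, theta_eq_of_intertwine ρ (quotRep ρ P) ⟨p, hp'⟩ ⟨p, hp⟩ (fixedSpace ρ P).mkQ
      (fun v => rfl)]
    · rfl
    · rw [Submodule.mkQ_apply, Ne, Submodule.Quotient.mk_eq_zero]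
      intro h
      obtain ⟨v, hv⟩ := exists_coroot_eq ρ ⟨(p : W), hp'⟩
      exact coroot_ne_zero ρ ⟨(p : W), hp'⟩ (eq_zero_of_fixed ρ (p : W) hv (h p))
  · have hp' := mt (mem_reflections_quotRep ρ P p).mpr hp
    have h1 : (Parameter.restrict P c).coupling.k p = 0 := dif_neg hp
    have h2 : (c.coupling.restrict P).k p = 0 := dif_neg hp'
    rw [h1, h2]

/-! ### Realizations with a single generalized weight -/

namespace Realization

variable [Fintype W] {ρ : Representation ℂ W V} {k : W → ℂ} {A : Type*} [Ring A] [Algebra ℂ A]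
  (r : Realization ρ k A)

/-- The subalgebra generated by a realization. -/
def subalgebra : Subalgebra ℂ A :=
  Algebra.adjoin ℂ ((LinearMap.range r.X : Set A) ∪ LinearMap.range r.Y ∪ Set.range r.T)

/-- A realization, viewed in the subalgebra that it generates. -/
def corestrict : Realization ρ k r.subalgebra where
  T := r.T.codRestrict r.subalgebra fun g => Algebra.subset_adjoin (Or.inr ⟨g, rfl⟩)
  X := r.X.codRestrict (Subalgebra.toSubmodule r.subalgebra) fun a =>
    Algebra.subset_adjoin (Or.inl (Or.inl ⟨a, rfl⟩))
  Y := r.Y.codRestrict (Subalgebra.toSubmodule r.subalgebra) fun a =>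
    Algebra.subset_adjoin (Or.inl (Or.inr ⟨a, rfl⟩))
  T_mul_X g a := Subtype.ext (r.T_mul_X g a)
  T_mul_Y g a := Subtype.ext (r.T_mul_Y g a)
  X_comm a a' := Subtype.ext (r.X_comm a a')
  Y_comm a a' := Subtype.ext (r.Y_comm a a')
  Y_X b a := by
    refine Subtype.ext ((r.Y_X b a).trans ?_)
    simp
    rfl

theorem Aspherical.corestrict {r : Realization ρ k A} (hr : r.Aspherical) :
    r.corestrict.Aspherical := by
  refine Subtype.ext (Eq.trans ?_ hr)
  rw [AddSubmonoidClass.coe_finsetSum]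
  rfl

theorem corestrict_generates : r.corestrict.Generates := by
  refine Eq.trans ?_ (Algebra.adjoin_adjoin_coe_preimage (R := ℂ)
    (s := (LinearMap.range r.X : Set A) ∪ LinearMap.range r.Y ∪ Set.range r.T))
  refine congrArg (Algebra.adjoin ℂ) (Set.ext fun x => ?_)
  constructor
  · rintro ((⟨a, rfl⟩ | ⟨a, rfl⟩) | ⟨a, rfl⟩)
    · exact Or.inl (Or.inl ⟨a, rfl⟩)
    · exact Or.inl (Or.inr ⟨a, rfl⟩)
    · exact Or.inr ⟨a, rfl⟩
  · rintro ((⟨a, ha⟩ | ⟨a, ha⟩) | ⟨a, ha⟩)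
    · exact Or.inl (Or.inl ⟨a, Subtype.ext ha⟩)
    · exact Or.inl (Or.inr ⟨a, Subtype.ext ha⟩)
    · exact Or.inr ⟨a, Subtype.ext ha⟩

variable {r} in
theorem Generates.shift (hr : r.Generates) {b : V} (hb : ∀ g, ρ g b = b) :
    (r.shift b hb).Generates := by
  rw [Generates, eq_top_iff, ← show _ = ⊤ from hr, Algebra.adjoin_le_iff]
  rintro _ ((⟨a, rfl⟩ | ⟨a, rfl⟩) | ⟨a, rfl⟩)
  · have h : (r.shift b hb).X a + algebraMap ℂ A (a b) = r.X a := sub_add_cancel _ _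
    rw [← h]
    exact add_mem (Algebra.subset_adjoin (Or.inl (Or.inl ⟨a, rfl⟩))) (Subalgebra.algebraMap_mem _ _)
  · exact Algebra.subset_adjoin (Or.inl (Or.inr ⟨a, rfl⟩))
  · exact Algebra.subset_adjoin (Or.inr ⟨a, rfl⟩)

/-- An aspherical realization gives rise to one on which `𝔥*` acts with the single generalized
weight `b`. -/
theorem Aspherical.exists_weight [FiniteDimensional ℂ V] [Nontrivial A] {r : Realization ρ k A}
    (hr : r.Aspherical) {b : V} (hb : ∀ g, ρ g b = b) :
    ∃ J : Ideal r.subalgebra, ∃ r' : Realization ρ k (Module.End ℂ (r.subalgebra ⧸ J)),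
      Nontrivial (r.subalgebra ⧸ J) ∧ r'.Aspherical ∧
        ∀ a m, m ∈ (r'.X a).maxGenEigenspace (a b) := by
  -- Passing to the generated subalgebra makes `one_notMem_span_X` applicable, and the shift by `b`
  -- turns the weight `b` into `0`. In the quotient by the left ideal of the shifted `𝔥*`, the class
  -- of `1` has weight `b`, and local nilpotency spreads this to all vectors.
  set q := r.corestrict with hq
  set s := q.shift b hb with hs
  have hgen : s.Generates := r.corestrict_generates.shift hb
  refine ⟨Ideal.span (LinearMap.range s.X : Set r.subalgebra),
    q.map (Algebra.lsmul ℂ ℂ _), ?_, hr.corestrict.map _, fun a m => ?_⟩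
  · rw [Submodule.Quotient.nontrivial_iff, Ne, Ideal.eq_top_iff_one]
    exact s.one_notMem_span_X hgen
  · obtain ⟨x, rfl⟩ := Submodule.Quotient.mk_surjective _ m
    obtain ⟨n, hn⟩ := s.triangular_swap.exists_pow_smul_eq_zero
      (by rw [Set.union_comm (LinearMap.range s.Y : Set r.subalgebra)]; exact hgen) x
      (Submodule.Quotient.mk (p := Ideal.span (LinearMap.range s.X : Set r.subalgebra)) 1)
      (by
        rintro _ ⟨a, rfl⟩
        refine ⟨1, ?_⟩
        rw [pow_one, ← Submodule.Quotient.mk_smul, Submodule.Quotient.mk_eq_zero, smul_eq_mul,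
          mul_one]
        exact Ideal.subset_span ⟨a, rfl⟩) _ ⟨a, rfl⟩
    rw [Module.End.mem_maxGenEigenspace]
    refine ⟨n, ?_⟩
    have hx : x • Submodule.Quotient.mk (p := Ideal.span (LinearMap.range s.X : Set r.subalgebra))
        1 = Submodule.Quotient.mk x := by
      rw [← Submodule.Quotient.mk_smul, smul_eq_mul, mul_one]
    rw [hx] at hn
    have e : (q.map (Algebra.lsmul ℂ ℂ (r.subalgebra ⧸
        Ideal.span (LinearMap.range s.X : Set r.subalgebra)))).X a - a b • 1 =
        Algebra.lsmul ℂ ℂ _ (s.X a) := by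
      have : s.X a = q.X a - algebraMap ℂ _ (a b) := rfl
      rw [this, map_sub, AlgHom.commutes, Algebra.algebraMap_eq_smul_one]
      rfl
    rw [e, ← map_pow]
    exact hn

end Realization

/-- From the quotient by the spherical ideal of `P`: extend from `𝔥/𝔥^P` to `𝔥`, concentrate at the
point `b` with stabilizer `P`, then induce to `W`. -/
theorem sphericalIdeal_ne_top_of_restrict [Finite W] [FiniteDimensional ℂ V]
    {ρ : Representation ℂ W V} {c : Parameter ρ} {P : Subgroup W} (hP : IsParabolic ρ P)
    (h : sphericalIdeal (quotRep ρ P) (Parameter.restrict P c) ≠ ⊤) : sphericalIdeal ρ c ≠ ⊤ := by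
  have := Fintype.ofFinite W
  have := Fintype.ofFinite P
  obtain ⟨b, hb⟩ := hP
  have : Nontrivial (H (quotRep ρ P) (Parameter.restrict P c) ⧸ sphericalLeftIdeal _ _) :=
    Ideal.Quotient.nontrivial_iff.mpr (sphericalLeftIdeal_ne_top h)
  obtain ⟨r, hr⟩ : ∃ r : Realization (quotRep ρ P) (c.coupling.restrict P).k
      (H (quotRep ρ P) (Parameter.restrict P c) ⧸ sphericalLeftIdeal _ _), r.Aspherical :=
    coupling_restrict_k P c ▸ ⟨quotientRealization, quotientRealization_aspherical⟩
  obtain ⟨J, r', _, hr', hX⟩ := (hr.extend (quotSplitting ρ P)).exists_weight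
    (b := b) fun g => (hb g.1).mp g.2
  exact (hr'.induce hb hX).sphericalIdeal_ne_top

/-! ### Duality -/

/-- The coupling of the dual realization. -/
def Coupling.dagger {ρ : Representation ℂ W V} (κ : Coupling ρ) : Coupling ρ where
  k g := κ.k' g⁻¹
  k' g := κ.k g⁻¹
  α g := κ.α g⁻¹
  β g := (κ.k g⁻¹ / κ.k' g⁻¹) • κ.β g⁻¹
  k_conj h g := by
    rw [← κ.k'_conj h g⁻¹]
    congr 1
    group
  k'_conj h g := by
    rw [← κ.k_conj h g⁻¹]
    congr 1
    group
  k_eq_zero_iff g := (κ.k_eq_zero_iff g⁻¹).symm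
  sub_apply g hg v := by
    have h := κ.compat g⁻¹ v
    rw [inv_inv, κ.sub_apply _ fun h0 => hg ((κ.k_eq_zero_iff _).mp h0)] at h
    rw [smul_comm, div_eq_inv_mul, mul_smul, smul_comm (κ.k g⁻¹), smul_comm _ (κ.α g⁻¹ v),
      smul_comm (κ.α g⁻¹ v), smul_comm (κ.α g⁻¹ v), h, smul_smul, inv_mul_cancel₀ hg, one_smul]
  compat g v := by
    have h := κ.compat g⁻¹ v
    rw [inv_inv] at h
    exact h.symm

namespace Realization

variable [Fintype W] {ρ : Representation ℂ W V} {κ : Coupling ρ} {M : Type*} [AddCommGroup M]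
  [Module ℂ M] (r : Realization ρ κ.k (Module.End ℂ M))

/-- The dual realization. -/
def dual : Realization ρ κ.dagger.k (Module.End ℂ (Module.Dual ℂ M)) where
  T :=
    { toFun := fun g => (r.T g⁻¹).dualMap
      map_one' := by rw [inv_one, map_one]; rfl
      map_mul' := fun g h => by rw [mul_inv_rev, map_mul]; rfl }
  X :=
    { toFun := fun a => (r.X a).dualMap
      map_add' := fun a a' => by rw [map_add]; ext; simp
      map_smul' := fun t a => by rw [map_smul]; ext; simp }
  Y :=
    { toFun := fun v => -(r.Y v).dualMap
      map_add' := fun v v' => by rw [map_add]; ext; simp; ring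
      map_smul' := fun t v => by rw [map_smul]; ext; simp }
  T_mul_X g a := by
    ext φ m
    have h := LinearMap.congr_fun (r.X_T g⁻¹ a) m
    rw [inv_inv] at h
    exact congrArg φ h
  T_mul_Y g v := by
    ext φ m
    have h := LinearMap.congr_fun (r.Y_T g⁻¹ v) m
    rw [inv_inv] at h
    exact congrArg (fun x => -φ x) h
  X_comm a a' := by
    ext φ m
    exact congrArg φ (LinearMap.congr_fun (r.X_comm a' a) m)
  Y_comm v v' := by
    ext φ m
    have := congrArg φ (LinearMap.congr_fun (r.Y_comm v' v) m)
    simpa using this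
  Y_X v a := by
    ext φ m
    have h := congrArg φ (LinearMap.congr_fun (r.Y_X v a) m)
    -- Transposition inverts group elements, and `compat` compensates by exchanging `k` with `k'`;
    -- this dictates the weights of `dagger`.
    have e : ∑ g, (κ.k g * a (v - ρ g v)) • φ (r.T g m) =
        ∑ g, (κ.dagger.k g * a (v - ρ g v)) • φ (r.T g⁻¹ m) := by
      refine Fintype.sum_equiv (Equiv.inv W) _ _ fun g => ?_
      have h1 := congrArg a (κ.dagger.compat g⁻¹ v)
      have h2 : κ.dagger.k' g⁻¹ = κ.k g := congrArg κ.k (inv_inv g)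
      rw [map_smul, map_smul, smul_eq_mul, smul_eq_mul, h2, inv_inv] at h1
      rw [Equiv.inv_apply, h1, inv_inv]
    simp only [LinearMap.sub_apply, Module.End.mul_apply, Module.algebraMap_end_apply,
      LinearMap.sum_apply, LinearMap.smul_apply, map_sub φ, map_sum, map_smul, e] at h
    simp only [LinearMap.sub_apply, Module.End.mul_apply, Module.algebraMap_end_apply,
      LinearMap.sum_apply, LinearMap.smul_apply, LinearMap.coe_mk, AddHom.coe_mk,
      LinearMap.neg_apply, LinearMap.dualMap_apply, MonoidHom.coe_mk, OneHom.coe_mk]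
    rw [← h]
    ring

variable {r} in
theorem Aspherical.dual (hr : r.Aspherical) : r.dual.Aspherical := by
  refine LinearMap.ext fun φ => LinearMap.ext fun m => ?_
  have h : ∑ g, r.T g⁻¹ = 0 := (Fintype.sum_equiv (Equiv.inv W) _ _ fun g => rfl).trans hr
  have h' := congrArg φ (LinearMap.congr_fun h m)
  rw [LinearMap.sum_apply, map_sum, LinearMap.zero_apply, map_zero] at h'
  rw [LinearMap.sum_apply, LinearMap.sum_apply]
  exact h'

theorem dual_X_apply (a : Module.Dual ℂ V) (φ : Module.Dual ℂ M) (m : M) :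
    r.dual.X a φ m = φ (r.X a m) := rfl

theorem mem_weightSpace_dual {b : V} {φ : Module.Dual ℂ M}
    (h : ∀ a m, φ (r.X a m) = a b * φ m) : φ ∈ r.dual.weightSpace b := by
  rw [mem_weightSpace]
  intro a
  refine ⟨1, LinearMap.ext fun m => ?_⟩
  rw [pow_one, LinearMap.sub_apply, LinearMap.sub_apply, dual_X_apply, h]
  exact sub_self _

/-- A realization, viewed as one of the improper subgroup. -/
def restrictTop {A : Type*} [Ring A] [Algebra ℂ A] (r : Realization ρ κ.k A)
    [Fintype (⊤ : Subgroup W)] :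
    Realization (ρ.comp (⊤ : Subgroup W).subtype : Representation ℂ (⊤ : Subgroup W) V)
      (κ.restrict ⊤).k A where
  T := r.T.comp (⊤ : Subgroup W).subtype
  X := r.X
  Y := r.Y
  T_mul_X g a := r.T_mul_X g a
  T_mul_Y g a := r.T_mul_Y g a
  X_comm := r.X_comm
  Y_comm := r.Y_comm
  Y_X v a := by
    rw [r.Y_X]
    congr 1
    exact (Fintype.sum_equiv (Subgroup.topEquiv (G := W)).toEquiv _ _ fun g => rfl).symm

theorem Aspherical.restrictTop {A : Type*} [Ring A] [Algebra ℂ A] {r : Realization ρ κ.k A}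
    [Fintype (⊤ : Subgroup W)] (hr : r.Aspherical) : r.restrictTop.Aspherical :=
  (Fintype.sum_equiv (Subgroup.topEquiv (G := W)).toEquiv _ _ fun _ => rfl).trans hr

end Realization

theorem sphericalIdeal_quotRep_ne_top [Fintype W] {ρ : Representation ℂ W V} {c : Parameter ρ}
    {P : Subgroup W} [Fintype P] {A : Type*} [Ring A] [Algebra ℂ A] [Nontrivial A]
    {r : Realization (ρ.comp P.subtype : Representation ℂ P V) (c.coupling.restrict P).k A}
    (hr : r.Aspherical) : sphericalIdeal (quotRep ρ P) (Parameter.restrict P c) ≠ ⊤ := by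
  obtain ⟨r', hr'⟩ : ∃ r' : Realization (quotRep ρ P) (Parameter.restrict P c).coupling.k A,
      r'.Aspherical :=
    (coupling_restrict_k P c).symm ▸ ⟨_, hr.descend (quotSplitting ρ P)⟩
  exact hr'.sphericalIdeal_ne_top

/-- Gives the inclusion from left to right when `W' = W` is admitted: an aspherical parameter stays
aspherical on `𝔥/𝔥^W`. -/
theorem sphericalIdeal_quotRep_top_ne_top [Finite W] {ρ : Representation ℂ W V}
    {c : Parameter ρ} (h : sphericalIdeal ρ c ≠ ⊤) :
    sphericalIdeal (quotRep ρ ⊤) (Parameter.restrict ⊤ c) ≠ ⊤ := by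
  have := Fintype.ofFinite W
  have := Fintype.ofFinite (⊤ : Subgroup W)
  have : Nontrivial (H ρ c ⧸ sphericalLeftIdeal ρ c) :=
    Ideal.Quotient.nontrivial_iff.mpr (sphericalLeftIdeal_ne_top h)
  exact sphericalIdeal_quotRep_ne_top (quotientRealization_aspherical (c := c)).restrictTop

/-- An aspherical realization with a `ℂ[𝔥]`-eigenfunctional at `b` yields an aspherical realization
of the stabilizer of `b`. -/
theorem sphericalIdeal_quotRep_ne_top_of_functional [Fintype W] {ρ : Representation ℂ W V}
    {c : Parameter ρ} {M : Type*} [AddCommGroup M] [Module ℂ M]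
    {r : Realization ρ c.coupling.k (Module.End ℂ M)} (hr : r.Aspherical) {b : V}
    {φ : Module.Dual ℂ M} (hφ : φ ≠ 0) (h : ∀ a m, φ (r.X a m) = a b * φ m) {P : Subgroup W}
    (hP : ∀ g, g ∈ P ↔ ρ g b = b) :
    sphericalIdeal (quotRep ρ P) (Parameter.restrict P c) ≠ ⊤ := by
  have := Fintype.ofFinite P
  -- A fiber at `b` is a quotient of `M`, whereas restriction uses a weight subspace; in the dual
  -- module `φ` is such a weight vector.
  have : Nontrivial (r.dual.weightSpace b) :=
    ⟨⟨φ, r.mem_weightSpace_dual h⟩, 0, fun h0 => hφ (congrArg Subtype.val h0)⟩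
  -- Dualizing has changed the parameter, so the restricted module is dualized once more.
  have hk : ((c.coupling.dagger.restrict P).dagger).k = (c.coupling.restrict P).k := by
    funext p
    exact congrArg c.coupling.k (inv_inv p.1)
  obtain ⟨r', hr'⟩ : ∃ r' : Realization (ρ.comp P.subtype : Representation ℂ P V)
      (c.coupling.restrict P).k (Module.End ℂ (Module.Dual ℂ (r.dual.weightSpace b))),
      r'.Aspherical := hk ▸ ⟨_, (hr.dual.restrict hP).dual⟩
  exact sphericalIdeal_quotRep_ne_top hr'

/-! ### Supports of finitely generated modules -/

section Support

variable {S : Type*} [CommRing S] [Algebra ℂ S] {M : Type*} [AddCommGroup M] [Module ℂ M]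
  [Module S M] [IsScalarTower ℂ S M] [Module.Finite S M] {x : Module.Dual ℂ V →ₗ[ℂ] S}

/-- If `I M = M`, Nakayama gives an element congruent to `1` modulo `I` in the annihilator, which is
contained in `I`. So `M / I M` is nonzero, and `ℂ[𝔥]` acts on it by the character of the point `b`.
-/
theorem exists_functional_of_character {I : Ideal S} [hI : I.IsMaximal]
    (hle : Module.annihilator S M ≤ I) {χ : S →ₐ[ℂ] ℂ} (hχ : ∀ s, χ s = 0 ↔ s ∈ I) {b : V}
    (hab : ∀ a : Module.Dual ℂ V, a b = χ (x a)) :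
    ∃ φ : Module.Dual ℂ M, φ ≠ 0 ∧ ∀ a m, φ (x a • m) = a b * φ m := by
  have hne : I • (⊤ : Submodule S M) ≠ ⊤ := by
    intro htop
    obtain ⟨s, hs1, hs2⟩ := Submodule.exists_sub_one_mem_and_smul_eq_zero_of_fg_of_le_smul I ⊤
      Module.Finite.fg_top htop.ge
    have hsI : s ∈ I := hle (Module.mem_annihilator.mpr fun m => hs2 m Submodule.mem_top)
    apply hI.ne_top
    rw [Ideal.eq_top_iff_one]
    have := I.sub_mem hsI hs1
    rwa [sub_sub_cancel] at this
  obtain ⟨m₀, hm₀⟩ : ∃ m₀, m₀ ∉ (I • (⊤ : Submodule S M)).restrictScalars ℂ := by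
    by_contra! hall
    exact hne (eq_top_iff.mpr fun m _ => hall m)
  obtain ⟨φ, hφ, hker⟩ := Submodule.exists_le_ker_of_notMem hm₀
  refine ⟨φ, fun h0 => hφ (by rw [h0]; rfl), fun a m => ?_⟩
  have h1 : x a - algebraMap ℂ S (a b) ∈ I := by
    rw [← hχ, map_sub, AlgHom.commutes, hab, Algebra.algebraMap_self, RingHom.id_apply, sub_self]
  have h2 : φ ((x a - algebraMap ℂ S (a b)) • m) = 0 :=
    LinearMap.mem_ker.mp (hker ((Submodule.restrictScalars_mem ℂ _ _).mpr
      (Submodule.smul_mem_smul h1 (Submodule.mem_top (x := m)))))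
  rw [sub_smul, map_sub, algebraMap_smul, map_smul φ (a b), sub_eq_zero, smul_eq_mul] at h2
  exact h2

variable [FiniteDimensional ℂ V]

theorem adjoin_range_finBasis (hx : Algebra.adjoin ℂ (Set.range x) = ⊤) :
    Algebra.adjoin ℂ (Set.range fun i => x (Module.finBasis ℂ (Module.Dual ℂ V) i)) = ⊤ := by
  rw [eq_top_iff, ← hx, Algebra.adjoin_le_iff]
  rintro _ ⟨a, rfl⟩
  rw [← (Module.finBasis ℂ (Module.Dual ℂ V)).sum_repr a, map_sum]
  refine sum_mem fun i _ => ?_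
  rw [map_smul]
  exact Subalgebra.smul_mem _ (Algebra.subset_adjoin (Set.mem_range_self i)) _

theorem finiteType_of_adjoin_range (hx : Algebra.adjoin ℂ (Set.range x) = ⊤) :
    Algebra.FiniteType ℂ S := by
  refine ⟨⟨(Set.finite_range fun i => x (Module.finBasis ℂ (Module.Dual ℂ V) i)).toFinset, ?_⟩⟩
  rw [Set.Finite.coe_toFinset]
  exact adjoin_range_finBasis hx

/-- A finitely generated module whose annihilator contains powers of all linear forms is finite
dimensional. -/
theorem finiteDimensional_of_mem_radical (hx : Algebra.adjoin ℂ (Set.range x) = ⊤)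
    (h : ∀ a, x a ∈ (Module.annihilator S M).radical) : FiniteDimensional ℂ M := by
  set I := Module.annihilator S M with hI
  -- Modulo the annihilator the algebra has finitely many generators, all nilpotent and hence
  -- integral over `ℂ`.
  have hfin : Module.Finite ℂ (S ⧸ I) := by
    have h1 := adjoin_range_finBasis hx
    have h2 := congrArg (Subalgebra.map (Ideal.Quotient.mkₐ ℂ I)) h1
    rw [AlgHom.map_adjoin, Algebra.map_top,
      (AlgHom.range_eq_top _).mpr (Ideal.Quotient.mkₐ_surjective ℂ I)] at h2
    refine ⟨?_⟩
    rw [← Algebra.top_toSubmodule, ← h2]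
    refine fg_adjoin_of_finite ((Set.finite_range _).image _) ?_
    rintro _ ⟨_, ⟨i, rfl⟩, rfl⟩
    obtain ⟨n, hn⟩ := h (Module.finBasis ℂ (Module.Dual ℂ V) i)
    -- The exponent `n` may be `0`; integrality from a power needs a positive one.
    have : (Ideal.Quotient.mkₐ ℂ I (x (Module.finBasis ℂ (Module.Dual ℂ V) i))) ^ (n + 1) = 0 := by
      rw [← map_pow, Ideal.Quotient.mkₐ_eq_mk, Ideal.Quotient.eq_zero_iff_mem, pow_succ]
      exact Ideal.mul_mem_right _ _ hn
    exact IsIntegral.of_pow n.succ_pos (by rw [this]; exact isIntegral_zero)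
  let _ : Module (S ⧸ I) M := Module.quotientAnnihilator
  have : IsScalarTower ℂ (S ⧸ I) M := ⟨fun t q m => by
    obtain ⟨s, rfl⟩ := Ideal.Quotient.mk_surjective q
    exact smul_assoc t s m⟩
  have : IsScalarTower S (S ⧸ I) M := ⟨fun t q m => by
    obtain ⟨s, rfl⟩ := Ideal.Quotient.mk_surjective q
    exact smul_assoc t s m⟩
  have : Module.Finite (S ⧸ I) M := Module.Finite.of_restrictScalars_finite S _ _
  exact Module.Finite.trans (S ⧸ I) M

/-- A maximal ideal of a finitely generated algebra is the kernel of a character. -/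
theorem exists_character [Algebra.FiniteType ℂ S] (I : Ideal S) [hI : I.IsMaximal] :
    ∃ χ : S →ₐ[ℂ] ℂ, ∀ s, χ s = 0 ↔ s ∈ I := by
  let _ : Field (S ⧸ I) := Ideal.Quotient.field I
  have : Module.Finite ℂ (S ⧸ I) := finite_of_finite_type_of_isJacobsonRing ℂ (S ⧸ I)
  let e : ℂ ≃ₐ[ℂ] (S ⧸ I) := AlgEquiv.ofBijective (Algebra.ofId ℂ (S ⧸ I))
    IsAlgClosed.algebraMap_bijective_of_isIntegral
  refine ⟨e.symm.toAlgHom.comp (Ideal.Quotient.mkₐ ℂ I), fun s => ?_⟩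
  rw [← Ideal.Quotient.eq_zero_iff_mem, ← map_eq_zero_iff e.symm e.symm.injective]
  rfl

/-- A finitely generated module over a quotient of `ℂ[𝔥]` is finite dimensional or has a nonzero
fiber at a nonzero point. -/
theorem finiteDimensional_or_exists_functional (hx : Algebra.adjoin ℂ (Set.range x) = ⊤) :
    FiniteDimensional ℂ M ∨ ∃ b : V, b ≠ 0 ∧ ∃ φ : Module.Dual ℂ M, φ ≠ 0 ∧
      ∀ a m, φ (x a • m) = a b * φ m := by
  have := finiteType_of_adjoin_range hx
  have : IsJacobsonRing S := isJacobsonRing_of_finiteType (A := ℂ)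
  by_cases h : ∀ a, x a ∈ (Module.annihilator S M).radical
  · exact Or.inl (finiteDimensional_of_mem_radical hx h)
  right
  push Not at h
  obtain ⟨a₀, ha₀⟩ := h
  -- By the Jacobson property, a form not nilpotent modulo the annihilator avoids some maximal ideal
  -- above it. That form is nonzero at the corresponding point `b`, so `b ≠ 0`.
  rw [Ideal.radical_eq_jacobson, Ideal.jacobson, Submodule.mem_sInf] at ha₀
  push Not at ha₀
  obtain ⟨I, ⟨hle, hI⟩, haI⟩ := ha₀
  obtain ⟨χ, hχ⟩ := exists_character I
  set b : V := (Module.evalEquiv ℂ V).symm (χ.toLinearMap ∘ₗ x) with hb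
  have hab : ∀ a : Module.Dual ℂ V, a b = χ (x a) := fun a => by
    rw [hb, Module.apply_evalEquiv_symm_apply]
    rfl
  refine ⟨b, ?_, ?_⟩
  · rintro h0
    apply haI
    rw [← hχ, ← hab, h0, map_zero]
  · exact exists_functional_of_character hle hχ hab

open scoped IsMulCommutative in
theorem finiteDimensional_or_exists_functional_of_adjoin {A : Type*} [Ring A] [Algebra ℂ A]
    {N : Type*} [AddCommGroup N] [Module ℂ N] [Module A N] [IsScalarTower ℂ A N]
    (y : Module.Dual ℂ V →ₗ[ℂ] A) (hy : ∀ a a', y a * y a' = y a' * y a)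
    (hfin : Module.Finite (Algebra.adjoin ℂ (Set.range y)) N) :
    FiniteDimensional ℂ N ∨ ∃ b : V, b ≠ 0 ∧ ∃ φ : Module.Dual ℂ N, φ ≠ 0 ∧
      ∀ a m, φ (y a • m) = a b * φ m := by
  have : IsMulCommutative (Algebra.adjoin ℂ (Set.range y)) :=
    Algebra.isMulCommutative_adjoin ℂ (by
      rintro _ ⟨a, rfl⟩ _ ⟨a', rfl⟩
      exact hy a a')
  let z : Module.Dual ℂ V →ₗ[ℂ] Algebra.adjoin ℂ (Set.range y) :=
    y.codRestrict (Subalgebra.toSubmodule (Algebra.adjoin ℂ (Set.range y))) fun a =>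
      Algebra.subset_adjoin ⟨a, rfl⟩
  have hz : Algebra.adjoin ℂ (Set.range z) = ⊤ := by
    refine Eq.trans ?_ (Algebra.adjoin_adjoin_coe_preimage (R := ℂ) (s := Set.range y))
    refine congrArg (Algebra.adjoin ℂ) (Set.ext fun p => ?_)
    constructor
    · rintro ⟨a, rfl⟩
      exact ⟨a, rfl⟩
    · rintro ⟨a, ha⟩
      exact ⟨a, Subtype.ext ha⟩
  exact finiteDimensional_or_exists_functional (M := N) hz

end Support

/-! ### The decomposition of the aspherical set -/

theorem isParabolic_top (ρ : Representation ℂ W V) : IsParabolic ρ ⊤ :=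
  ⟨0, fun g => by simp⟩

section Decomposition

variable [Finite W] [FiniteDimensional ℂ V] {ρ : Representation ℂ W V}

theorem mem_asphericalSet_iff_sphericalIdeal_ne_top {c : Parameter ρ} :
    c ∈ asphericalSet ρ ↔ sphericalIdeal ρ c ≠ ⊤ := by
  have := Fintype.ofFinite W
  exact mem_asphericalSet_iff

theorem mem_asphericalSet_of_restrict {c : Parameter ρ} {P : Subgroup W} (hP : IsParabolic ρ P)
    (h : Parameter.restrict P c ∈ asphericalSet (quotRep ρ P)) : c ∈ asphericalSet ρ :=
  mem_asphericalSet_iff_sphericalIdeal_ne_top.mpr (sphericalIdeal_ne_top_of_restrict hP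
    (mem_asphericalSet_iff_sphericalIdeal_ne_top.mp h))

/-- The support of the module over `ℂ[𝔥]` either consists of at most the origin, giving finite
dimension, or contains some `b ≠ 0`, whose stabilizer is proper because no nonzero vector is
`W`-fixed. -/
theorem mem_fdaSet_or_exists_parabolic (hρ : ρ.invariants = ⊥) {c : Parameter ρ}
    (hc : c ∈ asphericalSet ρ) :
    c ∈ fdaSet ρ ∨ ∃ P, (IsParabolic ρ P ∧ P ≠ ⊤) ∧
      Parameter.restrict P c ∈ asphericalSet (quotRep ρ P) := by
  have := Fintype.ofFinite W
  obtain ⟨M, _, _, ⟨hfin, -⟩, hM⟩ := hc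
  let _ : Module ℂ M := Module.compHom M (algebraMap ℂ (H ρ c))
  have : IsScalarTower ℂ (H ρ c) M := ⟨fun t x m => by
    rw [Algebra.smul_def, mul_smul]; rfl⟩
  rcases finiteDimensional_or_exists_functional_of_adjoin (N := M) (universalRealization c).X
      (universalRealization c).X_comm hfin with hfd | ⟨b, hb, φ, hφ, h⟩
  · exact Or.inl ⟨M, _, _, _, inferInstance, hfd, hM⟩
  · right
    let P : Subgroup W :=
      { carrier := {g | ρ g b = b}
        mul_mem' := fun {g h} hg hh => by
          rw [Set.mem_ofPred_eq, map_mul, Module.End.mul_apply, hh, hg]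
        one_mem' := by simp
        inv_mem' := fun {g} hg => by
          have := congrArg (ρ g⁻¹) (show ρ g b = b from hg)
          rw [← Module.End.mul_apply, ← map_mul, inv_mul_cancel, map_one,
            Module.End.one_apply] at this
          exact this.symm }
    have hP : ∀ g, g ∈ P ↔ ρ g b = b := fun _ => Iff.rfl
    refine ⟨P, ⟨⟨b, hP⟩, fun htop => hb ?_⟩, ?_⟩
    · have : b ∈ ρ.invariants := fun g => (hP g).mp (htop ▸ Subgroup.mem_top g)
      rwa [hρ, Submodule.mem_bot] at this
    · rw [mem_asphericalSet_iff_sphericalIdeal_ne_top]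
      have hr : ((universalRealization c).map
          (Algebra.lsmul ℂ ℂ M : H ρ c →ₐ[ℂ] Module.End ℂ M)).Aspherical := by
        ext m
        have h1 := hM.2 m
        rw [idem_eq, smul_assoc, smul_eq_zero] at h1
        have h2 := h1.resolve_left (inv_ne_zero (Nat.cast_ne_zero.mpr Nat.card_pos.ne'))
        rw [Finset.sum_smul] at h2
        rw [LinearMap.sum_apply]
        exact h2
      exact sphericalIdeal_quotRep_ne_top_of_functional hr hφ h hP

end Decomposition

end Cherednik

end

open Cherednik in
theorem mainTheorem4 {W : Type u} [Group W] [Finite W]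
    {V : Type v} [AddCommGroup V] [Module ℂ V] [FiniteDimensional ℂ V]
    (ρ : Representation ℂ W V) (hρ : Function.Injective ρ) :
    (∀ c : Parameter ρ, c ∈ asphericalSet ρ ↔ sphericalIdeal ρ c ≠ ⊤) ∧
    (asphericalSet ρ = fdaSet ρ ∪
      ⋃ P ∈ {P : Subgroup W | IsParabolic ρ P},
        Parameter.restrict P ⁻¹' asphericalSet (quotRep ρ P)) ∧
    (ρ.invariants = ⊥ → asphericalSet ρ = fdaSet ρ ∪
      ⋃ P ∈ {P : Subgroup W | IsParabolic ρ P ∧ P ≠ ⊤},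
        Parameter.restrict P ⁻¹' asphericalSet (quotRep ρ P)) := by
  have := Fintype.ofFinite W
  refine ⟨fun c => mem_asphericalSet_iff_sphericalIdeal_ne_top, ?_, fun hinv => ?_⟩
  · refine Set.Subset.antisymm (fun c hc => Or.inr ?_)
      (Set.union_subset fdaSet_subset_asphericalSet
        (Set.iUnion₂_subset fun P hP c hc => mem_asphericalSet_of_restrict hP hc))
    -- The group `W` is itself parabolic, as the stabilizer of `0`, and this member of the union
    -- already contains the left side.
    exact Set.mem_iUnion₂.mpr ⟨⊤, isParabolic_top ρ,
      mem_asphericalSet_iff_sphericalIdeal_ne_top.mpr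
        (sphericalIdeal_quotRep_top_ne_top (mem_asphericalSet_iff_sphericalIdeal_ne_top.mp hc))⟩
  · refine Set.Subset.antisymm (fun c hc => ?_)
      (Set.union_subset fdaSet_subset_asphericalSet
        (Set.iUnion₂_subset fun P hP c hc => mem_asphericalSet_of_restrict hP.1 hc))
    refine (mem_fdaSet_or_exists_parabolic hinv hc).imp id ?_
    rintro ⟨P, hP, h⟩
    exact Set.mem_iUnion₂.mpr ⟨P, hP, h⟩
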